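/- **Setting.** Let $\mathcal A$ be a finite action set, $\mathcal X$ a covariate space, $d\in\mathbb N$, and let $\mathcal P$ be the law of $(X,(Y(a))_{a\in\mathcal A})$ with $X\in\mathcal X$, $Y(a)\in\mathbb R$; write $\mathcal P_X$ for the law of $X$ and $\mathcal P_{Y\mid X}$ for the conditional law of $(Y(a))_a$ given $X$. Let $\pi(x,\theta)$ ($x\in\mathcal X$, $\theta\in\mathbb R^d$) be a policy (a probability distribution on $\mathcal A$), $w(\theta;x,a)$ a weight and $\ell(\theta;\zeta)$, $\zeta=(x,a,y)$, a loss, all measurable; $\nabla\ell,\nabla^2\ell$ denote derivatives in $\theta$. For $t\ge 1$ the tuples $(X_t,(Y_t(a))_a)$ are i.i.d. with law $\mathcal P$, each independent of the data (including actions) of earlier times; given all data of earlier times and $(X_t,(Y_t(a))_a)$, the action $A_t$ is drawn from $\pi(X_t,\theta_{t-1})$; $\zeta_t=(X_t,A_t,Y_t)$ with $Y_t=Y_t(A_t)$; and, from a deterministic $\theta_0\in\mathbb R^d$, $$\theta_t=\theta_{t-1}-\eta_t w_t\nabla\ell(\theta_{t-1};\zeta_t),\qquad w_t=w(\theta_{t-1};X_t,A_t),$$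 with step sizes $\eta_t>0$, $\sum_t\eta_t=\infty$, $\sum_t\eta_t^2<\infty$ (for instance $\eta_t=\eta_0t^{-\alpha}$, $\eta_0>0$, $\tfrac12<\alpha<1$). Norms are Euclidean for vectors and spectral for matrices. Put $$\mathcal L_{\theta'}(\theta)=\mathbb E\big[w(\theta';X,A)\,\ell(\theta;\zeta)\big],\quad \xi_{\theta'}(\theta;\zeta)=w(\theta';X,A)\nabla\ell(\theta;\zeta)-\nabla\mathcal L_{\theta'}(\theta),$$ where $(X,Y(\cdot))\sim\mathcal P$, $A\sim\pi(X,\theta')$ given $(X,Y(\cdot))$, $\zeta=(X,A,Y(A))$, the expectation is assumed to exist for all $\theta,\theta'$, and $\nabla,\nabla^2$ act on $\theta$. Let $\Delta(x,\theta)=\tfrac12\sum_{a}|\pi(x,\theta)(a)-\pi(x,\theta^*)(a)|$. **Assumptions.** Let $\theta^*\in\mathbb R^d$ and constants $\underline w,\overline w,\delta,\lambda,K$ be such that 1. $0<\underline w<w(\theta;x,a)<\overline w$ for all $\theta,x,a$. 2. For every $\theta'$, $\mathcal L_{\theta'}$ is convex and continuously differentiable on $\mathbb R^d$ and twice continuously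 differentiable at $\theta^*$. Moreover $\delta,\lambda>0$; for all $0<r\le R$, $\inf_{r\le\|\theta-\theta^*\|\le R}\langle\nabla\mathcal L_\theta(\theta),\theta-\theta^*\rangle>0$; and $\langle\nabla\mathcal L_\theta(\theta),\theta-\theta^*\rangle\ge\lambda\|\theta-\theta^*\|^2$ if $\|\theta-\theta^*\|\le\delta$. 3. $\nabla^2\mathcal L_{\theta'}(\theta)$ exists for all $\theta,\theta'$; $H:=\nabla^2\mathcal L_{\theta^*}(\theta^*)$ is positive definite; and $\|\nabla^2\mathcal L_{\theta'}(\theta)-H\|\le K\|\theta-\theta^*\|+K\|\theta'-\theta^*\|$ whenever $\|\theta-\theta^*\|+\|\theta'-\theta^*\|\le2\delta$. 4. There is $\phi\ge0$ on $\mathcal X$ with $0<\mathbb E[\phi(X)]<\infty$ such that, for $\mathcal P_X$-almost every $X$ and all $a,\theta$, $\mathbb E_{\mathcal P_{Y\mid X}}[\|\nabla\ell(\theta;X,a,Y(a))\|^2\mid X]\le\phi(X)(1+\|\theta-\theta^*\|^2)$; and $S:=\mathbb E[\xi_{\theta^*}(\theta^*;\zeta)\xi_{\theta^*}(\theta^*;\zeta)^\top]$,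 with $A\sim\pi(X,\theta^*)$, exists. 5. As $\theta\to\theta^*$: $\mathbb E_{\mathcal P_X}[\Delta(X,\theta)\phi(X)]\to0$; for $\mathcal P_X$-almost every $X$ and all $a$, $\mathbb E_{\mathcal P_{Y\mid X}}[\|\nabla\ell(\theta;X,a,Y(a))-\nabla\ell(\theta^*;X,a,Y(a))\|^2\mid X]\to0$; and for all $a$, $\mathbb E_{\mathcal P_X}[|w(\theta;X,a)-w(\theta^*;X,a)|^2\phi(X)]\to0$. 6. $\nabla^2\ell(\theta;\zeta)$ exists for all $\theta,\zeta$, and there is $\psi\ge0$ on $\mathcal X$ with $\mathbb E[\psi(X)]<\infty$ such that, for $\mathcal P_X$-almost every $X$ and all $a,\theta$, $\mathbb E_{\mathcal P_{Y\mid X}}[\|\nabla^2\ell(\theta;X,a,Y(a))\|^2\mid X]\le\psi(X)(1+\|\theta-\theta^*\|^2)$; and the three limits of 5 hold with $\nabla^2\ell$ in place of $\nabla\ell$ and $\psi$ in place of $\phi$. **Proposition.** Under Assumptions 1–6 the plug-in estimators $$\hat S_n=\frac1n\sum_{t=1}^nw_t^2\,\nabla\ell(\theta_{t-1};\zeta_t)\nabla\ell(\theta_{t-1};\zeta_t)^\top,\qquad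 \hat H_n=\frac1n\sum_{t=1}^nw_t\,\nabla^2\ell(\theta_{t-1};\zeta_t)$$ are consistent: $\hat S_n\to S$ and $\hat H_n\to H$ in probability as $n\to\infty$. -/

import Mathlib

open MeasureTheory ProbabilityTheory Filter Topology
open scoped ENNReal Matrix.Norms.L2Operator

noncomputable section

namespace AdaptiveSGD

/-- The parameter space `ℝ^d` with its Euclidean norm. -/
abbrev Param (d : ℕ) : Type := EuclideanSpace ℝ (Fin d)

/-- The Hessian matrix of `f` at `θ`: entry `(i, j)` is the `j`-th partial derivative of the `i`-th
coordinate of the gradient. The norm on matrices is the spectral norm throughout. -/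
def hessian {d : ℕ} (f : Param d → ℝ) (θ : Param d) : Matrix (Fin d) (Fin d) ℝ :=
  Matrix.of fun i j => (fderiv ℝ (gradient f) θ (EuclideanSpace.single j 1)) i

/-- The matrix `v vᵀ`. -/
def outer {d : ℕ} (v : Param d) : Matrix (Fin d) (Fin d) ℝ :=
  Matrix.of fun i j => v i * v j

/-- A contextual bandit environment with finite action set `𝒜`, a policy, a gradient weight and an
individual loss.
* `env` is the law of `(X, (Y(a))_{a ∈ 𝒜})`;
* `policy (x, θ)` is the distribution of the action given covariate `x` and current estimate `θ`;
* `weight θ x a` is the gradient weight `w(θ; x, a)`;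
* `loss θ (x, a, y)` is the individual loss `ℓ(θ; ζ)` at `ζ = (x, a, y)`. -/
structure Model (d : ℕ) (𝒳 𝒜 : Type*) [MeasurableSpace 𝒳] [MeasurableSpace 𝒜] where
  env : Measure (𝒳 × (𝒜 → ℝ))
  isProbabilityMeasure_env : IsProbabilityMeasure env
  policy : Kernel (𝒳 × Param d) 𝒜
  isMarkovKernel_policy : IsMarkovKernel policy
  weight : Param d → 𝒳 → 𝒜 → ℝ
  measurable_weight : Measurable fun p : Param d × 𝒳 × 𝒜 => weight p.1 p.2.1 p.2.2
  loss : Param d → 𝒳 × 𝒜 × ℝ → ℝ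
  measurable_loss : Measurable fun p : Param d × 𝒳 × 𝒜 × ℝ => loss p.1 p.2

attribute [instance] Model.isProbabilityMeasure_env Model.isMarkovKernel_policy

namespace Model

variable {d : ℕ} {𝒳 𝒜 : Type*} [MeasurableSpace 𝒳] [MeasurableSpace 𝒜]

/-- The stochastic gradient `∇ℓ(θ; ζ)`, with respect to `θ`. -/
def gradLoss (M : Model d 𝒳 𝒜) (θ : Param d) (ζ : 𝒳 × 𝒜 × ℝ) : Param d :=
  gradient (fun ϑ => M.loss ϑ ζ) θ

/-- The stochastic Hessian `∇²ℓ(θ; ζ)`, with respect to `θ`. -/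
def hessLoss (M : Model d 𝒳 𝒜) (θ : Param d) (ζ : 𝒳 × 𝒜 × ℝ) : Matrix (Fin d) (Fin d) ℝ :=
  hessian (fun ϑ => M.loss ϑ ζ) θ

/-- The law of `ζ = (X, A, Y(A))` when `(X, Y(·)) ∼ env` and, given `(X, Y(·))`, the action `A` is
drawn from `policy (X, θ')`. -/
def obsLaw (M : Model d 𝒳 𝒜) (θ' : Param d) : Measure (𝒳 × 𝒜 × ℝ) :=
  (M.env ⊗ₘ Kernel.prodMkRight (𝒜 → ℝ) (M.policy.sectL θ')).map
    fun p => (p.1.1, p.2, p.1.2 p.2)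

/-- The population loss `ℒ_{θ'}(θ) = 𝔼[w(θ'; X, A) ℓ(θ; ζ)]` with `A ∼ π(X, θ')`. -/
def popLoss (M : Model d 𝒳 𝒜) (θ' θ : Param d) : ℝ :=
  ∫ ζ, M.weight θ' ζ.1 ζ.2.1 * M.loss θ ζ ∂(M.obsLaw θ')

/-- `∇ℒ_{θ'}(θ)`, the gradient in `θ`. -/
def gradPopLoss (M : Model d 𝒳 𝒜) (θ' θ : Param d) : Param d :=
  gradient (M.popLoss θ') θ

/-- `∇²ℒ_{θ'}(θ)`, the Hessian in `θ`. -/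
def hessPopLoss (M : Model d 𝒳 𝒜) (θ' θ : Param d) : Matrix (Fin d) (Fin d) ℝ :=
  hessian (M.popLoss θ') θ

/-- `ξ_{θ'}(θ; ζ) = w(θ'; X, A) ∇ℓ(θ; ζ) - ∇ℒ_{θ'}(θ)`. -/
def xi (M : Model d 𝒳 𝒜) (θ' θ : Param d) (ζ : 𝒳 × 𝒜 × ℝ) : Param d :=
  M.weight θ' ζ.1 ζ.2.1 • M.gradLoss θ ζ - M.gradPopLoss θ' θ

/-- `H = ∇²ℒ_{θ*}(θ*)`. -/
def H (M : Model d 𝒳 𝒜) (θstar : Param d) : Matrix (Fin d) (Fin d) ℝ :=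
  M.hessPopLoss θstar θstar

/-- `S = 𝔼[ξ_{θ*}(θ*; ζ) ξ_{θ*}(θ*; ζ)ᵀ]` with `A ∼ π(X, θ*)`, computed entrywise. -/
def S (M : Model d 𝒳 𝒜) (θstar : Param d) : Matrix (Fin d) (Fin d) ℝ :=
  Matrix.of fun i j => ∫ ζ, outer (M.xi θstar θstar ζ) i j ∂(M.obsLaw θstar)

/-- `Δ(x, θ)`, the total variation distance of `π(x, θ)` and `π(x, θ*)`. -/
def tvDist [Fintype 𝒜] (M : Model d 𝒳 𝒜) (θstar : Param d) (x : 𝒳) (θ : Param d) : ℝ :=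
  (1 / 2) * ∑ a, |(M.policy (x, θ)).real {a} - (M.policy (x, θstar)).real {a}|

/-! ### Assumptions

Conditional expectations given `X = x` and `A = a` are integrals against the regular conditional
law `env.condKernel x` of the potential outcomes given `X = x`; statements about the covariate hold
for almost every `x` under the law `env.fst` of `X`. -/

/-- The gradient weight is bounded above and away from zero. -/
structure BoundedWeight (M : Model d 𝒳 𝒜) (wlo whi : ℝ) : Prop where
  pos : 0 < wlo
  lower : ∀ θ x a, wlo < M.weight θ x a
  upper : ∀ θ x a, M.weight θ x a < whi

/-- Regularity of the population loss. `separated` is positivity of `⟨∇ℒ_θ(θ), θ - θ*⟩` for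
`θ ≠ θ*`, uniformly on every compact annulus around `θ*`. -/
structure RegularLoss (M : Model d 𝒳 𝒜) (θstar : Param d) (δ lam : ℝ) : Prop where
  integrable : ∀ θ' θ, Integrable (fun ζ => M.weight θ' ζ.1 ζ.2.1 * M.loss θ ζ) (M.obsLaw θ')
  convex : ∀ θ', ConvexOn ℝ Set.univ (M.popLoss θ')
  contDiff : ∀ θ', ContDiff ℝ 1 (M.popLoss θ')
  twice_contDiffAt : ∀ θ', (∀ᶠ θ in 𝓝 θstar, DifferentiableAt ℝ (M.gradPopLoss θ') θ) ∧
    ContinuousAt (M.hessPopLoss θ') θstar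
  delta_pos : 0 < δ
  lam_pos : 0 < lam
  separated : ∀ r R : ℝ, 0 < r → r ≤ R → ∃ c : ℝ, 0 < c ∧
    ∀ θ, r ≤ ‖θ - θstar‖ → ‖θ - θstar‖ ≤ R → c ≤ inner ℝ (M.gradPopLoss θ θ) (θ - θstar)
  strong : ∀ θ, ‖θ - θstar‖ ≤ δ →
    lam * ‖θ - θstar‖ ^ 2 ≤ inner ℝ (M.gradPopLoss θ θ) (θ - θstar)

/-- The Hessian of the population loss exists, is positive definite at `(θ*, θ*)`, and is
`K`-Lipschitz at `(θ*, θ*)`. -/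
structure RegularHessian (M : Model d 𝒳 𝒜) (θstar : Param d) (δ K : ℝ) : Prop where
  differentiable : ∀ θ', Differentiable ℝ (M.gradPopLoss θ')
  posDef : (M.H θstar).PosDef
  lipschitz : ∀ θ θ', ‖θ - θstar‖ + ‖θ' - θstar‖ ≤ 2 * δ →
    ‖M.hessPopLoss θ' θ - M.hessPopLoss θstar θstar‖ ≤ K * ‖θ - θstar‖ + K * ‖θ' - θstar‖

/-- Second-moment bound on the stochastic gradient, and existence of the Gram matrix. -/
structure GradientMoment [Countable 𝒜] (M : Model d 𝒳 𝒜) (θstar : Param d) (φ : 𝒳 → ℝ) :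
    Prop where
  nonneg : ∀ x, 0 ≤ φ x
  integrable : Integrable φ M.env.fst
  integral_pos : 0 < ∫ x, φ x ∂M.env.fst
  bound : ∀ᵐ x ∂M.env.fst, ∀ a θ,
    ∫⁻ y, ‖M.gradLoss θ (x, a, y a)‖ₑ ^ 2 ∂(M.env.condKernel x) ≤
      ENNReal.ofReal (φ x * (1 + ‖θ - θstar‖ ^ 2))
  gram_exists : ∀ i j, Integrable (fun ζ => outer (M.xi θstar θstar ζ) i j) (M.obsLaw θstar)

/-- Continuity at `θ*` of the policy, of the stochastic gradient and of the weight. -/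
structure GradientContinuity [Fintype 𝒜] (M : Model d 𝒳 𝒜) (θstar : Param d) (φ : 𝒳 → ℝ) :
    Prop where
  tv : Tendsto (fun θ => ∫ x, M.tvDist θstar x θ * φ x ∂M.env.fst) (𝓝 θstar) (𝓝 0)
  grad : ∀ᵐ x ∂M.env.fst, ∀ a, Tendsto
    (fun θ => ∫⁻ y, ‖M.gradLoss θ (x, a, y a) - M.gradLoss θstar (x, a, y a)‖ₑ ^ 2
      ∂(M.env.condKernel x)) (𝓝 θstar) (𝓝 0)
  weight : ∀ a, Tendsto
    (fun θ => ∫ x, |M.weight θ x a - M.weight θstar x a| ^ 2 * φ x ∂M.env.fst) (𝓝 θstar) (𝓝 0)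

/-- The stochastic Hessian exists, has a second-moment bound, and the same continuity conditions
hold with the Hessian in place of the gradient and `ψ` in place of `φ`. -/
structure HessianConditions [Fintype 𝒜] (M : Model d 𝒳 𝒜) (θstar : Param d) (ψ : 𝒳 → ℝ) :
    Prop where
  differentiable_loss : ∀ ζ, Differentiable ℝ fun θ => M.loss θ ζ
  differentiable_grad : ∀ ζ, Differentiable ℝ fun θ => M.gradLoss θ ζ
  nonneg : ∀ x, 0 ≤ ψ x
  integrable : Integrable ψ M.env.fst
  bound : ∀ᵐ x ∂M.env.fst, ∀ a θ,
    ∫⁻ y, ‖M.hessLoss θ (x, a, y a)‖ₑ ^ 2 ∂(M.env.condKernel x) ≤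
      ENNReal.ofReal (ψ x * (1 + ‖θ - θstar‖ ^ 2))
  tv : Tendsto (fun θ => ∫ x, M.tvDist θstar x θ * ψ x ∂M.env.fst) (𝓝 θstar) (𝓝 0)
  hess : ∀ᵐ x ∂M.env.fst, ∀ a, Tendsto
    (fun θ => ∫⁻ y, ‖M.hessLoss θ (x, a, y a) - M.hessLoss θstar (x, a, y a)‖ₑ ^ 2
      ∂(M.env.condKernel x)) (𝓝 θstar) (𝓝 0)
  weight : ∀ a, Tendsto
    (fun θ => ∫ x, |M.weight θ x a - M.weight θstar x a| ^ 2 * ψ x ∂M.env.fst) (𝓝 θstar) (𝓝 0)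

/-! ### The adaptively collected data and the weighted SGD iterates

Data are indexed by `t ≥ 1`; the values at index `0` are never used. -/

variable {Ω : Type*}

/-- The observation `ζ_t = (X_t, A_t, Y_t)` with `Y_t = Y_t(A_t)`. -/
def obs (X : ℕ → Ω → 𝒳) (Y : ℕ → Ω → 𝒜 → ℝ) (A : ℕ → Ω → 𝒜) (t : ℕ) (ω : Ω) : 𝒳 × 𝒜 × ℝ :=
  (X t ω, A t ω, Y t ω (A t ω))

/-- The weighted SGD iterates
`θ_t = θ_{t-1} - η_t w(θ_{t-1}; X_t, A_t) ∇ℓ(θ_{t-1}; ζ_t)` started at `θ₀`. -/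
def sgd (M : Model d 𝒳 𝒜) (η : ℕ → ℝ) (θ₀ : Param d)
    (X : ℕ → Ω → 𝒳) (Y : ℕ → Ω → 𝒜 → ℝ) (A : ℕ → Ω → 𝒜) : ℕ → Ω → Param d
  | 0, _ => θ₀
  | t + 1, ω =>
    sgd M η θ₀ X Y A t ω -
      (η (t + 1) * M.weight (sgd M η θ₀ X Y A t ω) (X (t + 1) ω) (A (t + 1) ω)) •
        M.gradLoss (sgd M η θ₀ X Y A t ω) (obs X Y A (t + 1) ω)

/-- The σ-algebra generated by covariates, actions and all potential outcomes at times
`1, …, t`. -/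
abbrev past (X : ℕ → Ω → 𝒳) (Y : ℕ → Ω → 𝒜 → ℝ) (A : ℕ → Ω → 𝒜) (t : ℕ) : MeasurableSpace Ω :=
  ⨆ s ∈ Finset.Icc 1 t, MeasurableSpace.comap (fun ω => (X s ω, A s ω, Y s ω)) inferInstance

/-- The data are collected adaptively: every `(X_t, Y_t(·))` has law `env` and is independent of the
past (so these tuples are i.i.d.), and given the past and `(X_t, Y_t(·))` the action `A_t` is drawn
from `π(X_t, θ_{t-1})`. -/
structure IsAdaptiveData [MeasurableSpace Ω] (M : Model d 𝒳 𝒜) (η : ℕ → ℝ) (θ₀ : Param d)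
    (μ : Measure Ω) (X : ℕ → Ω → 𝒳) (Y : ℕ → Ω → 𝒜 → ℝ) (A : ℕ → Ω → 𝒜) : Prop where
  measurable_X : ∀ t, Measurable (X t)
  measurable_Y : ∀ t, Measurable (Y t)
  measurable_A : ∀ t, Measurable (A t)
  law : ∀ t, μ.map (fun ω => (X (t + 1) ω, Y (t + 1) ω)) = M.env
  indep : ∀ t, Indep (past X Y A t)
    (MeasurableSpace.comap (fun ω => (X (t + 1) ω, Y (t + 1) ω)) inferInstance) μ
  action : ∀ t a,
    μ[(A (t + 1) ⁻¹' {a}).indicator (fun _ => (1 : ℝ)) | past X Y A t ⊔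
        MeasurableSpace.comap (fun ω => (X (t + 1) ω, Y (t + 1) ω)) inferInstance]
      =ᵐ[μ] fun ω => (M.policy (X (t + 1) ω, M.sgd η θ₀ X Y A t ω)).real {a}

/-- `Ŝ_n = n⁻¹ ∑_{t=1}^n w_t² ∇ℓ(θ_{t-1}; ζ_t) ∇ℓ(θ_{t-1}; ζ_t)ᵀ`; the summation index is
`t - 1`. -/
def Shat (M : Model d 𝒳 𝒜) (η : ℕ → ℝ) (θ₀ : Param d)
    (X : ℕ → Ω → 𝒳) (Y : ℕ → Ω → 𝒜 → ℝ) (A : ℕ → Ω → 𝒜) (n : ℕ) (ω : Ω) :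
    Matrix (Fin d) (Fin d) ℝ :=
  (n : ℝ)⁻¹ • ∑ s ∈ Finset.range n,
    M.weight (M.sgd η θ₀ X Y A s ω) (X (s + 1) ω) (A (s + 1) ω) ^ 2 •
      outer (M.gradLoss (M.sgd η θ₀ X Y A s ω) (obs X Y A (s + 1) ω))

/-- `Ĥ_n = n⁻¹ ∑_{t=1}^n w_t ∇²ℓ(θ_{t-1}; ζ_t)`; the summation index is `t - 1`. -/
def Hhat (M : Model d 𝒳 𝒜) (η : ℕ → ℝ) (θ₀ : Param d)
    (X : ℕ → Ω → 𝒳) (Y : ℕ → Ω → 𝒜 → ℝ) (A : ℕ → Ω → 𝒜) (n : ℕ) (ω : Ω) :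
    Matrix (Fin d) (Fin d) ℝ :=
  (n : ℝ)⁻¹ • ∑ s ∈ Finset.range n,
    M.weight (M.sgd η θ₀ X Y A s ω) (X (s + 1) ω) (A (s + 1) ω) •
      M.hessLoss (M.sgd η θ₀ X Y A s ω) (obs X Y A (s + 1) ω)

end Model

end AdaptiveSGD

end

set_option linter.unusedSectionVars false

noncomputable section

namespace AdaptiveSGD

/-! Every entry of `Shat` and `Hhat` is an average of terms `f (θ_{t-1}) (ζ_t)`, where given the
past `ζ_t` has law `obsLaw θ_{t-1}`. Such averages converge in probability to the mean of `f θstar`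
under `obsLaw θstar` for two reasons: the iterates eventually stay near `θstar` with high
probability, and near `θstar` both `f` and the sampling law are continuous in mean.

Stability. The squared distance `D` to `θstar` satisfies `E[D(θ_{t+1}) | past] + 2 η b(θ_t) ≤ D(θ_t)
+ C η² (D(θ_t) + 1)`, with `η = η_{t+1}` and `b(θ) = ⟨∇ℒ_θ(θ), θ - θstar⟩ ≥ 0`
(`lintegral_sgd_step_add_le`). Summability of `η²` bounds `E D` and the sum of the `η E b`; since `∑
η = ∞`, `E b` is small at arbitrarily late times. At such a time `T`, the positivity of `b` on
annuli makes `D` small with high probability, and a maximal inequality keeps it small afterwards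
(`exists_forall_measure_exit_le`). Almost sure convergence is not needed.

Law of large numbers (`IsKernelDriven.tendstoInMeasure_average`). The products in `Shat` are only
integrable, so `f θstar` is approximated in `L¹` by a simple function `g`. The centred variables
`g(ζ_t)` are bounded and orthogonal, so their averages vanish; the remainder is handled by Markov's
inequality. The finite measure `slotLaw` dominates `obsLaw θ` for every `θ`, so one `L¹` bound
serves all policies.

Identification of the limits. The mean gradient vanishes at `θstar` (`gradPopLoss_self_eq_zero`), so
the uncentred second moment is `S` (`S_apply`). Differentiating twice under the expectation gives
`H` (`H_apply`); this is legitimate because `L²` bounds on derivatives make difference quotients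
uniformly integrable. -/

/-! ### Joint measurability of the stochastic gradient and Hessian. -/

lemma gradient_apply {d : ℕ} (f : Param d → ℝ) (θ : Param d) (i : Fin d) :
    gradient f θ i = fderiv ℝ f θ (EuclideanSpace.single i 1) := by
  have h : gradient f θ i = inner ℝ (gradient f θ) (EuclideanSpace.single i (1 : ℝ)) := by
    rw [EuclideanSpace.inner_single_right]
    simp
  rw [h, gradient, InnerProductSpace.toDual_symm_apply]

/-- A directional derivative of a function that is jointly measurable, and differentiable in the
first variable, is jointly measurable. -/
lemma measurable_fderiv_apply_of_differentiable {E Z : Type*} [NormedAddCommGroup E]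
    [NormedSpace ℝ E] [MeasurableSpace E] [BorelSpace E] [SecondCountableTopology E]
    [MeasurableSpace Z]
    {F : E → Z → ℝ} (hF : Measurable fun p : E × Z => F p.1 p.2)
    (hd : ∀ z, Differentiable ℝ fun θ => F θ z) (v : E) :
    Measurable fun p : E × Z => fderiv ℝ (fun θ => F θ p.2) p.1 v := by
  refine measurable_of_tendsto_metrizable (f := fun (n : ℕ) (p : E × Z) =>
    (n : ℝ) • (F (p.1 + (n : ℝ)⁻¹ • v) p.2 - F p.1 p.2)) (fun n => ?_) ?_
  · exact ((hF.comp (by fun_prop : Measurable fun p : E × Z =>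
      (p.1 + (n : ℝ)⁻¹ • v, p.2))).sub hF).const_smul (n : ℝ)
  · rw [tendsto_pi_nhds]
    intro p
    exact ((hd p.2 p.1).hasFDerivAt.lim_real v).comp tendsto_natCast_atTop_atTop

namespace Model

variable {d : ℕ} {𝒳 𝒜 : Type*} [MeasurableSpace 𝒳] [MeasurableSpace 𝒜]

lemma measurable_gradLoss (M : Model d 𝒳 𝒜) (hd : ∀ ζ, Differentiable ℝ fun θ => M.loss θ ζ) :
    Measurable fun p : Param d × 𝒳 × 𝒜 × ℝ => M.gradLoss p.1 p.2 := by
  have h : Measurable fun p : Param d × 𝒳 × 𝒜 × ℝ => fun i => M.gradLoss p.1 p.2 i := by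
    refine measurable_pi_iff.2 fun i => ?_
    simp only [gradLoss, gradient_apply]
    exact measurable_fderiv_apply_of_differentiable M.measurable_loss hd _
  exact (WithLp.measurable_toLp 2 (Fin d → ℝ)).comp h

lemma hessLoss_apply (M : Model d 𝒳 𝒜) (hd : ∀ ζ, Differentiable ℝ fun θ => M.gradLoss θ ζ)
    (θ : Param d) (ζ : 𝒳 × 𝒜 × ℝ) (i j : Fin d) :
    M.hessLoss θ ζ i j =
      fderiv ℝ (fun ϑ => M.gradLoss ϑ ζ i) θ (EuclideanSpace.single j 1) := by
  have h := ((EuclideanSpace.proj i : Param d →L[ℝ] ℝ).hasFDerivAt.comp θ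
    (hd ζ θ).hasFDerivAt).fderiv
  change _ = fderiv ℝ ((EuclideanSpace.proj i : Param d →L[ℝ] ℝ) ∘ fun ϑ => M.gradLoss ϑ ζ) θ _
  rw [h]
  rfl

lemma measurable_hessLoss_apply (M : Model d 𝒳 𝒜)
    (hd : ∀ ζ, Differentiable ℝ fun θ => M.loss θ ζ)
    (hd' : ∀ ζ, Differentiable ℝ fun θ => M.gradLoss θ ζ) (i j : Fin d) :
    Measurable fun p : Param d × 𝒳 × 𝒜 × ℝ => M.hessLoss p.1 p.2 i j := by
  simp only [M.hessLoss_apply hd']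
  refine measurable_fderiv_apply_of_differentiable
    (F := fun ϑ (z : 𝒳 × 𝒜 × ℝ) => M.gradLoss ϑ z i) ?_ (fun z => ?_) _
  · have := M.measurable_gradLoss hd
    fun_prop
  · exact (EuclideanSpace.proj i : Param d →L[ℝ] ℝ).differentiable.comp (hd' z)

/-! ### The law of an observation and a measure dominating it under every policy. -/

/-- The observation made when action `a` is taken in the environment state `p`. -/
def slot (a : 𝒜) (p : 𝒳 × (𝒜 → ℝ)) : 𝒳 × 𝒜 × ℝ := (p.1, a, p.2 a)

lemma measurable_slot (a : 𝒜) : Measurable (slot (𝒳 := 𝒳) a) := by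
  unfold slot
  fun_prop

variable [Fintype 𝒜] [MeasurableSingletonClass 𝒜]

lemma measurable_eval_uncurry :
    Measurable fun p : (𝒳 × (𝒜 → ℝ)) × 𝒜 => (p.1.1, p.2, p.1.2 p.2) := by
  have : Measurable fun p : (𝒳 × (𝒜 → ℝ)) × 𝒜 => p.1.2 p.2 :=
    measurable_from_prod_countable_left fun a => (measurable_pi_apply a).comp measurable_snd
  fun_prop

lemma measurable_policy_singleton (M : Model d 𝒳 𝒜) (a : 𝒜) :
    Measurable fun p : 𝒳 × Param d => M.policy p {a} :=
  M.policy.measurable_coe (measurableSet_singleton a)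

lemma lintegral_obsLaw (M : Model d 𝒳 𝒜) (θ : Param d) {f : 𝒳 × 𝒜 × ℝ → ℝ≥0∞}
    (hf : Measurable f) :
    ∫⁻ ζ, f ζ ∂(M.obsLaw θ) = ∫⁻ p, ∑ a, M.policy (p.1, θ) {a} * f (slot a p) ∂M.env := by
  have hm := measurable_eval_uncurry (𝒳 := 𝒳) (𝒜 := 𝒜)
  rw [obsLaw, lintegral_map hf hm, Measure.lintegral_compProd
    (f := fun p : (𝒳 × (𝒜 → ℝ)) × 𝒜 => f (p.1.1, p.2, p.1.2 p.2)) (hf.comp hm)]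
  refine lintegral_congr fun p => ?_
  rw [lintegral_fintype]
  refine Finset.sum_congr rfl fun a _ => ?_
  rw [mul_comm]
  rfl

instance (M : Model d 𝒳 𝒜) (θ : Param d) : IsProbabilityMeasure (M.obsLaw θ) :=
  Measure.isProbabilityMeasure_map measurable_eval_uncurry.aemeasurable

/-- The sum over all actions of the law of the corresponding observation; it dominates the law of
the observation under every policy. -/
def slotLaw (M : Model d 𝒳 𝒜) : Measure (𝒳 × 𝒜 × ℝ) := ∑ a, M.env.map (slot a)

lemma lintegral_slotLaw (M : Model d 𝒳 𝒜) {f : 𝒳 × 𝒜 × ℝ → ℝ≥0∞} (hf : Measurable f) :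
    ∫⁻ ζ, f ζ ∂M.slotLaw = ∑ a, ∫⁻ p, f (slot a p) ∂M.env := by
  rw [slotLaw, lintegral_finsetSum_measure]
  exact Finset.sum_congr rfl fun a _ => lintegral_map hf (measurable_slot a)

instance (M : Model d 𝒳 𝒜) : IsFiniteMeasure M.slotLaw := by
  unfold slotLaw
  infer_instance

/-- Each action has probability at most one. The bound is uniform in `θ`, so estimates against
`slotLaw` survive a random, changing policy. -/
lemma obsLaw_le_slotLaw (M : Model d 𝒳 𝒜) (θ : Param d) : M.obsLaw θ ≤ M.slotLaw := by
  refine Measure.le_intro fun s hs _ => ?_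
  rw [← lintegral_indicator_one hs, ← lintegral_indicator_one hs,
    M.lintegral_obsLaw θ (measurable_one.indicator hs),
    M.lintegral_slotLaw (measurable_one.indicator hs), ← lintegral_finsetSum]
  · gcongr with p a
    exact mul_le_of_le_one_left' prob_le_one
  · exact fun a _ => (measurable_one.indicator hs).comp (measurable_slot a)

/-- The law of an observation as a kernel in the parameter of the policy. -/
def obsKernel (M : Model d 𝒳 𝒜) : Kernel (Param d) (𝒳 × 𝒜 × ℝ) where
  toFun := M.obsLaw
  measurable' := by
    refine Measure.measurable_of_measurable_coe _ fun s hs => ?_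
    simp_rw [← lintegral_indicator_one hs, M.lintegral_obsLaw _ (measurable_one.indicator hs)]
    refine Measurable.lintegral_prod_right' (f := fun q : Param d × 𝒳 × (𝒜 → ℝ) =>
      ∑ a, M.policy (q.2.1, q.1) {a} * s.indicator 1 (slot a q.2)) ?_
    refine Finset.measurable_fun_sum _ fun a _ => ?_
    exact ((M.measurable_policy_singleton a).comp (by fun_prop)).mul
      ((measurable_one.indicator hs).comp ((measurable_slot a).comp measurable_snd))

lemma obsKernel_apply (M : Model d 𝒳 𝒜) (θ : Param d) : M.obsKernel θ = M.obsLaw θ := rfl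

instance (M : Model d 𝒳 𝒜) : IsMarkovKernel M.obsKernel :=
  ⟨fun θ => by rw [obsKernel_apply]; infer_instance⟩

end Model

/-! ### The conditional law of adaptively collected data. -/

/-- The indicator of an event may be replaced by its conditional probability when it is integrated
against a function that is measurable with respect to the conditioning σ-algebra. -/
lemma lintegral_indicator_eq_of_condExp {Ω : Type*} {m m₀ : MeasurableSpace Ω} {μ : Measure Ω}
    [IsFiniteMeasure μ] (hm : m ≤ m₀) {s : Set Ω} (hs : MeasurableSet s) {p : Ω → ℝ}
    (hp : Measurable p) (hp0 : ∀ ω, 0 ≤ p ω)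
    (h : μ[s.indicator (fun _ => (1 : ℝ)) | m] =ᵐ[μ] p) {g : Ω → ℝ≥0∞} (hg : Measurable[m] g) :
    ∫⁻ ω, s.indicator g ω ∂μ = ∫⁻ ω, ENNReal.ofReal (p ω) * g ω ∂μ := by
  have hint : Integrable p μ := integrable_condExp.congr h
  -- The defining property of conditional expectation says that the two measures agree on `m`, and
  -- the integral of the `m`-measurable `g` sees only these trims.
  have hmeas : (μ.restrict s).trim hm = (μ.withDensity fun ω => ENNReal.ofReal (p ω)).trim hm := by
    refine @Measure.ext _ m _ _ fun B hB => ?_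
    rw [trim_measurableSet_eq hm hB, trim_measurableSet_eq hm hB,
      Measure.restrict_apply (hm B hB), withDensity_apply _ (hm B hB),
      ← ofReal_integral_eq_lintegral_ofReal hint.integrableOn (ae_of_all _ hp0),
      ← setIntegral_congr_ae (g := p) (hm B hB) (h.mono fun ω hω _ => hω),
      setIntegral_condExp hm ((integrable_const _).indicator hs) hB,
      setIntegral_indicator hs, setIntegral_const, smul_eq_mul, mul_one,
      ofReal_measureReal]
  rw [lintegral_indicator hs, ← lintegral_trim hm hg, hmeas, lintegral_trim hm hg,
    lintegral_withDensity_eq_lintegral_mul _ hp.ennreal_ofReal (hg.mono hm le_rfl)]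
  rfl

/-- The sequence `ζ` is driven by the adapted sequence `θ` through the kernel `κ`: given `F t`, the
law of `ζ t` is `κ (θ t)`. -/
structure IsKernelDriven {Ω P Z : Type*} [MeasurableSpace Ω] [MeasurableSpace P]
    [MeasurableSpace Z] (μ : Measure Ω) (F : ℕ → MeasurableSpace Ω) (θ : ℕ → Ω → P)
    (ζ : ℕ → Ω → Z) (κ : Kernel P Z) : Prop where
  le : ∀ t, F t ≤ ‹MeasurableSpace Ω›
  mono : Monotone F
  measurable_param : ∀ t, Measurable[F t] (θ t)
  measurable_obs : ∀ t, Measurable[F (t + 1)] (ζ t)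
  -- The auxiliary variable `V` encodes conditioning on all of `F t`: it can be the indicator of an
  -- event of `F t`, or a partial sum of earlier increments.
  law : ∀ t (V : Ω → ℝ), Measurable[F t] V →
    μ.map (fun ω => ((θ t ω, V ω), ζ t ω)) =
      (μ.map fun ω => (θ t ω, V ω)) ⊗ₘ κ.prodMkRight ℝ

namespace Model

variable {d : ℕ} {𝒳 𝒜 Ω : Type*} [MeasurableSpace 𝒳] [MeasurableSpace 𝒜]
  {X : ℕ → Ω → 𝒳} {Y : ℕ → Ω → 𝒜 → ℝ} {A : ℕ → Ω → 𝒜}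

lemma past_mono : Monotone (past X Y A) := by
  intro s t hst
  refine iSup₂_le fun r hr => ?_
  refine le_iSup₂_of_le r ?_ le_rfl
  simp only [Finset.mem_Icc] at hr ⊢
  omega

lemma measurable_past_succ (t : ℕ) :
    Measurable[past X Y A (t + 1)] fun ω => (X (t + 1) ω, A (t + 1) ω, Y (t + 1) ω) := by
  rw [measurable_iff_comap_le]
  exact le_iSup₂_of_le (f := fun s (_ : s ∈ Finset.Icc 1 (t + 1)) =>
    MeasurableSpace.comap (fun ω => (X s ω, A s ω, Y s ω)) inferInstance) (t + 1) (by simp) le_rfl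

variable [Fintype 𝒜] [MeasurableSingletonClass 𝒜]

lemma measurable_obs_past (t : ℕ) : Measurable[past X Y A (t + 1)] (obs X Y A (t + 1)) :=
  (measurable_eval_uncurry.comp (by fun_prop : Measurable fun q : 𝒳 × 𝒜 × (𝒜 → ℝ) =>
    ((q.1, q.2.2), q.2.1))).comp (measurable_past_succ t)

lemma measurable_sgd_past (M : Model d 𝒳 𝒜) (hd : ∀ ζ, Differentiable ℝ fun θ => M.loss θ ζ)
    (η : ℕ → ℝ) (θ₀ : Param d) (t : ℕ) :
    Measurable[past X Y A t] (M.sgd η θ₀ X Y A t) := by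
  induction t with
  | zero => exact measurable_const
  | succ t ih =>
    have hθ : Measurable[past X Y A (t + 1)] (M.sgd η θ₀ X Y A t) :=
      ih.mono (past_mono (Nat.le_succ t)) le_rfl
    have hpair := hθ.prodMk (measurable_obs_past (X := X) (Y := Y) (A := A) t)
    have hstep : Measurable fun p : Param d × 𝒳 × 𝒜 × ℝ =>
        p.1 - (η (t + 1) * M.weight p.1 p.2.1 p.2.2.1) • M.gradLoss p.1 p.2 := by
      have h1 := M.measurable_gradLoss hd
      have h2 : Measurable fun p : Param d × 𝒳 × 𝒜 × ℝ => M.weight p.1 p.2.1 p.2.2.1 :=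
        M.measurable_weight.comp (by fun_prop : Measurable fun p : Param d × 𝒳 × 𝒜 × ℝ =>
          (p.1, p.2.1, p.2.2.1))
      fun_prop
    exact hstep.comp hpair

variable [MeasurableSpace Ω]

lemma IsAdaptiveData.past_le {M : Model d 𝒳 𝒜} {η : ℕ → ℝ} {θ₀ : Param d} {μ : Measure Ω}
    (h : M.IsAdaptiveData η θ₀ μ X Y A) (t : ℕ) : past X Y A t ≤ ‹MeasurableSpace Ω› := by
  refine iSup₂_le fun s _ => ?_
  rw [← measurable_iff_comap_le]
  exact (h.measurable_X s).prodMk ((h.measurable_A s).prodMk (h.measurable_Y s))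

/-- The observations are driven by the SGD iterates through the kernel of observation laws. -/
theorem IsAdaptiveData.isKernelDriven {M : Model d 𝒳 𝒜} {η : ℕ → ℝ} {θ₀ : Param d}
    {μ : Measure Ω} [IsProbabilityMeasure μ] (h : M.IsAdaptiveData η θ₀ μ X Y A)
    (hd : ∀ ζ, Differentiable ℝ fun θ => M.loss θ ζ) :
    IsKernelDriven μ (past X Y A) (M.sgd η θ₀ X Y A) (fun t => obs X Y A (t + 1))
      M.obsKernel where
  le := h.past_le
  mono := past_mono
  measurable_param := M.measurable_sgd_past hd η θ₀
  measurable_obs := measurable_obs_past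
  law t V hV := by
    set U : Ω → Param d × ℝ := fun ω => (M.sgd η θ₀ X Y A t ω, V ω) with hU
    set E : Ω → 𝒳 × (𝒜 → ℝ) := fun ω => (X (t + 1) ω, Y (t + 1) ω) with hE
    have hUp : Measurable[past X Y A t] U := (M.measurable_sgd_past hd η θ₀ t).prodMk hV
    have hUm : Measurable U := hUp.mono (h.past_le t) le_rfl
    have hEm : Measurable E := (h.measurable_X _).prodMk (h.measurable_Y _)
    have hobs : Measurable (obs X Y A (t + 1)) :=
      (measurable_obs_past t).mono (h.past_le (t + 1)) le_rfl
    -- Both components of `U` are functions of the past, which is independent of the new environment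
    -- state.
    have hjoint : μ.map (fun ω => (U ω, E ω)) = (μ.map U).prod M.env := by
      rw [← h.law t]
      refine (indepFun_iff_map_prod_eq_prod_map_map hUm.aemeasurable hEm.aemeasurable).1 ?_
      rw [IndepFun_iff_Indep]
      exact indep_of_indep_of_le_left (h.indep t) hUp.comap_le
    refine Measure.ext_of_lintegral _ fun f hf => ?_
    rw [lintegral_map hf (hUm.prodMk hobs), Measure.lintegral_compProd hf]
    have hh : Measurable fun q : (Param d × ℝ) × 𝒳 × (𝒜 → ℝ) =>
        ∑ a, M.policy (q.2.1, q.1.1) {a} * f (q.1, slot a q.2) := by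
      refine Finset.measurable_fun_sum _ fun a _ => ?_
      exact ((M.measurable_policy_singleton a).comp (by fun_prop)).mul
        (hf.comp (measurable_fst.prodMk ((measurable_slot a).comp measurable_snd)))
    have hκ : ∀ u : Param d × ℝ, ∫⁻ z, f (u, z) ∂(M.obsKernel.prodMkRight ℝ u) =
        ∫⁻ p, ∑ a, M.policy (p.1, u.1) {a} * f (u, slot a p) ∂M.env := fun u =>
      M.lintegral_obsLaw u.1 (hf.comp measurable_prodMk_left)
    simp_rw [hκ]
    rw [← lintegral_prod _ hh.aemeasurable, ← hjoint, lintegral_map hh (hUm.prodMk hEm)]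
    -- Splitting by the action taken leaves, beside each indicator, a function of the past and the
    -- environment state only, so the indicator can be replaced by the policy probability.
    have hsplit : ∀ ω, f (U ω, obs X Y A (t + 1) ω) =
        ∑ a, (A (t + 1) ⁻¹' {a}).indicator (fun ω => f (U ω, slot a (E ω))) ω := by
      intro ω
      rw [Finset.sum_eq_single (A (t + 1) ω)]
      · rw [Set.indicator_of_mem (by simp)]
        rfl
      · intro b _ hb
        exact Set.indicator_of_notMem (by simpa using hb.symm) _
      · simp
    have hA : ∀ a, MeasurableSet (A (t + 1) ⁻¹' {a}) := fun a =>
      h.measurable_A _ (measurableSet_singleton a)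
    have hslot : ∀ a, Measurable fun ω => f (U ω, slot a (E ω)) := fun a =>
      hf.comp (hUm.prodMk ((measurable_slot a).comp hEm))
    have hpol : ∀ a, Measurable fun ω => M.policy (X (t + 1) ω, M.sgd η θ₀ X Y A t ω) {a} :=
      fun a => (M.measurable_policy_singleton a).comp
        ((h.measurable_X _).prodMk (measurable_fst.comp hUm))
    change ∫⁻ ω, f (U ω, obs X Y A (t + 1) ω) ∂μ = _
    simp_rw [hsplit]
    rw [lintegral_finsetSum _ fun a _ => (hslot a).indicator (hA a),
      lintegral_finsetSum (f := fun a ω =>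
        M.policy ((E ω).1, (U ω).1) {a} * f (U ω, slot a (E ω))) _
        fun a _ => (hpol a).mul (hslot a)]
    refine Finset.sum_congr rfl fun a _ => ?_
    have hle : past X Y A t ⊔ MeasurableSpace.comap E inferInstance ≤ ‹MeasurableSpace Ω› :=
      sup_le (h.past_le t) hEm.comap_le
    rw [lintegral_indicator_eq_of_condExp hle (hA a) (hpol a).ennreal_toReal
      (fun ω => ENNReal.toReal_nonneg) (h.action t a)]
    · refine lintegral_congr fun ω => ?_
      rw [ENNReal.ofReal_toReal (measure_ne_top _ _)]
    · refine hf.comp (Measurable.prodMk (hUp.mono le_sup_left le_rfl)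
        ((measurable_slot a).comp ?_))
      exact (comap_measurable E).mono le_sup_right le_rfl

end Model

/-! ### Cauchy–Schwarz, uniform integrability and differentiation under the integral. -/

lemma lintegral_mul_sq_le {α : Type*} [MeasurableSpace α] (μ : Measure α) {f g : α → ℝ≥0∞}
    (hf : AEMeasurable f μ) (hg : AEMeasurable g μ) :
    (∫⁻ a, f a * g a ∂μ) ^ 2 ≤ (∫⁻ a, f a ^ 2 ∂μ) * ∫⁻ a, g a ^ 2 ∂μ := by
  have h := ENNReal.lintegral_mul_le_Lp_mul_Lq μ Real.HolderConjugate.two_two hf hg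
  simp only [Pi.mul_apply, ENNReal.rpow_two] at h
  have hsq : ∀ x : ℝ≥0∞, (x ^ (1 / 2 : ℝ)) ^ 2 = x := fun x => by
    rw [← ENNReal.rpow_two, ← ENNReal.rpow_mul]
    norm_num
  calc (∫⁻ a, f a * g a ∂μ) ^ 2
      ≤ ((∫⁻ a, f a ^ 2 ∂μ) ^ (1 / 2 : ℝ) * (∫⁻ a, g a ^ 2 ∂μ) ^ (1 / 2 : ℝ)) ^ 2 := by gcongr
    _ = _ := by rw [mul_pow, hsq, hsq]

lemma lintegral_sq_le {α : Type*} [MeasurableSpace α] (μ : Measure α) {f : α → ℝ≥0∞}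
    (hf : AEMeasurable f μ) :
    (∫⁻ a, f a ∂μ) ^ 2 ≤ (∫⁻ a, f a ^ 2 ∂μ) * μ Set.univ := by
  simpa using lintegral_mul_sq_le μ hf (aemeasurable_const (b := 1))

/-- A sequence that is bounded in `L²` is uniformly integrable. -/
lemma unifIntegrable_one_of_lintegral_sq_le {ι Z : Type*} [MeasurableSpace Z] {ν : Measure Z}
    {f : ι → Z → ℝ} (hf : ∀ n, AEStronglyMeasurable (f n) ν) {C : ℝ} (hC : 0 ≤ C)
    (h : ∀ n, ∫⁻ z, ‖f n z‖ₑ ^ 2 ∂ν ≤ ENNReal.ofReal C) : UnifIntegrable f 1 ν := by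
  intro ε hε
  -- Cauchy–Schwarz bounds the squared integral over `s` by `C * ν s`; the `+ 1` covers `C = 0`.
  refine ⟨ε ^ 2 / (C + 1), by positivity, fun n s hs hνs => ?_⟩
  rw [eLpNorm_one_eq_lintegral_enorm]
  simp_rw [enorm_indicator_eq_indicator_enorm]
  rw [lintegral_indicator hs]
  have h1 : (∫⁻ z in s, ‖f n z‖ₑ ∂ν) ^ 2 ≤ ENNReal.ofReal ε ^ 2 := by
    calc (∫⁻ z in s, ‖f n z‖ₑ ∂ν) ^ 2
        ≤ (∫⁻ z in s, ‖f n z‖ₑ ^ 2 ∂ν) * ν.restrict s Set.univ :=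
          lintegral_sq_le _ (hf n).enorm.restrict
      _ ≤ ENNReal.ofReal C * ENNReal.ofReal (ε ^ 2 / (C + 1)) := by
          rw [Measure.restrict_apply_univ]
          gcongr
          exact (setLIntegral_le_lintegral _ _).trans (h n)
      _ ≤ ENNReal.ofReal (ε ^ 2) := by
          rw [← ENNReal.ofReal_mul hC]
          refine ENNReal.ofReal_le_ofReal ?_
          rw [← mul_div_assoc, div_le_iff₀ (by positivity)]
          nlinarith [sq_nonneg ε]
      _ = ENNReal.ofReal ε ^ 2 := ENNReal.ofReal_pow hε.le 2
  exact (ENNReal.pow_le_pow_left_iff two_ne_zero).1 h1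

/-- The square of an increment is controlled by the integral of the squared derivative. -/
lemma enorm_sub_sq_le_lintegral_deriv {g g' : ℝ → ℝ} (hg : ∀ s, HasDerivAt g (g' s) s)
    (hm : Measurable g') {h : ℝ} (hh : 0 ≤ h) :
    ‖g h - g 0‖ₑ ^ 2 ≤ ENNReal.ofReal h * ∫⁻ s in Set.Ioc 0 h, ‖g' s‖ₑ ^ 2 := by
  have hcs : (∫⁻ s in Set.Ioc 0 h, ‖g' s‖ₑ) ^ 2 ≤
      ENNReal.ofReal h * ∫⁻ s in Set.Ioc 0 h, ‖g' s‖ₑ ^ 2 := by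
    refine (lintegral_sq_le _ hm.enorm.aemeasurable).trans ?_
    rw [Measure.restrict_apply_univ, Real.volume_Ioc, sub_zero, mul_comm]
  refine le_trans ?_ hcs
  gcongr
  -- Otherwise `g'` is integrable on the interval, as the fundamental theorem of calculus requires.
  by_cases htop : ∫⁻ s in Set.Ioc 0 h, ‖g' s‖ₑ = ∞
  · simp [htop]
  have hint : IntervalIntegrable g' volume 0 h := by
    rw [intervalIntegrable_iff_integrableOn_Ioc_of_le hh]
    exact ⟨hm.aestronglyMeasurable, lt_top_iff_ne_top.2 htop⟩
  rw [← intervalIntegral.integral_eq_sub_of_hasDerivAt (fun s _ => hg s) hint,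
    intervalIntegral.integral_of_le hh]
  exact enorm_integral_le_lintegral_enorm _

/-- Differentiation under the integral sign when the derivative is bounded in `L²`. -/
theorem eq_integral_of_hasDerivAt_of_lintegral_sq_le {Z : Type*} [MeasurableSpace Z]
    {ν : Measure Z} [IsFiniteMeasure ν] {g g' : ℝ → Z → ℝ}
    (hm : Measurable fun p : ℝ × Z => g p.1 p.2)
    (hg : ∀ z s, HasDerivAt (fun s => g s z) (g' s z) s) {C : ℝ} (hC : 0 ≤ C)
    (hbound : ∀ s ∈ Set.Icc (0 : ℝ) 1, ∫⁻ z, ‖g' s z‖ₑ ^ 2 ∂ν ≤ ENNReal.ofReal C)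
    (hint : ∀ s, Integrable (g s) ν) {c : ℝ} (hc : HasDerivAt (fun s => ∫ z, g s z ∂ν) c 0) :
    Integrable (g' 0) ν ∧ c = ∫ z, g' 0 z ∂ν := by
  have hm' : Measurable fun p : ℝ × Z => g' p.1 p.2 := by
    have := measurable_fderiv_apply_of_differentiable hm (fun z s => (hg z s).differentiableAt) 1
    convert this using 2 with p
    exact (hg p.2 p.1).hasFDerivAt.fderiv ▸ by simp
  -- Difference quotients with increments `1 / (n + 1)`, which remain in the interval where `hbound`
  -- holds.
  set D : ℕ → Z → ℝ := fun n z => ((n : ℝ) + 1) * (g (((n : ℝ) + 1)⁻¹) z - g 0 z) with hD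
  have hDm : ∀ n, Measurable (D n) := fun n =>
    ((hm.comp measurable_prodMk_left).sub (hm.comp measurable_prodMk_left)).const_mul _
  -- The squared quotient is at most the average of `‖g' s z‖ₑ ^ 2` over `s` in `(0, h]`; by Tonelli
  -- the quotients inherit the `L²` bound of the derivative.
  have hDb : ∀ n, ∫⁻ z, ‖D n z‖ₑ ^ 2 ∂ν ≤ ENNReal.ofReal C := by
    intro n
    have hn : (0 : ℝ) < (n : ℝ) + 1 := by positivity
    set h : ℝ := ((n : ℝ) + 1)⁻¹ with hh
    have hhpos : 0 < h := inv_pos.2 hn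
    have hle1 : h ≤ 1 := inv_le_one_of_one_le₀ (by linarith [(Nat.cast_nonneg n : (0 : ℝ) ≤ n)])
    have hpt : ∀ z, ‖D n z‖ₑ ^ 2 ≤
        ENNReal.ofReal (n + 1) * ∫⁻ s in Set.Ioc 0 h, ‖g' s z‖ₑ ^ 2 := by
      intro z
      have hz := enorm_sub_sq_le_lintegral_deriv (hg z) (hm'.comp measurable_prodMk_right) hhpos.le
      calc ‖D n z‖ₑ ^ 2 = ENNReal.ofReal (n + 1) ^ 2 * ‖g h z - g 0 z‖ₑ ^ 2 := by
            rw [hD, enorm_mul, mul_pow, Real.enorm_of_nonneg hn.le]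
        _ ≤ ENNReal.ofReal (n + 1) ^ 2 *
            (ENNReal.ofReal h * ∫⁻ s in Set.Ioc 0 h, ‖g' s z‖ₑ ^ 2) := by gcongr
        _ = _ := by
            rw [sq, mul_assoc, ← mul_assoc (ENNReal.ofReal (n + 1)) (ENNReal.ofReal h),
              ← ENNReal.ofReal_mul hn.le, mul_inv_cancel₀ hn.ne', ENNReal.ofReal_one, one_mul]
    calc ∫⁻ z, ‖D n z‖ₑ ^ 2 ∂ν
        ≤ ∫⁻ z, (ENNReal.ofReal (n + 1) * ∫⁻ s in Set.Ioc 0 h, ‖g' s z‖ₑ ^ 2) ∂ν :=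
          lintegral_mono hpt
      _ = ENNReal.ofReal (n + 1) * ∫⁻ s in Set.Ioc 0 h, (∫⁻ z, ‖g' s z‖ₑ ^ 2 ∂ν) := by
          rw [lintegral_const_mul' _ _ ENNReal.ofReal_ne_top, lintegral_lintegral_swap]
          exact ((hm'.comp measurable_swap).enorm.pow_const 2).aemeasurable
      _ ≤ ENNReal.ofReal (n + 1) * ∫⁻ _ in Set.Ioc 0 h, ENNReal.ofReal C := by
          gcongr 1
          refine setLIntegral_mono measurable_const fun s hs => ?_
          exact hbound s ⟨hs.1.le, hs.2.trans hle1⟩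
      _ = ENNReal.ofReal C := by
          rw [setLIntegral_const, Real.volume_Ioc, sub_zero, mul_comm (ENNReal.ofReal C), ← mul_assoc,
            ← ENNReal.ofReal_mul hn.le, mul_inv_cancel₀ hn.ne', ENNReal.ofReal_one, one_mul]
  have hinv : Tendsto (fun n : ℕ => (n : ℝ) + 1) atTop atTop :=
    tendsto_atTop_add_const_right _ _ tendsto_natCast_atTop_atTop
  have hlim : ∀ {f : ℝ → ℝ} {f' : ℝ}, HasDerivAt f f' 0 →
      Tendsto (fun n : ℕ => ((n : ℝ) + 1) * (f (((n : ℝ) + 1)⁻¹) - f 0)) atTop (𝓝 f') := by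
    intro f f' hf
    have := (hf.hasFDerivAt.lim_real 1).comp hinv
    simpa [Function.comp_def] using this
  have hg0 : MemLp (g' 0) 1 ν := by
    have hmeas : Measurable (g' 0) := hm'.comp measurable_prodMk_left
    have h2 : MemLp (g' 0) 2 ν := by
      refine ⟨hmeas.aestronglyMeasurable, ?_⟩
      rw [eLpNorm_lt_top_iff_lintegral_rpow_enorm_lt_top two_ne_zero ENNReal.ofNat_ne_top]
      simpa using (hbound 0 (by simp)).trans_lt ENNReal.ofReal_lt_top
    exact h2.mono_exponent one_le_two
  -- Vitali: pointwise convergence together with uniform integrability gives convergence in `L¹`.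
  have hconv := tendsto_Lp_finite_of_tendsto_ae le_rfl ENNReal.one_ne_top
    (fun n => (hDm n).aestronglyMeasurable) hg0
    (unifIntegrable_one_of_lintegral_sq_le (fun n => (hDm n).aestronglyMeasurable) hC hDb)
    (ae_of_all _ fun z => hlim (hg z 0))
  have hDint : ∀ n, Integrable (D n) ν := fun n => ((hint _).sub (hint _)).const_mul _
  have h1 := tendsto_integral_of_L1' (g' 0) hg0.1
    (Eventually.of_forall hDint) hconv
  refine ⟨memLp_one_iff_integrable.1 hg0, tendsto_nhds_unique (hlim hc) (h1.congr fun n => ?_)⟩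
  rw [hD, integral_const_mul, integral_sub (hint _) (hint _)]

/-! ### Mean-square continuity of weighted statistics at `θstar`. -/

lemma two_mul_ofReal (x : ℝ) : 2 * ENNReal.ofReal x = ENNReal.ofReal (2 * x) := by
  rw [ENNReal.ofReal_mul zero_le_two, ENNReal.ofReal_ofNat]

lemma enorm_sub_sq_le (a b : ℝ) : ‖a - b‖ₑ ^ 2 ≤ 2 * ‖a‖ₑ ^ 2 + 2 * ‖b‖ₑ ^ 2 := by
  have h : ∀ c : ℝ, ‖c‖ₑ ^ 2 = ENNReal.ofReal (c ^ 2) := fun c => by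
    rw [← ofReal_norm, ← ENNReal.ofReal_pow (norm_nonneg _), Real.norm_eq_abs, sq_abs]
  rw [h, h, h, two_mul_ofReal, two_mul_ofReal, ← ENNReal.ofReal_add (by positivity) (by positivity)]
  exact ENNReal.ofReal_le_ofReal (by nlinarith [sq_nonneg (a + b)])

lemma enorm_mul_sub_mul_sq_le (w w₀ k k₀ : ℝ) :
    ‖w * k - w₀ * k₀‖ₑ ^ 2 ≤ 2 * (‖w‖ₑ ^ 2 * ‖k - k₀‖ₑ ^ 2) + 2 * (‖w - w₀‖ₑ ^ 2 * ‖k₀‖ₑ ^ 2) := by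
  have h := enorm_sub_sq_le (w * (k - k₀)) (-((w - w₀) * k₀))
  rw [enorm_neg, enorm_mul, enorm_mul, mul_pow, mul_pow] at h
  convert h using 3
  ring_nf

/-- The form in which Cauchy–Schwarz turns mean-square convergence into convergence in mean. -/
lemma tendsto_zero_of_sq_le {ι : Type*} {l : Filter ι} {u v : ι → ℝ≥0∞} (hv : Tendsto v l (𝓝 0))
    (h : ∀ i, u i ^ 2 ≤ v i) : Tendsto u l (𝓝 0) := by
  have hsq : Tendsto (fun i => u i ^ 2) l (𝓝 0) :=
    tendsto_of_tendsto_of_tendsto_of_le_of_le tendsto_const_nhds hv (fun _ => zero_le) h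
  have := (ENNReal.continuous_rpow_const (y := 1 / 2)).tendsto 0 |>.comp hsq
  rw [ENNReal.zero_rpow_of_pos (by norm_num)] at this
  refine this.congr fun i => ?_
  simp only [Function.comp_apply]
  rw [← ENNReal.rpow_two, ← ENNReal.rpow_mul]
  norm_num

namespace Model

variable {d : ℕ} {𝒳 𝒜 : Type*} [MeasurableSpace 𝒳] [MeasurableSpace 𝒜]
  [Fintype 𝒜] [MeasurableSingletonClass 𝒜]

lemma lintegral_slotLaw_eq_condKernel (M : Model d 𝒳 𝒜) {f : 𝒳 × 𝒜 × ℝ → ℝ≥0∞}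
    (hf : Measurable f) :
    ∫⁻ z, f z ∂M.slotLaw =
      ∑ a, ∫⁻ x, ∫⁻ y, f (x, a, y a) ∂(M.env.condKernel x) ∂M.env.fst := by
  rw [M.lintegral_slotLaw hf]
  refine Finset.sum_congr rfl fun a _ => ?_
  exact (Measure.lintegral_condKernel (hf.comp (measurable_slot a))).symm

lemma lintegral_slotLaw_le (M : Model d 𝒳 𝒜) {φ : 𝒳 → ℝ} (hφ : ∀ x, 0 ≤ φ x)
    (hφi : Integrable φ M.env.fst) {f : 𝒳 × 𝒜 × ℝ → ℝ≥0∞} (hf : Measurable f) {c : ℝ}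
    (hc : 0 ≤ c) (h : ∀ᵐ x ∂M.env.fst, ∀ a, ∫⁻ y, f (x, a, y a) ∂(M.env.condKernel x) ≤
      ENNReal.ofReal (φ x * c)) :
    ∫⁻ z, f z ∂M.slotLaw ≤
      ENNReal.ofReal (Fintype.card 𝒜 * (∫ x, φ x ∂M.env.fst) * c) := by
  rw [M.lintegral_slotLaw_eq_condKernel hf]
  calc ∑ a, ∫⁻ x, ∫⁻ y, f (x, a, y a) ∂(M.env.condKernel x) ∂M.env.fst
      ≤ ∑ _a : 𝒜, ∫⁻ x, ENNReal.ofReal (φ x * c) ∂M.env.fst := by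
        gcongr 1 with a
        exact lintegral_mono_ae (h.mono fun x hx => hx a)
    _ = _ := by
        rw [← ofReal_integral_eq_lintegral_ofReal (hφi.mul_const c)
          (ae_of_all _ fun x => mul_nonneg (hφ x) hc), integral_mul_const, Finset.sum_const,
          nsmul_eq_mul, Finset.card_univ, mul_assoc, ENNReal.ofReal_mul (Nat.cast_nonneg _),
          ENNReal.ofReal_natCast]

/-- A real-valued statistic `k θ ζ` with a conditional second-moment bound and with the continuity
conditions that the model imposes on the entries of the gradient and of the Hessian. -/
structure RegularStatistic (M : Model d 𝒳 𝒜) (θstar : Param d) (φ : 𝒳 → ℝ)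
    (k : Param d → 𝒳 × 𝒜 × ℝ → ℝ) : Prop where
  measurable : Measurable fun p : Param d × 𝒳 × 𝒜 × ℝ => k p.1 p.2
  nonneg : ∀ x, 0 ≤ φ x
  integrable : Integrable φ M.env.fst
  bound : ∀ᵐ x ∂M.env.fst, ∀ a θ, ∫⁻ y, ‖k θ (x, a, y a)‖ₑ ^ 2 ∂(M.env.condKernel x) ≤
    ENNReal.ofReal (φ x * (1 + ‖θ - θstar‖ ^ 2))
  tv : Tendsto (fun θ => ∫ x, M.tvDist θstar x θ * φ x ∂M.env.fst) (𝓝 θstar) (𝓝 0)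
  cont : ∀ᵐ x ∂M.env.fst, ∀ a, Tendsto
    (fun θ => ∫⁻ y, ‖k θ (x, a, y a) - k θstar (x, a, y a)‖ₑ ^ 2 ∂(M.env.condKernel x))
    (𝓝 θstar) (𝓝 0)
  weight : ∀ a, Tendsto
    (fun θ => ∫ x, |M.weight θ x a - M.weight θstar x a| ^ 2 * φ x ∂M.env.fst) (𝓝 θstar) (𝓝 0)

/-- The statistic `k` multiplied by the gradient weight. -/
def weighted (M : Model d 𝒳 𝒜) (k : Param d → 𝒳 × 𝒜 × ℝ → ℝ) (θ : Param d)
    (z : 𝒳 × 𝒜 × ℝ) : ℝ :=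
  M.weight θ z.1 z.2.1 * k θ z

lemma measurable_weight_obs (M : Model d 𝒳 𝒜) :
    Measurable fun p : Param d × 𝒳 × 𝒜 × ℝ => M.weight p.1 p.2.1 p.2.2.1 :=
  M.measurable_weight.comp (by fun_prop : Measurable fun p : Param d × 𝒳 × 𝒜 × ℝ =>
    (p.1, p.2.1, p.2.2.1))

lemma BoundedWeight.enorm_le {M : Model d 𝒳 𝒜} {wlo whi : ℝ} (h : M.BoundedWeight wlo whi)
    (θ : Param d) (x : 𝒳) (a : 𝒜) : ‖M.weight θ x a‖ₑ ≤ ENNReal.ofReal whi := by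
  rw [Real.enorm_of_nonneg (h.pos.le.trans (h.lower θ x a).le)]
  exact ENNReal.ofReal_le_ofReal (h.upper θ x a).le

lemma measurable_policy_real (M : Model d 𝒳 𝒜) (θ : Param d) (a : 𝒜) :
    Measurable fun x => (M.policy (x, θ)).real {a} :=
  ((M.measurable_policy_singleton a).comp (by fun_prop)).ennreal_toReal

lemma enorm_policy_sub_le_one (M : Model d 𝒳 𝒜) (θ θ' : Param d) (x : 𝒳) (a : 𝒜) :
    ‖(M.policy (x, θ)).real {a} - (M.policy (x, θ')).real {a}‖ₑ ≤ 1 := by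
  rw [← ofReal_norm, ENNReal.ofReal_le_one, Real.norm_eq_abs, abs_le]
  have h1 := measureReal_le_one (μ := M.policy (x, θ)) (s := {a})
  have h2 := measureReal_le_one (μ := M.policy (x, θ')) (s := {a})
  have h3 := measureReal_nonneg (μ := M.policy (x, θ)) (s := {a})
  have h4 := measureReal_nonneg (μ := M.policy (x, θ')) (s := {a})
  constructor <;> linarith

lemma measurable_tvDist (M : Model d 𝒳 𝒜) (θstar θ : Param d) :
    Measurable fun x => M.tvDist θstar x θ := by
  unfold tvDist
  refine Measurable.const_mul (Finset.measurable_fun_sum _ fun a _ => ?_) _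
  exact ((M.measurable_policy_real θ a).sub (M.measurable_policy_real θstar a)).abs

lemma abs_policy_sub_le_tvDist (M : Model d 𝒳 𝒜) (θstar θ : Param d) (x : 𝒳) (a : 𝒜) :
    |(M.policy (x, θ)).real {a} - (M.policy (x, θstar)).real {a}| ≤ 2 * M.tvDist θstar x θ := by
  rw [tvDist, ← mul_assoc]
  norm_num
  exact Finset.single_le_sum (f := fun a =>
    |(M.policy (x, θ)).real {a} - (M.policy (x, θstar)).real {a}|) (fun _ _ => abs_nonneg _)
    (Finset.mem_univ a)

lemma tvDist_nonneg (M : Model d 𝒳 𝒜) (θstar θ : Param d) (x : 𝒳) : 0 ≤ M.tvDist θstar x θ := by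
  unfold tvDist
  positivity

lemma integrable_tvDist_mul (M : Model d 𝒳 𝒜) (θstar θ : Param d) {φ : 𝒳 → ℝ}
    (hφ : Integrable φ M.env.fst) :
    Integrable (fun x => M.tvDist θstar x θ * φ x) M.env.fst := by
  refine hφ.bdd_mul (c := Fintype.card 𝒜) (M.measurable_tvDist θstar θ).aestronglyMeasurable
    (ae_of_all _ fun x => ?_)
  rw [Real.norm_of_nonneg (M.tvDist_nonneg θstar θ x), tvDist]
  have : ∑ a, |(M.policy (x, θ)).real {a} - (M.policy (x, θstar)).real {a}| ≤
      ∑ _a : 𝒜, (1 : ℝ) := by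
    refine Finset.sum_le_sum fun a _ => ?_
    have := M.enorm_policy_sub_le_one θ θstar x a
    rwa [← ofReal_norm, ENNReal.ofReal_le_one] at this
  rw [Finset.sum_const, Finset.card_univ, nsmul_eq_mul, mul_one] at this
  have h0 : 0 ≤ ∑ a, |(M.policy (x, θ)).real {a} - (M.policy (x, θstar)).real {a}| := by positivity
  linarith

namespace RegularStatistic

variable {M : Model d 𝒳 𝒜} {θstar : Param d} {φ : 𝒳 → ℝ} {k : Param d → 𝒳 × 𝒜 × ℝ → ℝ}
  {wlo whi : ℝ}

lemma measurable_apply (hk : M.RegularStatistic θstar φ k) (θ : Param d) : Measurable (k θ) :=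
  hk.measurable.comp measurable_prodMk_left

lemma measurable_weighted (hk : M.RegularStatistic θstar φ k) :
    Measurable fun p : Param d × 𝒳 × 𝒜 × ℝ => M.weighted k p.1 p.2 :=
  M.measurable_weight_obs.mul hk.measurable

lemma measurable_weighted_apply (hk : M.RegularStatistic θstar φ k) (θ : Param d) :
    Measurable (M.weighted k θ) :=
  hk.measurable_weighted.comp measurable_prodMk_left

lemma lintegral_sq_le (hk : M.RegularStatistic θstar φ k) (θ : Param d) :
    ∫⁻ z, ‖k θ z‖ₑ ^ 2 ∂M.slotLaw ≤
      ENNReal.ofReal (Fintype.card 𝒜 * (∫ x, φ x ∂M.env.fst) * (1 + ‖θ - θstar‖ ^ 2)) :=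
  M.lintegral_slotLaw_le hk.nonneg hk.integrable ((hk.measurable_apply θ).enorm.pow_const 2)
    (by positivity) (hk.bound.mono fun _ hx a => hx a θ)

/-- The weight has its own parameter because `popLoss θ'` is differentiated in `θ` with the weight
and the policy frozen at `θ'`. -/
lemma lintegral_weighted_sq_le (hk : M.RegularStatistic θstar φ k)
    (hw : M.BoundedWeight wlo whi) (θ θ' : Param d) {κ : Measure (𝒳 × 𝒜 × ℝ)}
    (hκ : κ ≤ M.slotLaw) :
    ∫⁻ z, ‖M.weight θ' z.1 z.2.1 * k θ z‖ₑ ^ 2 ∂κ ≤ ENNReal.ofReal whi ^ 2 *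
      ENNReal.ofReal (Fintype.card 𝒜 * (∫ x, φ x ∂M.env.fst) * (1 + ‖θ - θstar‖ ^ 2)) := by
  calc ∫⁻ z, ‖M.weight θ' z.1 z.2.1 * k θ z‖ₑ ^ 2 ∂κ
      ≤ ∫⁻ z, ENNReal.ofReal whi ^ 2 * ‖k θ z‖ₑ ^ 2 ∂M.slotLaw := by
        refine lintegral_mono' hκ fun z => ?_
        rw [enorm_mul, mul_pow]
        gcongr
        exact hw.enorm_le _ _ _
    _ ≤ _ := by
        rw [lintegral_const_mul _ ((hk.measurable_apply θ).enorm.pow_const 2)]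
        gcongr
        exact hk.lintegral_sq_le θ

lemma memLp_weighted (hk : M.RegularStatistic θstar φ k) (hw : M.BoundedWeight wlo whi)
    (θ : Param d) : MemLp (M.weighted k θ) 2 M.slotLaw := by
  refine ⟨(hk.measurable_weighted_apply θ).aestronglyMeasurable, ?_⟩
  rw [eLpNorm_lt_top_iff_lintegral_rpow_enorm_lt_top two_ne_zero ENNReal.ofNat_ne_top]
  have := hk.lintegral_weighted_sq_le hw θ θ le_rfl
  simpa [weighted] using this.trans_lt (ENNReal.mul_lt_top (by simp) ENNReal.ofReal_lt_top)

/-- The statistic is continuous at `θstar` in `L²`. -/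
lemma tendsto_lintegral_sub_sq (hk : M.RegularStatistic θstar φ k) :
    Tendsto (fun θ => ∫⁻ z, ‖k θ z - k θstar z‖ₑ ^ 2 ∂M.slotLaw) (𝓝 θstar) (𝓝 0) := by
  have hm : ∀ θ, Measurable fun z => ‖k θ z - k θstar z‖ₑ ^ 2 := fun θ =>
    ((hk.measurable_apply θ).sub (hk.measurable_apply θstar)).enorm.pow_const 2
  simp_rw [fun θ => M.lintegral_slotLaw_eq_condKernel (hm θ)]
  rw [← Finset.sum_const_zero (s := (Finset.univ : Finset 𝒜))]
  refine tendsto_finsetSum _ fun a _ => ?_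
  rw [← lintegral_zero (μ := M.env.fst)]
  -- Dominated convergence over the covariate. Within distance one of `θstar` the conditional second
  -- moment of the difference is at most `2 * (2 * φ x) + 2 * φ x = 6 * φ x`.
  refine tendsto_lintegral_filter_of_dominated_convergence
    (fun x => ENNReal.ofReal (6 * φ x)) (Eventually.of_forall fun θ => ?_) ?_ ?_ ?_
  · exact Measurable.lintegral_kernel_prod_right'
      (f := fun p : 𝒳 × (𝒜 → ℝ) => ‖k θ (slot a p) - k θstar (slot a p)‖ₑ ^ 2)
      ((hm θ).comp (measurable_slot a))
  · filter_upwards [Metric.ball_mem_nhds θstar one_pos] with θ hθ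
    rw [Metric.mem_ball, dist_eq_norm] at hθ
    filter_upwards [hk.bound] with x hx
    have hmy : Measurable fun y : 𝒜 → ℝ => 2 * ‖k θ (x, a, y a)‖ₑ ^ 2 :=
      (((hk.measurable_apply θ).comp ((measurable_slot a).comp
        measurable_prodMk_left)).enorm.pow_const 2).const_mul _
    calc ∫⁻ y, ‖k θ (x, a, y a) - k θstar (x, a, y a)‖ₑ ^ 2 ∂(M.env.condKernel x)
        ≤ ∫⁻ y, 2 * ‖k θ (x, a, y a)‖ₑ ^ 2 + 2 * ‖k θstar (x, a, y a)‖ₑ ^ 2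
            ∂(M.env.condKernel x) := lintegral_mono fun y => enorm_sub_sq_le _ _
      _ = 2 * (∫⁻ y, ‖k θ (x, a, y a)‖ₑ ^ 2 ∂(M.env.condKernel x)) +
          2 * ∫⁻ y, ‖k θstar (x, a, y a)‖ₑ ^ 2 ∂(M.env.condKernel x) := by
        rw [lintegral_add_left hmy, lintegral_const_mul' _ _ (by simp),
          lintegral_const_mul' _ _ (by simp)]
      _ ≤ 2 * ENNReal.ofReal (φ x * (1 + ‖θ - θstar‖ ^ 2)) +
          2 * ENNReal.ofReal (φ x * (1 + ‖θstar - θstar‖ ^ 2)) := by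
        gcongr
        exacts [hx a θ, hx a θstar]
      _ ≤ ENNReal.ofReal (6 * φ x) := by
        have h0 := hk.nonneg x
        rw [two_mul_ofReal, two_mul_ofReal, ← ENNReal.ofReal_add (by positivity) (by positivity)]
        refine ENNReal.ofReal_le_ofReal ?_
        rw [sub_self, norm_zero]
        have : ‖θ - θstar‖ ^ 2 ≤ 1 := pow_le_one₀ (norm_nonneg _) hθ.le
        nlinarith
  · exact (hk.integrable.const_mul 6).lintegral_lt_top.ne
  · filter_upwards [hk.cont] with x hx
    exact hx a

/-- The weighted statistic is continuous at `θstar` in `L²`. -/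
lemma tendsto_lintegral_weighted_sub_sq (hk : M.RegularStatistic θstar φ k)
    (hw : M.BoundedWeight wlo whi) :
    Tendsto (fun θ => ∫⁻ z, ‖M.weighted k θ z - M.weighted k θstar z‖ₑ ^ 2 ∂M.slotLaw)
      (𝓝 θstar) (𝓝 0) := by
  have hmw : ∀ θ, Measurable fun z : 𝒳 × 𝒜 × ℝ =>
      ‖M.weight θ z.1 z.2.1 - M.weight θstar z.1 z.2.1‖ₑ ^ 2 := fun θ =>
    ((M.measurable_weight_obs.comp measurable_prodMk_left).sub
      (M.measurable_weight_obs.comp measurable_prodMk_left)).enorm.pow_const 2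
  have hmk : ∀ θ, Measurable fun z => ‖k θ z - k θstar z‖ₑ ^ 2 := fun θ =>
    ((hk.measurable_apply θ).sub (hk.measurable_apply θstar)).enorm.pow_const 2
  have hmks : Measurable fun z => ‖k θstar z‖ₑ ^ 2 := (hk.measurable_apply _).enorm.pow_const 2
  -- The weights depend only on the covariate and the action, so their difference leaves the
  -- conditional integral, and `φ` bounds what remains.
  have hsecond : ∀ θ, ∫⁻ z, ‖M.weight θ z.1 z.2.1 - M.weight θstar z.1 z.2.1‖ₑ ^ 2 *
      ‖k θstar z‖ₑ ^ 2 ∂M.slotLaw ≤ ∑ a, ENNReal.ofReal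
        (∫ x, |M.weight θ x a - M.weight θstar x a| ^ 2 * φ x ∂M.env.fst) := by
    intro θ
    refine (M.lintegral_slotLaw_eq_condKernel ((hmw θ).mul hmks)).trans_le ?_
    gcongr 1 with a
    have hmwx : Measurable fun x => |M.weight θ x a - M.weight θstar x a| ^ 2 :=
      ((M.measurable_weight.comp (by fun_prop : Measurable fun x : 𝒳 => (θ, x, a))).sub
        (M.measurable_weight.comp (by fun_prop : Measurable fun x : 𝒳 => (θstar, x, a)))).abs.pow_const 2
    have hint : Integrable (fun x => |M.weight θ x a - M.weight θstar x a| ^ 2 * φ x)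
        M.env.fst := by
      refine hk.integrable.bdd_mul (c := whi ^ 2) hmwx.aestronglyMeasurable
        (ae_of_all _ fun x => ?_)
      rw [Real.norm_of_nonneg (by positivity)]
      have h1 := hw.lower θ x a
      have h2 := hw.upper θ x a
      have h3 := hw.lower θstar x a
      have h4 := hw.upper θstar x a
      have h5 := hw.pos
      gcongr
      rw [abs_le]
      constructor <;> linarith
    rw [ofReal_integral_eq_lintegral_ofReal hint
      (ae_of_all _ fun x => mul_nonneg (by positivity) (hk.nonneg x))]
    refine lintegral_mono_ae ?_
    filter_upwards [hk.bound] with x hx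
    have hx' := hx a θstar
    rw [sub_self, norm_zero, zero_pow two_ne_zero, add_zero, mul_one] at hx'
    simp only [Pi.mul_apply]
    rw [lintegral_const_mul' _ _ (by simp), ENNReal.ofReal_mul (by positivity),
      ← ofReal_norm, ← ENNReal.ofReal_pow (norm_nonneg _), Real.norm_eq_abs]
    gcongr
  -- From `w k - w₀ k₀ = w (k - k₀) + (w - w₀) k₀`: pairing the weight difference with the fixed
  -- `k₀` is what lets `hk.weight` apply.
  have hle : ∀ θ, ∫⁻ z, ‖M.weighted k θ z - M.weighted k θstar z‖ₑ ^ 2 ∂M.slotLaw ≤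
      2 * (ENNReal.ofReal whi ^ 2 * ∫⁻ z, ‖k θ z - k θstar z‖ₑ ^ 2 ∂M.slotLaw) +
      2 * ∑ a, ENNReal.ofReal
        (∫ x, |M.weight θ x a - M.weight θstar x a| ^ 2 * φ x ∂M.env.fst) := by
    intro θ
    calc _ ≤ ∫⁻ z, 2 * (ENNReal.ofReal whi ^ 2 * ‖k θ z - k θstar z‖ₑ ^ 2) +
          2 * (‖M.weight θ z.1 z.2.1 - M.weight θstar z.1 z.2.1‖ₑ ^ 2 * ‖k θstar z‖ₑ ^ 2)
            ∂M.slotLaw := by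
          refine lintegral_mono fun z => (enorm_mul_sub_mul_sq_le _ _ _ _).trans ?_
          gcongr
          exact hw.enorm_le _ _ _
      _ ≤ _ := by
          rw [lintegral_add_left (((hmk θ).const_mul _).const_mul _),
            lintegral_const_mul' _ _ (by simp), lintegral_const_mul' _ _ (by simp),
            lintegral_const_mul' _ _ (by simp)]
          gcongr
          exact hsecond θ
  refine tendsto_of_tendsto_of_tendsto_of_le_of_le tendsto_const_nhds ?_ (fun _ => zero_le) hle
  have h1 := ENNReal.Tendsto.const_mul (ENNReal.Tendsto.const_mul hk.tendsto_lintegral_sub_sq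
    (Or.inr (by simp : ENNReal.ofReal whi ^ 2 ≠ ∞))) (Or.inr (by simp : (2 : ℝ≥0∞) ≠ ∞))
  have h2 : Tendsto (fun θ => ∑ a, ENNReal.ofReal
      (∫ x, |M.weight θ x a - M.weight θstar x a| ^ 2 * φ x ∂M.env.fst)) (𝓝 θstar)
      (𝓝 (∑ _a : 𝒜, ENNReal.ofReal 0)) :=
    tendsto_finsetSum _ fun a _ => ENNReal.tendsto_ofReal (hk.weight a)
  have h3 := h1.add (ENNReal.Tendsto.const_mul h2 (Or.inr (by simp : (2 : ℝ≥0∞) ≠ ∞)))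
  simpa using h3

/-- Changing the policy has a vanishing effect on the second moment of the weighted statistic. -/
lemma tendsto_policy_sq (hk : M.RegularStatistic θstar φ k) (hw : M.BoundedWeight wlo whi) :
    Tendsto (fun θ => ∑ a, ∫⁻ p, ‖(M.policy (p.1, θ)).real {a} -
      (M.policy (p.1, θstar)).real {a}‖ₑ * ‖M.weighted k θstar (slot a p)‖ₑ ^ 2 ∂M.env)
      (𝓝 θstar) (𝓝 0) := by
  rw [← Finset.sum_const_zero (s := (Finset.univ : Finset 𝒜))]
  refine tendsto_finsetSum _ fun a _ => ?_
  have hlim : Tendsto (fun θ => ENNReal.ofReal whi ^ 2 *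
      (2 * ENNReal.ofReal (∫ x, M.tvDist θstar x θ * φ x ∂M.env.fst))) (𝓝 θstar) (𝓝 0) := by
    have := ENNReal.Tendsto.const_mul (ENNReal.Tendsto.const_mul (ENNReal.tendsto_ofReal hk.tv)
      (Or.inr (by simp : (2 : ℝ≥0∞) ≠ ∞))) (Or.inr (by simp : ENNReal.ofReal whi ^ 2 ≠ ∞))
    simpa using this
  refine tendsto_of_tendsto_of_tendsto_of_le_of_le tendsto_const_nhds hlim (fun _ => zero_le)
    fun θ => ?_
  have hmp : Measurable fun p : 𝒳 × (𝒜 → ℝ) => ‖(M.policy (p.1, θ)).real {a} -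
      (M.policy (p.1, θstar)).real {a}‖ₑ :=
    (((M.measurable_policy_real θ a).comp measurable_fst).sub
      ((M.measurable_policy_real θstar a).comp measurable_fst)).enorm
  have hmk : Measurable fun p : 𝒳 × (𝒜 → ℝ) => ‖k θstar (slot a p)‖ₑ ^ 2 :=
    ((hk.measurable_apply θstar).comp (measurable_slot a)).enorm.pow_const 2
  -- The policy difference depends only on the covariate; conditioning on it replaces the squared
  -- statistic by `φ` and leaves the quantity in `hk.tv`.
  calc ∫⁻ p, ‖(M.policy (p.1, θ)).real {a} - (M.policy (p.1, θstar)).real {a}‖ₑ *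
        ‖M.weighted k θstar (slot a p)‖ₑ ^ 2 ∂M.env
      ≤ ∫⁻ p, ENNReal.ofReal whi ^ 2 * (‖(M.policy (p.1, θ)).real {a} -
          (M.policy (p.1, θstar)).real {a}‖ₑ * ‖k θstar (slot a p)‖ₑ ^ 2) ∂M.env := by
        refine lintegral_mono fun p => ?_
        rw [weighted, enorm_mul, mul_pow, mul_left_comm]
        gcongr
        exact hw.enorm_le _ _ _
    _ = ENNReal.ofReal whi ^ 2 * ∫⁻ x, ∫⁻ y, ‖(M.policy (x, θ)).real {a} -
          (M.policy (x, θstar)).real {a}‖ₑ * ‖k θstar (x, a, y a)‖ₑ ^ 2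
            ∂(M.env.condKernel x) ∂M.env.fst := by
        rw [lintegral_const_mul' _ _ (by simp)]
        exact congrArg _ (Measure.lintegral_condKernel (hmp.mul hmk)).symm
    _ ≤ ENNReal.ofReal whi ^ 2 * ∫⁻ x, 2 * ENNReal.ofReal (M.tvDist θstar x θ * φ x)
          ∂M.env.fst := by
        gcongr 1
        refine lintegral_mono_ae ?_
        filter_upwards [hk.bound] with x hx
        have hx' := hx a θstar
        rw [sub_self, norm_zero, zero_pow two_ne_zero, add_zero, mul_one] at hx'
        rw [lintegral_const_mul' _ _ (by simp), ENNReal.ofReal_mul (M.tvDist_nonneg _ _ _),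
          ← mul_assoc, two_mul_ofReal,
          ← ofReal_norm, Real.norm_eq_abs]
        gcongr
        exact M.abs_policy_sub_le_tvDist θstar θ x a
    _ = _ := by
        rw [lintegral_const_mul' _ _ (by simp), ofReal_integral_eq_lintegral_ofReal
          (M.integrable_tvDist_mul θstar θ hk.integrable)
          (ae_of_all _ fun x => mul_nonneg (M.tvDist_nonneg _ _ _) (hk.nonneg x))]

end RegularStatistic

end Model

/-! ### Continuity in mean, and derivatives of expectations. -/

namespace Model

variable {d : ℕ} {𝒳 𝒜 : Type*} [MeasurableSpace 𝒳] [MeasurableSpace 𝒜]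
  [Fintype 𝒜] [MeasurableSingletonClass 𝒜]

/-- A statistic that is continuous at `θstar` in mean, both with respect to its parameter and with
respect to the parameter of the policy. -/
structure ContinuousStatistic (M : Model d 𝒳 𝒜) (θstar : Param d)
    (f : Param d → 𝒳 × 𝒜 × ℝ → ℝ) : Prop where
  measurable : Measurable fun p : Param d × 𝒳 × 𝒜 × ℝ => f p.1 p.2
  integrable : ∀ θ, Integrable (f θ) M.slotLaw
  tendsto_sub : Tendsto (fun θ => ∫⁻ z, ‖f θ z - f θstar z‖ₑ ∂M.slotLaw) (𝓝 θstar) (𝓝 0)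
  tendsto_policy : Tendsto (fun θ => ∑ a, ∫⁻ p, ‖(M.policy (p.1, θ)).real {a} -
    (M.policy (p.1, θstar)).real {a}‖ₑ * ‖f θstar (slot a p)‖ₑ ∂M.env) (𝓝 θstar) (𝓝 0)

lemma integrable_slot (M : Model d 𝒳 𝒜) {f : 𝒳 × 𝒜 × ℝ → ℝ} (hm : Measurable f)
    (hf : Integrable f M.slotLaw) (a : 𝒜) : Integrable (fun p => f (slot a p)) M.env := by
  refine ⟨(hm.comp (measurable_slot a)).aestronglyMeasurable, ?_⟩
  have := hf.2
  rw [HasFiniteIntegral, M.lintegral_slotLaw hm.enorm] at this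
  exact (ENNReal.sum_lt_top.1 this) a (Finset.mem_univ a)

lemma integral_obsLaw (M : Model d 𝒳 𝒜) (θ : Param d) {f : 𝒳 × 𝒜 × ℝ → ℝ} (hm : Measurable f)
    (hf : Integrable f M.slotLaw) :
    ∫ z, f z ∂(M.obsLaw θ) = ∑ a, ∫ p, (M.policy (p.1, θ)).real {a} * f (slot a p) ∂M.env := by
  have he := measurable_eval_uncurry (𝒳 := 𝒳) (𝒜 := 𝒜)
  have hf' : Integrable f (M.obsLaw θ) := hf.mono_measure (M.obsLaw_le_slotLaw θ)
  have hint : Integrable (fun p : (𝒳 × (𝒜 → ℝ)) × 𝒜 => f (p.1.1, p.2, p.1.2 p.2)) _ :=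
    (integrable_map_measure hm.aestronglyMeasurable he.aemeasurable).1 hf'
  rw [obsLaw, integral_map he.aemeasurable hm.aestronglyMeasurable,
    Measure.integral_compProd hint, ← integral_finsetSum]
  · refine integral_congr_ae (ae_of_all _ fun p => ?_)
    simp only
    rw [integral_fintype Integrable.of_finite]
    rfl
  · intro a _
    refine (M.integrable_slot hm hf a).bdd_mul (c := 1)
      ((M.measurable_policy_real θ a).comp measurable_fst).aestronglyMeasurable
      (ae_of_all _ fun p => ?_)
    rw [Real.norm_of_nonneg measureReal_nonneg]
    exact measureReal_le_one

namespace ContinuousStatistic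

variable {M : Model d 𝒳 𝒜} {θstar : Param d} {f : Param d → 𝒳 × 𝒜 × ℝ → ℝ}

lemma measurable_apply (hf : M.ContinuousStatistic θstar f) (θ : Param d) : Measurable (f θ) :=
  hf.measurable.comp measurable_prodMk_left

lemma tendsto_integral_policy (hf : M.ContinuousStatistic θstar f) :
    Tendsto (fun θ => ∫ z, f θstar z ∂(M.obsLaw θ)) (𝓝 θstar)
      (𝓝 (∫ z, f θstar z ∂(M.obsLaw θstar))) := by
  rw [tendsto_iff_edist_tendsto_0]
  refine tendsto_of_tendsto_of_tendsto_of_le_of_le tendsto_const_nhds hf.tendsto_policy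
    (fun _ => zero_le) fun θ => ?_
  have hm := hf.measurable_apply θstar
  have hint : ∀ θ a, Integrable (fun p : 𝒳 × (𝒜 → ℝ) =>
      (M.policy (p.1, θ)).real {a} * f θstar (slot a p)) M.env := by
    intro θ a
    refine (M.integrable_slot hm (hf.integrable θstar) a).bdd_mul (c := 1)
      ((M.measurable_policy_real θ a).comp measurable_fst).aestronglyMeasurable
      (ae_of_all _ fun p => ?_)
    rw [Real.norm_of_nonneg measureReal_nonneg]
    exact measureReal_le_one
  rw [edist_eq_enorm_sub, M.integral_obsLaw θ hm (hf.integrable θstar),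
    M.integral_obsLaw θstar hm (hf.integrable θstar), ← Finset.sum_sub_distrib]
  refine (enorm_sum_le _ _).trans (Finset.sum_le_sum fun a _ => ?_)
  rw [← integral_sub (hint θ a) (hint θstar a)]
  refine (enorm_integral_le_lintegral_enorm _).trans (lintegral_mono fun p => ?_)
  rw [← sub_mul, enorm_mul]

/-- Changing the integrand costs at most its `L¹` distance under `slotLaw`, whatever the policy;
changing the policy is then needed only for the fixed integrand `f θstar`. -/
lemma tendsto_integral (hf : M.ContinuousStatistic θstar f) :
    Tendsto (fun θ => ∫ z, f θ z ∂(M.obsLaw θ)) (𝓝 θstar)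
      (𝓝 (∫ z, f θstar z ∂(M.obsLaw θstar))) := by
  have hsub : Tendsto (fun θ => ∫ z, (f θ z - f θstar z) ∂(M.obsLaw θ)) (𝓝 θstar) (𝓝 0) := by
    rw [tendsto_iff_edist_tendsto_0]
    refine tendsto_of_tendsto_of_tendsto_of_le_of_le tendsto_const_nhds hf.tendsto_sub
      (fun _ => zero_le) fun θ => ?_
    rw [edist_eq_enorm_sub, sub_zero]
    exact (enorm_integral_le_lintegral_enorm _).trans
      (lintegral_mono' (M.obsLaw_le_slotLaw θ) le_rfl)
  have h := hsub.add hf.tendsto_integral_policy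
  rw [zero_add] at h
  refine h.congr fun θ => ?_
  rw [integral_sub ((hf.integrable θ).mono_measure (M.obsLaw_le_slotLaw θ))
    ((hf.integrable θstar).mono_measure (M.obsLaw_le_slotLaw θ)), sub_add_cancel]

end ContinuousStatistic

namespace RegularStatistic

variable {M : Model d 𝒳 𝒜} {θstar : Param d} {φ : 𝒳 → ℝ} {k l : Param d → 𝒳 × 𝒜 × ℝ → ℝ}
  {wlo whi : ℝ}

lemma measurable_policy_slot (M : Model d 𝒳 𝒜) (θ θ' : Param d) (a : 𝒜) :
    Measurable fun p : 𝒳 × (𝒜 → ℝ) => ‖(M.policy (p.1, θ)).real {a} -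
      (M.policy (p.1, θ')).real {a}‖ₑ :=
  (((M.measurable_policy_real θ a).comp measurable_fst).sub
    ((M.measurable_policy_real θ' a).comp measurable_fst)).enorm

lemma continuousStatistic_weighted (hk : M.RegularStatistic θstar φ k)
    (hw : M.BoundedWeight wlo whi) : M.ContinuousStatistic θstar (M.weighted k) where
  measurable := hk.measurable_weighted
  integrable θ := (hk.memLp_weighted hw θ).integrable one_le_two
  tendsto_sub := by
    have h := ENNReal.Tendsto.mul_const (hk.tendsto_lintegral_weighted_sub_sq hw)
      (Or.inr (measure_ne_top M.slotLaw Set.univ))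
    rw [zero_mul] at h
    exact tendsto_zero_of_sq_le h fun θ => AdaptiveSGD.lintegral_sq_le _
      ((hk.measurable_weighted_apply θ).sub
        (hk.measurable_weighted_apply θstar)).enorm.aemeasurable
  tendsto_policy := by
    have h : ∀ a, Tendsto (fun θ => ∫⁻ p, ‖(M.policy (p.1, θ)).real {a} -
        (M.policy (p.1, θstar)).real {a}‖ₑ * ‖M.weighted k θstar (slot a p)‖ₑ ∂M.env)
        (𝓝 θstar) (𝓝 0) := by
      intro a
      refine tendsto_zero_of_sq_le (hk.tendsto_policy_sq hw) fun θ => ?_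
      refine (AdaptiveSGD.lintegral_sq_le _ ((measurable_policy_slot M θ θstar a).mul
        ((hk.measurable_weighted_apply θstar).comp
          (measurable_slot a)).enorm).aemeasurable).trans ?_
      rw [measure_univ, mul_one]
      refine le_trans (lintegral_mono fun p => ?_) (Finset.single_le_sum (f := fun a =>
        ∫⁻ p, ‖(M.policy (p.1, θ)).real {a} - (M.policy (p.1, θstar)).real {a}‖ₑ *
          ‖M.weighted k θstar (slot a p)‖ₑ ^ 2 ∂M.env) (fun _ _ => zero_le)
        (Finset.mem_univ a))
      simp only [Pi.mul_apply, Function.comp_apply, mul_pow]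
      gcongr
      -- A difference of probabilities is at most one, so its square may be replaced by its first
      -- power, as in `tendsto_policy_sq`.
      exact pow_le_of_le_one zero_le (M.enorm_policy_sub_le_one _ _ _ _) two_ne_zero
    simpa using tendsto_finsetSum Finset.univ fun a _ => h a

/-- With `a, b` the weighted statistics and `a₀, b₀` their values at `θstar`, `ab - a₀b₀ = (a -
a₀)(b - b₀) + (a - a₀)b₀ + a₀(b - b₀)`, and Cauchy–Schwarz handles each term. This is why second
moments suffice for the products in `Shat`. -/
lemma continuousStatistic_weighted_mul (hk : M.RegularStatistic θstar φ k)
    (hl : M.RegularStatistic θstar φ l) (hw : M.BoundedWeight wlo whi) :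
    M.ContinuousStatistic θstar fun θ z => M.weighted k θ z * M.weighted l θ z where
  measurable := hk.measurable_weighted.mul hl.measurable_weighted
  integrable θ := (hk.memLp_weighted hw θ).integrable_mul (hl.memLp_weighted hw θ)
  tendsto_sub := by
    have hmk := hk.measurable_weighted_apply
    have hml := hl.measurable_weighted_apply
    have hfin : ∀ {k}, M.RegularStatistic θstar φ k →
        ∫⁻ z, ‖M.weighted k θstar z‖ₑ ^ 2 ∂M.slotLaw ≠ ∞ := fun hk =>
      ((hk.lintegral_weighted_sq_le hw θstar θstar le_rfl).trans_lt
        (ENNReal.mul_lt_top (by simp) ENNReal.ofReal_lt_top)).ne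
    have hkk := hk.tendsto_lintegral_weighted_sub_sq hw
    have hll := hl.tendsto_lintegral_weighted_sub_sq hw
    have h1 : Tendsto (fun θ => ∫⁻ z, ‖M.weighted k θ z - M.weighted k θstar z‖ₑ *
        ‖M.weighted l θ z - M.weighted l θstar z‖ₑ ∂M.slotLaw) (𝓝 θstar) (𝓝 0) := by
      have := ENNReal.Tendsto.mul hkk (by simp) hll (by simp)
      rw [zero_mul] at this
      exact tendsto_zero_of_sq_le this fun θ => lintegral_mul_sq_le _
        ((hmk θ).sub (hmk θstar)).enorm.aemeasurable ((hml θ).sub (hml θstar)).enorm.aemeasurable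
    have h2 : Tendsto (fun θ => ∫⁻ z, ‖M.weighted k θ z - M.weighted k θstar z‖ₑ *
        ‖M.weighted l θstar z‖ₑ ∂M.slotLaw) (𝓝 θstar) (𝓝 0) := by
      have := ENNReal.Tendsto.mul_const hkk (Or.inr (hfin hl))
      rw [zero_mul] at this
      exact tendsto_zero_of_sq_le this fun θ => lintegral_mul_sq_le _
        ((hmk θ).sub (hmk θstar)).enorm.aemeasurable (hml θstar).enorm.aemeasurable
    have h3 : Tendsto (fun θ => ∫⁻ z, ‖M.weighted k θstar z‖ₑ *
        ‖M.weighted l θ z - M.weighted l θstar z‖ₑ ∂M.slotLaw) (𝓝 θstar) (𝓝 0) := by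
      have := ENNReal.Tendsto.const_mul hll (Or.inr (hfin hk))
      rw [mul_zero] at this
      exact tendsto_zero_of_sq_le this fun θ => lintegral_mul_sq_le _
        (hmk θstar).enorm.aemeasurable ((hml θ).sub (hml θstar)).enorm.aemeasurable
    have h := (h1.add h2).add h3
    simp only [add_zero] at h
    refine tendsto_of_tendsto_of_tendsto_of_le_of_le tendsto_const_nhds h (fun _ => zero_le)
      fun θ => ?_
    have hm1 : Measurable fun z => ‖M.weighted k θ z - M.weighted k θstar z‖ₑ :=
      ((hmk θ).sub (hmk θstar)).enorm
    have hm2 : Measurable fun z => ‖M.weighted l θ z - M.weighted l θstar z‖ₑ :=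
      ((hml θ).sub (hml θstar)).enorm
    simp only
    rw [← lintegral_add_left (hm1.fun_mul hm2), ← lintegral_add_left
      ((hm1.fun_mul hm2).fun_add (hm1.fun_mul (hml θstar).enorm))]
    refine lintegral_mono fun z => ?_
    rw [← enorm_mul, ← enorm_mul, ← enorm_mul]
    refine le_trans (le_of_eq ?_) ((enorm_add_le _ _).trans (add_le_add_left (enorm_add_le _ _) _))
    ring_nf
  tendsto_policy := by
    have h := (hk.tendsto_policy_sq hw).add (hl.tendsto_policy_sq hw)
    rw [add_zero] at h
    refine tendsto_of_tendsto_of_tendsto_of_le_of_le tendsto_const_nhds h (fun _ => zero_le)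
      fun θ => ?_
    rw [← Finset.sum_add_distrib]
    refine Finset.sum_le_sum fun a _ => ?_
    rw [← lintegral_add_left (f := fun p => ‖(M.policy (p.1, θ)).real {a} -
      (M.policy (p.1, θstar)).real {a}‖ₑ * ‖M.weighted k θstar (slot a p)‖ₑ ^ 2)
      ((measurable_policy_slot M θ θstar a).mul
      (((hk.measurable_weighted_apply θstar).comp (measurable_slot a)).enorm.pow_const 2))]
    refine lintegral_mono fun p => ?_
    rw [← mul_add, enorm_mul]
    gcongr
    -- A product is at most the square of its larger factor.
    rcases le_total ‖M.weighted k θstar (slot a p)‖ₑ ‖M.weighted l θstar (slot a p)‖ₑ with h | h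
    · refine le_add_left ?_
      rw [sq]
      gcongr
    · refine le_add_right ?_
      rw [sq]
      gcongr

/-- Differentiation under the expectation of a weighted statistic. -/
lemma fderiv_integral_weighted {L : Param d → 𝒳 × 𝒜 × ℝ → ℝ}
    (hLm : Measurable fun p : Param d × 𝒳 × 𝒜 × ℝ => L p.1 p.2)
    (hLd : ∀ z, Differentiable ℝ fun θ => L θ z) {v : Param d} (hv : ‖v‖ = 1)
    (hk : M.RegularStatistic θstar φ fun θ z => fderiv ℝ (fun ϑ => L ϑ z) θ v)
    (hw : M.BoundedWeight wlo whi) (θ' θ : Param d)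
    (hint : ∀ θ, Integrable (fun z => M.weight θ' z.1 z.2.1 * L θ z) (M.obsLaw θ'))
    (hd : DifferentiableAt ℝ (fun θ => ∫ z, M.weight θ' z.1 z.2.1 * L θ z ∂(M.obsLaw θ')) θ) :
    fderiv ℝ (fun θ => ∫ z, M.weight θ' z.1 z.2.1 * L θ z ∂(M.obsLaw θ')) θ v =
      ∫ z, M.weight θ' z.1 z.2.1 * fderiv ℝ (fun ϑ => L ϑ z) θ v ∂(M.obsLaw θ') := by
  have hline : Measurable fun p : ℝ × 𝒳 × 𝒜 × ℝ => (θ + p.1 • v, p.2) := by fun_prop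
  have hwm : Measurable fun z : 𝒳 × 𝒜 × ℝ => M.weight θ' z.1 z.2.1 :=
    M.measurable_weight_obs.comp measurable_prodMk_left
  have hcard : 0 ≤ ∫ x, φ x ∂M.env.fst := integral_nonneg hk.nonneg
  have h := eq_integral_of_hasDerivAt_of_lintegral_sq_le (ν := M.obsLaw θ')
    (g := fun s z => M.weight θ' z.1 z.2.1 * L (θ + s • v) z)
    (g' := fun s z => M.weight θ' z.1 z.2.1 * fderiv ℝ (fun ϑ => L ϑ z) (θ + s • v) v)
    -- For `s` in `[0, 1]` the point `θ + s • v` is within `‖θ - θstar‖ + 1` of `θstar`, since `v`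
    -- is a unit vector.
    (C := whi ^ 2 * (Fintype.card 𝒜 * (∫ x, φ x ∂M.env.fst) * (1 + (‖θ - θstar‖ + 1) ^ 2)))
    ((hwm.comp measurable_snd).mul (hLm.comp hline)) (fun z s => ?_) (by positivity)
    (fun s hs => ?_) (fun s => hint _) (hd.hasFDerivAt.hasLineDerivAt v)
  · simpa using h.2
  · have hl : HasDerivAt (fun s : ℝ => θ + s • v) v s := by
      simpa using ((hasDerivAt_id s).smul_const v).const_add θ
    exact ((hLd z (θ + s • v)).hasFDerivAt.comp_hasDerivAt s hl).const_mul _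
  · refine (hk.lintegral_weighted_sq_le hw _ _ (M.obsLaw_le_slotLaw θ')).trans ?_
    have hwhi : ENNReal.ofReal whi ^ 2 ≤ ENNReal.ofReal (whi ^ 2) := by
      rcases le_total 0 whi with h | h
      · rw [ENNReal.ofReal_pow h]
      · simp [ENNReal.ofReal_of_nonpos h]
    refine (mul_le_mul_left hwhi _).trans ?_
    rw [← ENNReal.ofReal_mul (by positivity)]
    refine ENNReal.ofReal_le_ofReal ?_
    gcongr
    calc ‖θ + s • v - θstar‖ = ‖(θ - θstar) + s • v‖ := by congr 1; abel
      _ ≤ ‖θ - θstar‖ + ‖s • v‖ := norm_add_le _ _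
      _ ≤ ‖θ - θstar‖ + 1 := by
        rw [norm_smul, hv, mul_one, Real.norm_of_nonneg hs.1]
        linarith [hs.2]

end RegularStatistic

end Model

/-! ### Identification of the limits and the one-step drift of the iterates. -/

lemma abs_apply_le_l2_opNorm {d : ℕ} (B : Matrix (Fin d) (Fin d) ℝ) (i j : Fin d) :
    ‖B i j‖ ≤ ‖B‖ := by
  have h := Matrix.l2_opNorm_mulVec B (EuclideanSpace.single j 1)
  rw [PiLp.norm_single, norm_one, mul_one] at h
  refine le_trans ?_ ((PiLp.norm_apply_le _ i).trans h)
  simp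

namespace Model

variable {d : ℕ} {𝒳 𝒜 : Type*} [MeasurableSpace 𝒳] [MeasurableSpace 𝒜]
  [Fintype 𝒜] [MeasurableSingletonClass 𝒜] {M : Model d 𝒳 𝒜} {θstar : Param d}
  {φ ψ : 𝒳 → ℝ} {wlo whi δ lam K : ℝ}

lemma regularStatistic_gradLoss (hd : ∀ ζ, Differentiable ℝ fun θ => M.loss θ ζ)
    (h4 : M.GradientMoment θstar φ) (h5 : M.GradientContinuity θstar φ) (i : Fin d) :
    M.RegularStatistic θstar φ fun θ z => M.gradLoss θ z i where
  measurable := by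
    have := M.measurable_gradLoss hd
    fun_prop
  nonneg := h4.nonneg
  integrable := h4.integrable
  bound := h4.bound.mono fun x hx a θ => le_trans (lintegral_mono fun y => by
    gcongr
    exact enorm_le_iff_norm_le.2 (PiLp.norm_apply_le _ i)) (hx a θ)
  tv := h5.tv
  cont := h5.grad.mono fun x hx a =>
    tendsto_of_tendsto_of_tendsto_of_le_of_le tendsto_const_nhds (hx a) (fun _ => zero_le)
      fun θ => lintegral_mono fun y => by
        simp only
        gcongr
        exact enorm_le_iff_norm_le.2 (PiLp.norm_apply_le
          (M.gradLoss θ (x, a, y a) - M.gradLoss θstar (x, a, y a)) i)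
  weight := h5.weight

lemma regularStatistic_hessLoss (h6 : M.HessianConditions θstar ψ) (i j : Fin d) :
    M.RegularStatistic θstar ψ fun θ z => M.hessLoss θ z i j where
  measurable := M.measurable_hessLoss_apply h6.differentiable_loss h6.differentiable_grad i j
  nonneg := h6.nonneg
  integrable := h6.integrable
  bound := h6.bound.mono fun x hx a θ => le_trans (lintegral_mono fun y => by
    gcongr
    exact enorm_le_iff_norm_le.2 (abs_apply_le_l2_opNorm _ i j)) (hx a θ)
  tv := h6.tv
  cont := h6.hess.mono fun x hx a =>
    tendsto_of_tendsto_of_tendsto_of_le_of_le tendsto_const_nhds (hx a) (fun _ => zero_le)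
      fun θ => lintegral_mono fun y => by
        simp only
        gcongr
        exact enorm_le_iff_norm_le.2 (abs_apply_le_l2_opNorm
          (M.hessLoss θ (x, a, y a) - M.hessLoss θstar (x, a, y a)) i j)
  weight := h6.weight

/-- The gradient of the population loss is the mean of the weighted stochastic gradient. -/
lemma gradPopLoss_apply (hd : ∀ ζ, Differentiable ℝ fun θ => M.loss θ ζ)
    (h1 : M.BoundedWeight wlo whi) (h2 : M.RegularLoss θstar δ lam)
    (h4 : M.GradientMoment θstar φ) (h5 : M.GradientContinuity θstar φ)
    (θ' θ : Param d) (i : Fin d) :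
    M.gradPopLoss θ' θ i =
      ∫ z, M.weight θ' z.1 z.2.1 * M.gradLoss θ z i ∂(M.obsLaw θ') := by
  have hk := regularStatistic_gradLoss hd h4 h5 i
  simp only [gradLoss, gradient_apply] at hk
  rw [gradPopLoss, gradient_apply]
  simp only [gradLoss, gradient_apply]
  exact RegularStatistic.fderiv_integral_weighted M.measurable_loss hd (by simp) hk h1 θ' θ
    (h2.integrable θ') ((h2.contDiff θ').differentiable one_ne_zero θ)

/-- The Hessian of the population loss at `θstar` is the mean of the weighted stochastic Hessian. -/
lemma H_apply (h1 : M.BoundedWeight wlo whi) (h2 : M.RegularLoss θstar δ lam)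
    (h3 : M.RegularHessian θstar δ K) (h4 : M.GradientMoment θstar φ)
    (h5 : M.GradientContinuity θstar φ) (h6 : M.HessianConditions θstar ψ) (i j : Fin d) :
    M.H θstar i j =
      ∫ z, M.weighted (fun θ z => M.hessLoss θ z i j) θstar z ∂(M.obsLaw θstar) := by
  have hd := h6.differentiable_loss
  -- The integral formula holds at every `θ`, so it may be differentiated a second time.
  have hgi : ∀ θ, M.gradPopLoss θstar θ i = _ := fun θ =>
    gradPopLoss_apply hd h1 h2 h4 h5 θstar θ i
  have hk := regularStatistic_hessLoss h6 i j
  simp only [M.hessLoss_apply h6.differentiable_grad] at hk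
  have hproj : Differentiable ℝ fun θ => M.gradPopLoss θstar θ i :=
    (EuclideanSpace.proj i : Param d →L[ℝ] ℝ).differentiable.comp (h3.differentiable θstar)
  have hH : M.H θstar i j = fderiv ℝ (fun θ => M.gradPopLoss θstar θ i) θstar
      (EuclideanSpace.single j 1) := by
    have h := ((EuclideanSpace.proj i : Param d →L[ℝ] ℝ).hasFDerivAt.comp θstar
      (h3.differentiable θstar θstar).hasFDerivAt).fderiv
    change _ = fderiv ℝ ((EuclideanSpace.proj i : Param d →L[ℝ] ℝ) ∘ M.gradPopLoss θstar) θstar _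
    rw [h]
    rfl
  rw [hH]
  simp only [weighted, M.hessLoss_apply h6.differentiable_grad]
  simp only [hgi] at hproj ⊢
  have hk' := regularStatistic_gradLoss hd h4 h5 i
  refine RegularStatistic.fderiv_integral_weighted (L := fun θ z => M.gradLoss θ z i)
    hk'.measurable (fun z => ?_) (by simp) hk h1 θstar θstar (fun θ => ?_) (hproj θstar)
  · exact (EuclideanSpace.proj i : Param d →L[ℝ] ℝ).differentiable.comp
      (h6.differentiable_grad z)
  · have hm : Measurable fun z : 𝒳 × 𝒜 × ℝ => M.weight θstar z.1 z.2.1 * M.gradLoss θ z i :=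
      (M.measurable_weight_obs.comp measurable_prodMk_left).mul (hk'.measurable_apply θ)
    have h2' : MemLp (fun z : 𝒳 × 𝒜 × ℝ => M.weight θstar z.1 z.2.1 * M.gradLoss θ z i) 2
        (M.obsLaw θstar) := by
      refine ⟨hm.aestronglyMeasurable, ?_⟩
      rw [eLpNorm_lt_top_iff_lintegral_rpow_enorm_lt_top two_ne_zero ENNReal.ofNat_ne_top]
      have := hk'.lintegral_weighted_sq_le h1 θ θstar (M.obsLaw_le_slotLaw θstar)
      simpa using this.trans_lt (ENNReal.mul_lt_top (by simp) ENNReal.ofReal_lt_top)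
    exact h2'.integrable one_le_two

/-- The mean gradient vanishes at `θstar`. -/
lemma gradPopLoss_self_eq_zero (hd : ∀ ζ, Differentiable ℝ fun θ => M.loss θ ζ)
    (h1 : M.BoundedWeight wlo whi) (h2 : M.RegularLoss θstar δ lam)
    (h4 : M.GradientMoment θstar φ) (h5 : M.GradientContinuity θstar φ) :
    M.gradPopLoss θstar θstar = 0 := by
  -- Policy and weight move together with the argument, so smoothness of each `popLoss θ'` does not
  -- suffice; continuity in mean does.
  have hcont : Tendsto (fun θ => M.gradPopLoss θ θ) (𝓝 θstar) (𝓝 (M.gradPopLoss θstar θstar)) := by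
    have : Tendsto (fun θ i => M.gradPopLoss θ θ i) (𝓝 θstar)
        (𝓝 fun i => M.gradPopLoss θstar θstar i) := by
      rw [tendsto_pi_nhds]
      intro i
      simp only [gradPopLoss_apply hd h1 h2 h4 h5]
      exact ((regularStatistic_gradLoss hd h4 h5 i).continuousStatistic_weighted
        h1).tendsto_integral
    exact ((PiLp.continuous_toLp 2 fun _ : Fin d => ℝ).tendsto _).comp this
  -- Along `θstar - s • g` with small `s > 0`, strong monotonicity forces the mean gradient to have
  -- nonpositive inner product with `g`; letting `s → 0` gives `‖g‖ ^ 2 ≤ 0`.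
  set g := M.gradPopLoss θstar θstar with hg
  have hline : Tendsto (fun s : ℝ => θstar - s • g) (𝓝[>] 0) (𝓝 θstar) := by
    have : Tendsto (fun s : ℝ => θstar - s • g) (𝓝 0) (𝓝 (θstar - (0 : ℝ) • g)) := by
      exact (by fun_prop : Continuous fun s : ℝ => θstar - s • g).tendsto 0
    rw [zero_smul, sub_zero] at this
    exact this.mono_left nhdsWithin_le_nhds
  have hlim : Tendsto (fun s : ℝ => inner ℝ (M.gradPopLoss (θstar - s • g) (θstar - s • g)) g)
      (𝓝[>] 0) (𝓝 (inner ℝ g g)) := (hcont.comp hline).inner tendsto_const_nhds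
  have hle : inner ℝ g g ≤ 0 := by
    refine le_of_tendsto hlim ?_
    have hball := hline.eventually (Metric.closedBall_mem_nhds θstar h2.delta_pos)
    filter_upwards [hball, self_mem_nhdsWithin] with s hs hs0
    rw [Set.mem_Ioi] at hs0
    have hst := h2.strong (θstar - s • g) (by rwa [← dist_eq_norm])
    have heq : θstar - s • g - θstar = (-s) • g := by rw [neg_smul]; abel
    rw [heq, inner_smul_right] at hst
    have := (mul_nonneg h2.lam_pos.le (sq_nonneg _)).trans hst
    nlinarith
  rw [real_inner_self_eq_norm_sq] at hle
  exact norm_eq_zero.1 (pow_eq_zero_iff two_ne_zero |>.1 (le_antisymm hle (sq_nonneg _)))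

/-- Off `θstar`, use the degenerate annulus with both radii `‖θ - θstar‖`. -/
lemma inner_gradPopLoss_nonneg (h2 : M.RegularLoss θstar δ lam) (θ : Param d) :
    0 ≤ inner ℝ (M.gradPopLoss θ θ) (θ - θstar) := by
  rcases eq_or_ne θ θstar with rfl | hne
  · simp
  · obtain ⟨c, hc, h⟩ := h2.separated ‖θ - θstar‖ ‖θ - θstar‖
      (norm_pos_iff.2 (sub_ne_zero.2 hne)) le_rfl
    exact hc.le.trans (h θ le_rfl le_rfl)

/-- The centring in `xi` is zero at `θstar`, which is why `Shat` needs no centring. -/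
lemma S_apply (hd : ∀ ζ, Differentiable ℝ fun θ => M.loss θ ζ)
    (h1 : M.BoundedWeight wlo whi) (h2 : M.RegularLoss θstar δ lam)
    (h4 : M.GradientMoment θstar φ) (h5 : M.GradientContinuity θstar φ) (i j : Fin d) :
    M.S θstar i j = ∫ z, M.weighted (fun θ z => M.gradLoss θ z i) θstar z *
      M.weighted (fun θ z => M.gradLoss θ z j) θstar z ∂(M.obsLaw θstar) := by
  simp [S, outer, xi, gradPopLoss_self_eq_zero hd h1 h2 h4 h5, weighted]

/-- One step of the recursion for the mean squared distance to `θstar`. -/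
lemma lintegral_sgd_step_add_le (hd : ∀ ζ, Differentiable ℝ fun θ => M.loss θ ζ)
    (h1 : M.BoundedWeight wlo whi) (h2 : M.RegularLoss θstar δ lam)
    (h4 : M.GradientMoment θstar φ) (h5 : M.GradientContinuity θstar φ) {c : ℝ} (hc : 0 ≤ c)
    (θ : Param d) :
    ∫⁻ z, ENNReal.ofReal (‖θ - (c * M.weight θ z.1 z.2.1) • M.gradLoss θ z - θstar‖ ^ 2)
        ∂(M.obsLaw θ) +
      ENNReal.ofReal (2 * c * inner ℝ (M.gradPopLoss θ θ) (θ - θstar)) ≤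
    ENNReal.ofReal (‖θ - θstar‖ ^ 2 + whi ^ 2 * (Fintype.card 𝒜 * (∫ x, φ x ∂M.env.fst)) * c ^ 2 *
      (1 + ‖θ - θstar‖ ^ 2)) := by
  set v : 𝒳 × 𝒜 × ℝ → Param d := fun z => M.weight θ z.1 z.2.1 • M.gradLoss θ z with hv
  have hgm : Measurable (M.gradLoss θ) := (M.measurable_gradLoss hd).comp measurable_prodMk_left
  have hvm : Measurable v := (M.measurable_weight_obs.comp measurable_prodMk_left).smul hgm
  have hvb : ∫⁻ z, ‖v z‖ₑ ^ 2 ∂(M.obsLaw θ) ≤ ENNReal.ofReal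
      (whi ^ 2 * (Fintype.card 𝒜 * (∫ x, φ x ∂M.env.fst)) * (1 + ‖θ - θstar‖ ^ 2)) := by
    have hb := M.lintegral_slotLaw_le h4.nonneg h4.integrable (hgm.enorm.pow_const 2)
      (by positivity : 0 ≤ 1 + ‖θ - θstar‖ ^ 2) (h4.bound.mono fun _ hx a => hx a θ)
    calc ∫⁻ z, ‖v z‖ₑ ^ 2 ∂(M.obsLaw θ)
        ≤ ∫⁻ z, ENNReal.ofReal (whi ^ 2) * ‖M.gradLoss θ z‖ₑ ^ 2 ∂M.slotLaw := by
          refine lintegral_mono' (M.obsLaw_le_slotLaw θ) fun z => ?_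
          have hw0 : 0 ≤ whi := h1.pos.le.trans
            ((h1.lower θ z.1 z.2.1).le.trans (h1.upper θ z.1 z.2.1).le)
          simp only [hv, enorm_smul, mul_pow]
          rw [ENNReal.ofReal_pow hw0]
          gcongr
          exact h1.enorm_le _ _ _
      _ ≤ _ := by
          rw [lintegral_const_mul' _ _ (by simp), mul_assoc, ENNReal.ofReal_mul (sq_nonneg whi)]
          gcongr
  have hv2 : MemLp v 2 (M.obsLaw θ) := by
    refine ⟨hvm.aestronglyMeasurable, ?_⟩
    rw [eLpNorm_lt_top_iff_lintegral_rpow_enorm_lt_top two_ne_zero ENNReal.ofNat_ne_top]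
    simpa using hvb.trans_lt ENNReal.ofReal_lt_top
  have hvi : Integrable v (M.obsLaw θ) := hv2.integrable one_le_two
  have hvsq : Integrable (fun z => ‖v z‖ ^ 2) (M.obsLaw θ) := hv2.integrable_norm_pow two_ne_zero
  have hvint : ∫ z, v z ∂(M.obsLaw θ) = M.gradPopLoss θ θ := by
    ext i
    rw [gradPopLoss_apply hd h1 h2 h4 h5]
    exact ((EuclideanSpace.proj i : Param d →L[ℝ] ℝ).integral_comp_comm hvi).symm
  -- By `hvint` the mean of the cross term is the drift; the quadratic term is the `c ^ 2` error.
  have hexp : ∀ z, ‖θ - (c * M.weight θ z.1 z.2.1) • M.gradLoss θ z - θstar‖ ^ 2 =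
      ‖θ - θstar‖ ^ 2 - 2 * c * inner ℝ (θ - θstar) (v z) + c ^ 2 * ‖v z‖ ^ 2 := by
    intro z
    have : θ - (c * M.weight θ z.1 z.2.1) • M.gradLoss θ z - θstar = (θ - θstar) - c • v z := by
      simp only [hv, mul_smul]
      abel
    rw [this, norm_sub_sq_real, inner_smul_right, norm_smul, mul_pow, Real.norm_eq_abs, sq_abs]
    ring
  have hin : Integrable (fun z => inner ℝ (θ - θstar) (v z)) (M.obsLaw θ) := hvi.const_inner _
  have hsub : Integrable (fun z => ‖θ - θstar‖ ^ 2 - 2 * c * inner ℝ (θ - θstar) (v z))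
      (M.obsLaw θ) := (integrable_const _).sub (hin.const_mul _)
  have hI : Integrable (fun z => ‖θ - θstar‖ ^ 2 - 2 * c * inner ℝ (θ - θstar) (v z) +
      c ^ 2 * ‖v z‖ ^ 2) (M.obsLaw θ) :=
    hsub.add (hvsq.const_mul _)
  have hsq : ∫ z, ‖v z‖ ^ 2 ∂(M.obsLaw θ) ≤
      whi ^ 2 * (Fintype.card 𝒜 * (∫ x, φ x ∂M.env.fst)) * (1 + ‖θ - θstar‖ ^ 2) := by
    have hφ0 := h4.integral_pos
    rw [← ENNReal.ofReal_le_ofReal_iff (by positivity),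
      ofReal_integral_eq_lintegral_ofReal hvsq (ae_of_all _ fun z => by positivity)]
    refine le_trans (le_of_eq (lintegral_congr fun z => ?_)) hvb
    rw [ENNReal.ofReal_pow (norm_nonneg _), ofReal_norm]
  simp_rw [hexp]
  rw [← ofReal_integral_eq_lintegral_ofReal hI
    (ae_of_all _ fun z => by simp only [← hexp, Pi.zero_apply]; positivity),
    ← ENNReal.ofReal_add]
  · refine ENNReal.ofReal_le_ofReal ?_
    rw [integral_add hsub (hvsq.const_mul _),
      integral_sub (integrable_const _) (hin.const_mul _), integral_const_mul, integral_const_mul,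
      integral_inner hvi, hvint, integral_const, probReal_univ, one_smul,
      real_inner_comm (M.gradPopLoss θ θ)]
    nlinarith [mul_le_mul_of_nonneg_left hsq (sq_nonneg c)]
  · exact integral_nonneg fun z => by simp only [← hexp, Pi.zero_apply]; positivity
  · have := inner_gradPopLoss_nonneg h2 θ
    positivity

end Model

/-! ### Stability of the iterates: Lyapunov recursion and maximal inequality. -/

namespace IsKernelDriven

variable {Ω P Z : Type*} [MeasurableSpace Ω] [MeasurableSpace P] [MeasurableSpace Z]
  {μ : Measure Ω} [IsProbabilityMeasure μ] {F : ℕ → MeasurableSpace Ω} {θ : ℕ → Ω → P}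
  {ζ : ℕ → Ω → Z} {κ : Kernel P Z} [IsMarkovKernel κ]

lemma measurable_param' (h : IsKernelDriven μ F θ ζ κ) (t : ℕ) : Measurable (θ t) :=
  (h.measurable_param t).mono (h.le t) le_rfl

lemma measurable_obs' (h : IsKernelDriven μ F θ ζ κ) (t : ℕ) : Measurable (ζ t) :=
  (h.measurable_obs t).mono (h.le _) le_rfl

/-- The case of `law` in which `V` is the indicator of `B`. -/
lemma setLIntegral_eq (h : IsKernelDriven μ F θ ζ κ) (t : ℕ) {B : Set Ω}
    (hB : MeasurableSet[F t] B) {g : P × Z → ℝ≥0∞} (hg : Measurable g) :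
    ∫⁻ ω in B, g (θ t ω, ζ t ω) ∂μ = ∫⁻ ω in B, ∫⁻ z, g (θ t ω, z) ∂(κ (θ t ω)) ∂μ := by
  set V : Ω → ℝ := B.indicator 1 with hV
  have hVm : Measurable[F t] V := (@measurable_const _ _ _ (F t) (1 : ℝ)).indicator hB
  have hVm' : Measurable V := hVm.mono (h.le t) le_rfl
  have hf : Measurable fun q : (P × ℝ) × Z => ENNReal.ofReal q.1.2 * g (q.1.1, q.2) :=
    (measurable_snd.comp measurable_fst).ennreal_ofReal.mul (hg.comp (by fun_prop))
  have hpair : Measurable fun ω => (θ t ω, V ω) := (h.measurable_param' t).prodMk hVm'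
  have hlaw := congrArg (fun m => ∫⁻ q, ENNReal.ofReal q.1.2 * g (q.1.1, q.2) ∂m) (h.law t V hVm)
  rw [lintegral_map hf (hpair.prodMk (h.measurable_obs' t)), Measure.lintegral_compProd hf,
    lintegral_map hf.lintegral_kernel_prod_right' hpair] at hlaw
  have hind : ∀ u : Ω → ℝ≥0∞, ∫⁻ ω in B, u ω ∂μ = ∫⁻ ω, ENNReal.ofReal (V ω) * u ω ∂μ := by
    intro u
    rw [← lintegral_indicator (h.le t B hB)]
    refine lintegral_congr fun ω => ?_
    by_cases hω : ω ∈ B <;> simp [hV, hω]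
  rw [hind, hind, hlaw]
  refine lintegral_congr fun ω => ?_
  simp only [Kernel.prodMkRight_apply]
  exact lintegral_const_mul' _ _ ENNReal.ofReal_ne_top

lemma lintegral_eq (h : IsKernelDriven μ F θ ζ κ) (t : ℕ) {g : P × Z → ℝ≥0∞}
    (hg : Measurable g) :
    ∫⁻ ω, g (θ t ω, ζ t ω) ∂μ = ∫⁻ ω, ∫⁻ z, g (θ t ω, z) ∂(κ (θ t ω)) ∂μ := by
  simpa using h.setLIntegral_eq t (B := Set.univ) MeasurableSet.univ hg

section Lyapunov

variable {D b : P → ℝ≥0∞} {step : ℕ → P → Z → P} {e γ : ℕ → ℝ}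

/-- Localising to events of `F t` is what the maximal inequality needs: there `B` is the event of no
exit so far. -/
lemma setLIntegral_succ_add_le (h : IsKernelDriven μ F θ ζ κ)
    (hD : ∀ t, Measurable fun p : P × Z => D (step t p.1 p.2))
    (hrec : ∀ t ω, θ (t + 1) ω = step t (θ t ω) (ζ t ω))
    (hstep : ∀ t p, ∫⁻ z, D (step t p z) ∂(κ p) + ENNReal.ofReal (γ t) * b p ≤
      D p + ENNReal.ofReal (e t) * (D p + 1)) (t : ℕ) {B : Set Ω} (hB : MeasurableSet[F t] B) :
    ∫⁻ ω in B, D (θ (t + 1) ω) ∂μ + ENNReal.ofReal (γ t) * ∫⁻ ω in B, b (θ t ω) ∂μ ≤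
      ∫⁻ ω in B, D (θ t ω) + ENNReal.ofReal (e t) * (D (θ t ω) + 1) ∂μ := by
  simp_rw [hrec]
  rw [h.setLIntegral_eq t hB (hD t), ← lintegral_const_mul' _ _ ENNReal.ofReal_ne_top]
  -- Superadditivity of the lower integral is enough here, so no measurability of `b` is required.
  exact (le_lintegral_add _ _).trans (lintegral_mono fun ω => hstep t (θ t ω))

lemma lintegral_succ_add_le (h : IsKernelDriven μ F θ ζ κ) (hDm : Measurable D)
    (hD : ∀ t, Measurable fun p : P × Z => D (step t p.1 p.2))
    (hrec : ∀ t ω, θ (t + 1) ω = step t (θ t ω) (ζ t ω))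
    (hstep : ∀ t p, ∫⁻ z, D (step t p z) ∂(κ p) + ENNReal.ofReal (γ t) * b p ≤
      D p + ENNReal.ofReal (e t) * (D p + 1)) (t : ℕ) :
    ∫⁻ ω, D (θ (t + 1) ω) ∂μ + ENNReal.ofReal (γ t) * ∫⁻ ω, b (θ t ω) ∂μ ≤
      ∫⁻ ω, D (θ t ω) ∂μ + ENNReal.ofReal (e t) * (∫⁻ ω, D (θ t ω) ∂μ + 1) := by
  have := h.setLIntegral_succ_add_le hD hrec hstep t (B := Set.univ) MeasurableSet.univ
  have hDt : Measurable fun ω => D (θ t ω) := hDm.comp (h.measurable_param' t)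
  rw [Measure.restrict_univ, lintegral_add_left hDt,
    lintegral_const_mul' _ _ ENNReal.ofReal_ne_top, lintegral_add_left hDt] at this
  simpa using this

end Lyapunov

end IsKernelDriven

/-- A deterministic form of the Robbins–Siegmund argument: bounds for a sequence that decreases up
to summable multiplicative and additive errors. -/
lemma exists_bound_of_almost_decreasing {u v : ℕ → ℝ≥0∞} {e γ : ℕ → ℝ} (he : ∀ t, 0 ≤ e t)
    (hes : Summable e) (hu0 : u 0 ≠ ∞)
    (h : ∀ t, u (t + 1) + ENNReal.ofReal (γ t) * v t ≤ u t + ENNReal.ofReal (e t) * (u t + 1)) :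
    ∃ C : ℝ≥0∞, C ≠ ∞ ∧ (∀ t, u t ≤ C) ∧
      ∀ t, ∑ s ∈ Finset.range t, ENNReal.ofReal (γ s) * v s ≤ C := by
  set Q : ℝ≥0∞ := (u 0 + 1) * ENNReal.ofReal (Real.exp (∑' s, e s)) with hQ
  have hQt : Q ≠ ∞ := ENNReal.mul_ne_top (by simp [hu0]) ENNReal.ofReal_ne_top
  have hbound : ∀ t, u t + 1 ≤ Q := by
    -- Adding one makes the recursion multiplicative, with factors `1 + e t ≤ exp (e t)`.
    have hind : ∀ t, u t + 1 ≤
        (u 0 + 1) * ENNReal.ofReal (Real.exp (∑ s ∈ Finset.range t, e s)) := by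
      intro t
      induction t with
      | zero => simp
      | succ t ih =>
        calc u (t + 1) + 1 ≤ u t + ENNReal.ofReal (e t) * (u t + 1) + 1 := by
              gcongr
              exact le_self_add.trans (h t)
          _ = (u t + 1) * ENNReal.ofReal (1 + e t) := by
              rw [ENNReal.ofReal_add zero_le_one (he t), ENNReal.ofReal_one]
              ring
          _ ≤ (u 0 + 1) * ENNReal.ofReal (Real.exp (∑ s ∈ Finset.range t, e s)) *
              ENNReal.ofReal (Real.exp (e t)) := by
              gcongr
              linarith [Real.add_one_le_exp (e t)]
          _ = _ := by
              rw [mul_assoc, ← ENNReal.ofReal_mul (Real.exp_nonneg _), ← Real.exp_add,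
                Finset.sum_range_succ]
    intro t
    refine (hind t).trans ?_
    rw [hQ]
    gcongr
    exact hes.sum_le_tsum _ fun s _ => he s
  have hsum : ∀ t, (∑ s ∈ Finset.range t, ENNReal.ofReal (γ s) * v s) + u t ≤
      u 0 + Q * ∑ s ∈ Finset.range t, ENNReal.ofReal (e s) := by
    intro t
    induction t with
    | zero => simp
    | succ t ih =>
      rw [Finset.sum_range_succ, Finset.sum_range_succ, mul_add, ← add_assoc]
      calc _ = (∑ s ∈ Finset.range t, ENNReal.ofReal (γ s) * v s) +
            (u (t + 1) + ENNReal.ofReal (γ t) * v t) := by ring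
        _ ≤ (∑ s ∈ Finset.range t, ENNReal.ofReal (γ s) * v s) +
            (u t + ENNReal.ofReal (e t) * (u t + 1)) := by
            exact add_le_add_right (h t) _
        _ = ((∑ s ∈ Finset.range t, ENNReal.ofReal (γ s) * v s) + u t) +
            (u t + 1) * ENNReal.ofReal (e t) := by ring
        _ ≤ _ := by
          gcongr
          exact hbound t
  have hb : Q * ∑' s, ENNReal.ofReal (e s) ≠ ∞ := by
    refine ENNReal.mul_ne_top hQt ?_
    rw [← ENNReal.ofReal_tsum_of_nonneg he hes]
    exact ENNReal.ofReal_ne_top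
  refine ⟨u 0 + Q * (∑' s, ENNReal.ofReal (e s)) + Q, ?_, fun t => ?_, fun t => ?_⟩
  · exact ENNReal.add_ne_top.2 ⟨ENNReal.add_ne_top.2 ⟨hu0, hb⟩, hQt⟩
  · exact (le_self_add.trans (hbound t)).trans le_add_self
  · refine (le_self_add.trans (hsum t)).trans (le_trans ?_ le_self_add)
    gcongr
    exact ENNReal.sum_le_tsum _

/-- If `∑ γ = ∞` and `∑ γ v < ∞` then `v` is frequently small. -/
lemma frequently_le_of_sum_le {v : ℕ → ℝ≥0∞} {γ : ℕ → ℝ} (hγ : ∀ t, 0 ≤ γ t)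
    (hγs : ¬ Summable γ) {C : ℝ≥0∞} (hC : C ≠ ∞)
    (h : ∀ t, ∑ s ∈ Finset.range t, ENNReal.ofReal (γ s) * v s ≤ C) {ε : ℝ≥0∞} (hε : ε ≠ 0) :
    ∃ᶠ t in atTop, v t ≤ ε := by
  rw [frequently_atTop]
  by_contra! hcon
  obtain ⟨T, hT⟩ := hcon
  -- The cap makes the threshold finite, so one may divide by it: `v > ε` from `T` on would bound
  -- the tail sums of `γ` by `C / ε'`.
  set ε' : ℝ≥0∞ := min ε 1 with hε'
  have hε'0 : ε' ≠ 0 := (lt_min (pos_iff_ne_zero.2 hε) one_pos).ne'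
  have hε't : ε' ≠ ∞ := ((min_le_right _ _).trans_lt ENNReal.one_lt_top).ne
  refine hγs ((summable_nat_add_iff T).1 ?_)
  refine summable_of_sum_range_le (c := (C / ε').toReal) (fun n => hγ _) fun n => ?_
  rw [← ENNReal.ofReal_le_iff_le_toReal (ENNReal.div_ne_top hC hε'0),
    ENNReal.ofReal_sum_of_nonneg fun _ _ => hγ _, ENNReal.le_div_iff_mul_le (Or.inl hε'0)
    (Or.inl hε't), Finset.sum_mul]
  calc ∑ i ∈ Finset.range n, ENNReal.ofReal (γ (i + T)) * ε'
      ≤ ∑ i ∈ Finset.range n, ENNReal.ofReal (γ (i + T)) * v (i + T) := by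
        gcongr with i
        exact (min_le_left _ _).trans (hT _ (Nat.le_add_left _ _)).le
    _ ≤ ∑ s ∈ Finset.range (T + n), ENNReal.ofReal (γ s) * v s := by
        rw [Finset.sum_range_add]
        simp_rw [add_comm T]
        exact le_add_self
    _ ≤ C := h _

namespace IsKernelDriven

variable {Ω P Z : Type*} [MeasurableSpace Ω] [MeasurableSpace P] [MeasurableSpace Z]
  {μ : Measure Ω} [IsProbabilityMeasure μ] {F : ℕ → MeasurableSpace Ω} {θ : ℕ → Ω → P}
  {ζ : ℕ → Ω → Z} {κ : Kernel P Z} [IsMarkovKernel κ]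
  {D b : P → ℝ≥0∞} {step : ℕ → P → Z → P} {e γ : ℕ → ℝ}

/-- A maximal inequality for a Lyapunov function that decreases in mean up to small errors. -/
lemma maximal_inequality (h : IsKernelDriven μ F θ ζ κ) (hDm : Measurable D)
    (hD : ∀ t, Measurable fun p : P × Z => D (step t p.1 p.2))
    (hrec : ∀ t ω, θ (t + 1) ω = step t (θ t ω) (ζ t ω))
    (hstep : ∀ t p, ∫⁻ z, D (step t p z) ∂(κ p) + ENNReal.ofReal (γ t) * b p ≤
      D p + ENNReal.ofReal (e t) * (D p + 1)) (ρ : ℝ≥0∞) (T n : ℕ) :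
    ρ * μ {ω | ∃ s ≤ n, ρ ≤ D (θ (T + s) ω)} ≤
      ρ * μ {ω | ρ ≤ D (θ T ω)} + ∫⁻ ω in {ω | D (θ T ω) < ρ}, D (θ T ω) ∂μ +
        (ρ + 1) * ∑ s ∈ Finset.range n, ENNReal.ofReal (e (T + s)) := by
  set E : ℕ → Set Ω := fun n => {ω | ∃ s ≤ n, ρ ≤ D (θ (T + s) ω)} with hE
  have hEm : ∀ n, MeasurableSet[F (T + n)] (E n) := by
    intro n
    have : E n = ⋃ s ∈ Finset.range (n + 1), {ω | ρ ≤ D (θ (T + s) ω)} := by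
      ext ω
      simp [hE]
    rw [this]
    refine Finset.measurableSet_biUnion _ fun s hs => ?_
    have hs' : T + s ≤ T + n := by
      have := Finset.mem_range.1 hs
      omega
    exact (hDm.comp ((h.measurable_param (T + s)).mono (h.mono hs') le_rfl)) measurableSet_Ici
  have hsucc : ∀ n, E (n + 1) = E n ∪ {ω | ρ ≤ D (θ (T + (n + 1)) ω)} := by
    intro n
    ext ω
    simp only [hE, Set.mem_ofPred_eq, Set.mem_union, Nat.le_succ_iff]
    constructor
    · rintro ⟨s, hs | rfl, hρ⟩
      exacts [Or.inl ⟨s, hs, hρ⟩, Or.inr hρ]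
    · rintro (⟨s, hs, hρ⟩ | hρ)
      exacts [⟨s, Or.inl hs, hρ⟩, ⟨n + 1, Or.inr rfl, hρ⟩]
  -- The left side is the mean of the process stopped on reaching level `ρ`, with its value there
  -- lowered to `ρ`. Keeping the unstopped part makes the induction close.
  have key : ∀ n, ρ * μ (E n) + ∫⁻ ω in (E n)ᶜ, D (θ (T + n) ω) ∂μ ≤
      ρ * μ {ω | ρ ≤ D (θ T ω)} + ∫⁻ ω in {ω | D (θ T ω) < ρ}, D (θ T ω) ∂μ +
        (ρ + 1) * ∑ s ∈ Finset.range n, ENNReal.ofReal (e (T + s)) := by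
    intro n
    induction n with
    | zero =>
      have h0 : E 0 = {ω | ρ ≤ D (θ T ω)} := by simp [hE]
      have h0' : {ω | ρ ≤ D (θ T ω)}ᶜ = {ω | D (θ T ω) < ρ} := by ext; simp
      simp [h0, h0']
    | succ n ih =>
      set G : Set Ω := {ω | ρ ≤ D (θ (T + (n + 1)) ω)} with hG
      have hGm : MeasurableSet G :=
        (hDm.comp (h.measurable_param' (T + (n + 1)))) measurableSet_Ici
      have hEm' := h.le _ _ (hEm n)
      -- On newly exiting paths `D ≥ ρ`, so recording `ρ` there can only lower the total.
      have hexit : ρ * μ (E (n + 1)) + ∫⁻ ω in (E (n + 1))ᶜ, D (θ (T + (n + 1)) ω) ∂μ ≤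
          ρ * μ (E n) + ∫⁻ ω in (E n)ᶜ, D (θ (T + (n + 1)) ω) ∂μ := by
        have hunion : μ (E (n + 1)) ≤ μ (E n) + μ ((E n)ᶜ ∩ G) := by
          rw [hsucc n, ← Set.union_sdiff_self, Set.sdiff_eq, Set.inter_comm]
          exact measure_union_le _ _
        have hcompl : (E (n + 1))ᶜ = (E n)ᶜ \ G := by
          rw [hsucc n, Set.compl_union, Set.sdiff_eq]
        have hlow : ρ * μ ((E n)ᶜ ∩ G) ≤ ∫⁻ ω in (E n)ᶜ ∩ G, D (θ (T + (n + 1)) ω) ∂μ := by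
          rw [← setLIntegral_const]
          exact setLIntegral_mono' (hEm'.compl.inter hGm) fun ω hω => hω.2
        calc _ ≤ ρ * (μ (E n) + μ ((E n)ᶜ ∩ G)) +
              ∫⁻ ω in (E n)ᶜ \ G, D (θ (T + (n + 1)) ω) ∂μ := by
              rw [hcompl]
              gcongr
          _ = ρ * μ (E n) + (ρ * μ ((E n)ᶜ ∩ G) +
              ∫⁻ ω in (E n)ᶜ \ G, D (θ (T + (n + 1)) ω) ∂μ) := by ring
          _ ≤ ρ * μ (E n) + (∫⁻ ω in (E n)ᶜ ∩ G, D (θ (T + (n + 1)) ω) ∂μ +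
              ∫⁻ ω in (E n)ᶜ \ G, D (θ (T + (n + 1)) ω) ∂μ) := by gcongr
          _ = _ := by rw [lintegral_inter_add_sdiff _ _ hGm]
      -- Before exit `D < ρ`, so the error of one step is at most `e * (ρ + 1)`.
      have hdrift : ∫⁻ ω in (E n)ᶜ, D (θ (T + (n + 1)) ω) ∂μ ≤
          ∫⁻ ω in (E n)ᶜ, D (θ (T + n) ω) ∂μ + (ρ + 1) * ENNReal.ofReal (e (T + n)) := by
        refine (le_self_add.trans (h.setLIntegral_succ_add_le hD hrec hstep (T + n)
          (hEm n).compl)).trans ?_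
        rw [lintegral_add_left (f := fun ω => D (θ (T + n) ω)) (hDm.comp (h.measurable_param' _))]
        gcongr
        calc ∫⁻ ω in (E n)ᶜ, ENNReal.ofReal (e (T + n)) * (D (θ (T + n) ω) + 1) ∂μ
            ≤ ∫⁻ _ in (E n)ᶜ, ENNReal.ofReal (e (T + n)) * (ρ + 1) ∂μ := by
              refine setLIntegral_mono' hEm'.compl fun ω hω => ?_
              gcongr
              by_contra hlt
              exact hω ⟨n, le_rfl, (not_le.1 hlt).le⟩
          _ ≤ ENNReal.ofReal (e (T + n)) * (ρ + 1) * 1 := by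
              rw [setLIntegral_const]
              gcongr
              exact prob_le_one
          _ = _ := by ring
      calc _ ≤ ρ * μ (E n) + ∫⁻ ω in (E n)ᶜ, D (θ (T + (n + 1)) ω) ∂μ := hexit
        _ ≤ ρ * μ (E n) + (∫⁻ ω in (E n)ᶜ, D (θ (T + n) ω) ∂μ +
            (ρ + 1) * ENNReal.ofReal (e (T + n))) := by gcongr
        _ = (ρ * μ (E n) + ∫⁻ ω in (E n)ᶜ, D (θ (T + n) ω) ∂μ) +
            (ρ + 1) * ENNReal.ofReal (e (T + n)) := by ring
        _ ≤ _ := by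
          rw [Finset.sum_range_succ, mul_add, ← add_assoc]
          gcongr
  exact le_self_add.trans (key n)

/-- With high probability the Lyapunov function is uniformly small from some time on. -/
theorem exists_forall_measure_exit_le (h : IsKernelDriven μ F θ ζ κ) (hDm : Measurable D)
    (hD : ∀ t, Measurable fun p : P × Z => D (step t p.1 p.2))
    (hrec : ∀ t ω, θ (t + 1) ω = step t (θ t ω) (ζ t ω))
    (hstep : ∀ t p, ∫⁻ z, D (step t p z) ∂(κ p) + ENNReal.ofReal (γ t) * b p ≤
      D p + ENNReal.ofReal (e t) * (D p + 1))
    (he : ∀ t, 0 ≤ e t) (hes : Summable e) (hγ : ∀ t, 0 ≤ γ t) (hγs : ¬ Summable γ)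
    (h0 : ∫⁻ ω, D (θ 0 ω) ∂μ ≠ ∞)
    (hsep : ∀ r R : ℝ≥0∞, r ≠ 0 → R ≠ ∞ → ∃ c : ℝ≥0∞, c ≠ 0 ∧
      ∀ p, r ≤ D p → D p ≤ R → c ≤ b p)
    {ρ ε : ℝ≥0∞} (hρ : ρ ≠ 0) (hρt : ρ ≠ ∞) (hε : ε ≠ 0) :
    ∃ T, ∀ n, μ {ω | ∃ s ≤ n, ρ ≤ D (θ (T + s) ω)} ≤ ε := by
  obtain ⟨C, hC, hDC, hbC⟩ := exists_bound_of_almost_decreasing he hes h0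
    (h.lintegral_succ_add_le hDm hD hrec hstep)
  set ε₁ : ℝ≥0∞ := min ε 1 with hε₁
  have hε₁0 : ε₁ ≠ 0 := (lt_min (pos_iff_ne_zero.2 hε) one_pos).ne'
  have hε₁t : ε₁ ≠ ∞ := ((min_le_right _ _).trans_lt ENNReal.one_lt_top).ne
  -- Four contributions of size `τ` arise below: large `D`, middle `D`, small `D` at time `T`, and
  -- the tail of the errors.
  set τ : ℝ≥0∞ := ρ * ε₁ / 4 with hτ
  have hτ0 : τ ≠ 0 := by
    rw [hτ, ENNReal.div_ne_zero]
    exact ⟨mul_ne_zero hρ hε₁0, by simp⟩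
  have hτt : τ ≠ ∞ := ENNReal.div_ne_top (ENNReal.mul_ne_top hρt hε₁t) (by simp)
  -- Chosen so that Markov's inequality with `E D ≤ C` gives `hlarge`; the `+ 1` keeps `R` nonzero.
  set R : ℝ≥0∞ := 2 * ρ * C / τ + 1 with hR
  have hRt : R ≠ ∞ := by
    refine ENNReal.add_ne_top.2 ⟨ENNReal.div_ne_top ?_ hτ0, ENNReal.one_ne_top⟩
    exact ENNReal.mul_ne_top (ENNReal.mul_ne_top (by simp) hρt) hC
  have hR0 : R ≠ 0 := by simp [hR]
  obtain ⟨c₀, hc₀, hsep'⟩ := hsep τ R hτ0 hRt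
  set c : ℝ≥0∞ := min c₀ 1 with hc
  have hc0 : c ≠ 0 := (lt_min (pos_iff_ne_zero.2 hc₀) one_pos).ne'
  have hct : c ≠ ∞ := ((min_le_right _ _).trans_lt ENNReal.one_lt_top).ne
  -- If the mean of `b` is below this level, Markov's inequality with `b ≥ c` on the annulus gives
  -- `hmiddle`.
  have hβ : τ * c / (2 * ρ) ≠ 0 := by
    rw [ENNReal.div_ne_zero]
    exact ⟨mul_ne_zero hτ0 hc0, ENNReal.mul_ne_top (by simp) hρt⟩
  have hetop : ∑' s, ENNReal.ofReal (e s) ≠ ∞ := by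
    rw [← ENNReal.ofReal_tsum_of_nonneg he hes]
    exact ENNReal.ofReal_ne_top
  have htail : ∀ᶠ T in atTop, (ρ + 1) * ∑' s, ENNReal.ofReal (e (s + T)) ≤ τ := by
    have := ENNReal.Tendsto.const_mul (ENNReal.tendsto_sum_nat_add _ hetop)
      (Or.inr (ENNReal.add_ne_top.2 ⟨hρt, ENNReal.one_ne_top⟩))
    rw [mul_zero] at this
    exact (this.eventually_lt_const (pos_iff_ne_zero.2 hτ0)).mono fun _ hT => hT.le
  -- The mean of `b` is known to be small only at infinitely many times; one of them is late enough
  -- for the tail bound.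
  obtain ⟨T, hbT, hTtail⟩ :=
    ((frequently_le_of_sum_le hγ hγs hC hbC hβ).and_eventually htail).exists
  refine ⟨T, fun n => ?_⟩
  have hDT : Measurable fun ω => D (θ T ω) := hDm.comp (h.measurable_param' T)
  have hlarge : 2 * ρ * μ {ω | R ≤ D (θ T ω)} ≤ τ := by
    have hmarkov : R * μ {ω | R ≤ D (θ T ω)} ≤ C :=
      (mul_meas_ge_le_lintegral hDT R).trans (hDC T)
    have hle : μ {ω | R ≤ D (θ T ω)} ≤ C / R := by
      rw [ENNReal.le_div_iff_mul_le (Or.inl hR0) (Or.inl hRt), mul_comm]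
      exact hmarkov
    calc 2 * ρ * μ {ω | R ≤ D (θ T ω)} ≤ 2 * ρ * (C / R) := by gcongr
      _ = 2 * ρ * C / R := (mul_div_assoc _ _ _).symm
      _ ≤ τ := by
        refine ENNReal.div_le_of_le_mul ?_
        rw [hR, mul_add, ENNReal.mul_div_cancel hτ0 hτt]
        exact le_self_add
  have hmiddle : 2 * ρ * μ {ω | τ ≤ D (θ T ω) ∧ D (θ T ω) ≤ R} ≤ τ := by
    have hms : MeasurableSet {ω | τ ≤ D (θ T ω) ∧ D (θ T ω) ≤ R} :=
      (hDT measurableSet_Ici).inter (hDT measurableSet_Iic)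
    have hle : c * μ {ω | τ ≤ D (θ T ω) ∧ D (θ T ω) ≤ R} ≤ τ * c / (2 * ρ) := by
      refine le_trans ?_ hbT
      rw [← setLIntegral_const]
      refine (setLIntegral_mono' hms fun ω hω => ?_).trans (setLIntegral_le_lintegral _ _)
      exact (min_le_left _ _).trans (hsep' _ hω.1 hω.2)
    rw [ENNReal.le_div_iff_mul_le (Or.inl (mul_ne_zero two_ne_zero hρ))
      (Or.inl (ENNReal.mul_ne_top (by simp) hρt))] at hle
    rw [← ENNReal.mul_le_mul_iff_left hc0 hct]
    calc _ = c * μ {ω | τ ≤ D (θ T ω) ∧ D (θ T ω) ≤ R} * (2 * ρ) := by ring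
      _ ≤ _ := hle
  have hsplit : 2 * ρ * μ {ω | τ ≤ D (θ T ω)} ≤ 2 * τ := by
    have hsub : {ω | τ ≤ D (θ T ω)} ⊆
        {ω | R ≤ D (θ T ω)} ∪ {ω | τ ≤ D (θ T ω) ∧ D (θ T ω) ≤ R} := by
      intro ω hω
      rcases le_total R (D (θ T ω)) with hle | hle
      exacts [Or.inl hle, Or.inr ⟨hω, hle⟩]
    calc _ ≤ 2 * ρ * (μ {ω | R ≤ D (θ T ω)} +
          μ {ω | τ ≤ D (θ T ω) ∧ D (θ T ω) ≤ R}) := by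
          gcongr
          exact (measure_mono hsub).trans (measure_union_le _ _)
      _ ≤ τ + τ := by
          rw [mul_add]
          gcongr
      _ = 2 * τ := (two_mul τ).symm
  have hτρ : τ ≤ ρ := by
    calc τ ≤ ρ * ε₁ := ENNReal.div_le_of_le_mul (le_mul_of_one_le_right' (by norm_num))
      _ ≤ ρ := mul_le_of_le_one_right' (min_le_right _ _)
  have hinit : ρ * μ {ω | ρ ≤ D (θ T ω)} + ∫⁻ ω in {ω | D (θ T ω) < ρ}, D (θ T ω) ∂μ ≤
      2 * ρ * μ {ω | τ ≤ D (θ T ω)} + τ := by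
    -- Where `D < ρ`, use the bound `ρ` if `D ≥ τ` and the bound `τ` otherwise.
    have hint : ∫⁻ ω in {ω | D (θ T ω) < ρ}, D (θ T ω) ∂μ ≤
        ρ * μ {ω | τ ≤ D (θ T ω)} + τ := by
      have hm1 : MeasurableSet {ω | D (θ T ω) < ρ} := hDT measurableSet_Iio
      have hm2 : MeasurableSet {ω | τ ≤ D (θ T ω)} := hDT measurableSet_Ici
      calc ∫⁻ ω in {ω | D (θ T ω) < ρ}, D (θ T ω) ∂μ
          ≤ ∫⁻ ω, {ω | τ ≤ D (θ T ω)}.indicator (fun _ => ρ) ω + τ ∂μ := by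
            rw [← lintegral_indicator hm1]
            refine lintegral_mono fun ω => ?_
            by_cases h1 : D (θ T ω) < ρ
            · rw [Set.indicator_of_mem (show ω ∈ {ω | D (θ T ω) < ρ} from h1)]
              by_cases h2 : τ ≤ D (θ T ω)
              · rw [Set.indicator_of_mem (show ω ∈ {ω | τ ≤ D (θ T ω)} from h2)]
                exact h1.le.trans le_self_add
              · exact (not_le.1 h2).le.trans le_add_self
            · rw [Set.indicator_of_notMem (show ω ∉ {ω | D (θ T ω) < ρ} from h1)]
              exact zero_le
        _ = _ := by
            rw [lintegral_add_right _ measurable_const, lintegral_indicator_const hm2]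
            simp
    calc _ ≤ ρ * μ {ω | τ ≤ D (θ T ω)} + (ρ * μ {ω | τ ≤ D (θ T ω)} + τ) := by
          gcongr
      _ = _ := by ring
  have hmax := h.maximal_inequality hDm hD hrec hstep ρ T n
  have hfin : ρ * μ {ω | ∃ s ≤ n, ρ ≤ D (θ (T + s) ω)} ≤ ρ * ε₁ := by
    calc _ ≤ (2 * ρ * μ {ω | τ ≤ D (θ T ω)} + τ) +
          (ρ + 1) * ∑' s, ENNReal.ofReal (e (s + T)) := by
          refine hmax.trans ?_
          gcongr
          simp_rw [add_comm T]
          exact ENNReal.sum_le_tsum (f := fun s => ENNReal.ofReal (e (s + T))) _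
      _ ≤ (2 * τ + τ) + τ := by gcongr
      _ = 4 * τ := by ring
      _ = ρ * ε₁ := ENNReal.mul_div_cancel (by simp) (by simp)
  rw [ENNReal.mul_le_mul_iff_right hρ hρt] at hfin
  exact hfin.trans (min_le_left _ _)

end IsKernelDriven

/-! ### A weak law of large numbers for kernel-driven data. -/

namespace IsKernelDriven

variable {Ω P Z : Type*} [MeasurableSpace Ω] [MeasurableSpace P] [MeasurableSpace Z]
  {μ : Measure Ω} [IsProbabilityMeasure μ] {F : ℕ → MeasurableSpace Ω} {θ : ℕ → Ω → P}
  {ζ : ℕ → Ω → Z} {κ : Kernel P Z} [IsMarkovKernel κ]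

lemma measurable_integral_kernel {g : Z → ℝ} (hg : Measurable g) :
    Measurable fun p => ∫ z, g z ∂(κ p) :=
  (hg.stronglyMeasurable.integral_kernel (κ := κ)).measurable

lemma abs_integral_kernel_le {g : Z → ℝ} {c : ℝ} (hc : ∀ z, |g z| ≤ c) (p : P) :
    |∫ z, g z ∂(κ p)| ≤ c := by
  have := norm_integral_le_of_norm_le_const (μ := κ p) (f := g) (ae_of_all _ hc)
  simpa using this

/-- A centred bounded increment is orthogonal to bounded functions of the past. -/
lemma integral_mul_centred_eq_zero (h : IsKernelDriven μ F θ ζ κ) (t : ℕ) {g : Z → ℝ}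
    (hg : Measurable g) {c : ℝ} (hc : ∀ z, |g z| ≤ c) {V : Ω → ℝ} (hV : Measurable[F t] V)
    {C : ℝ} (hVb : ∀ ω, |V ω| ≤ C) :
    ∫ ω, V ω * (g (ζ t ω) - ∫ z, g z ∂(κ (θ t ω))) ∂μ = 0 := by
  have hVm : Measurable V := hV.mono (h.le t) le_rfl
  have hq : Measurable fun p => ∫ z, g z ∂(κ p) := measurable_integral_kernel hg
  have hpair : Measurable fun ω => ((θ t ω, V ω), ζ t ω) :=
    ((h.measurable_param' t).prodMk hVm).prodMk (h.measurable_obs' t)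
  have hf : Measurable fun x : (P × ℝ) × Z => x.1.2 * (g x.2 - ∫ z, g z ∂(κ x.1.1)) :=
    (measurable_snd.comp measurable_fst).mul ((hg.comp measurable_snd).sub
      (hq.comp (measurable_fst.comp measurable_fst)))
  have hint : Integrable (fun x : (P × ℝ) × Z => x.1.2 * (g x.2 - ∫ z, g z ∂(κ x.1.1)))
      (μ.map fun ω => ((θ t ω, V ω), ζ t ω)) := by
    rw [integrable_map_measure hf.aestronglyMeasurable hpair.aemeasurable]
    refine Integrable.of_bound (C := C * (c + c)) (hf.comp hpair).aestronglyMeasurable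
      (ae_of_all _ fun ω => ?_)
    simp only [Function.comp_apply, Real.norm_eq_abs, abs_mul]
    have hC : 0 ≤ C := (abs_nonneg _).trans (hVb ω)
    gcongr
    · exact hVb ω
    · exact (abs_sub _ _).trans (add_le_add (hc _) (abs_integral_kernel_le hc _))
  have hmap := integral_map (μ := μ) hpair.aemeasurable hf.aestronglyMeasurable
  rw [← hmap]
  rw [h.law t V hV] at hint ⊢
  rw [Measure.integral_compProd hint]
  refine integral_eq_zero_of_ae (ae_of_all _ fun u => ?_)
  have hgi : Integrable g (κ u.1) :=
    Integrable.of_bound hg.aestronglyMeasurable (C := c) (ae_of_all _ hc)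
  simp only [Kernel.prodMkRight_apply, Pi.zero_apply]
  rw [integral_const_mul, integral_sub hgi (integrable_const _)]
  simp

/-- The second moment of a sum of centred bounded increments grows at most linearly. -/
lemma integral_sum_centred_sq_le (h : IsKernelDriven μ F θ ζ κ) {g : Z → ℝ} (hg : Measurable g)
    {c : ℝ} (hc : ∀ z, |g z| ≤ c) (n : ℕ) :
    ∫ ω, (∑ s ∈ Finset.range n, (g (ζ s ω) - ∫ z, g z ∂(κ (θ s ω)))) ^ 2 ∂μ ≤
      n * (2 * c) ^ 2 := by
  have hq : Measurable fun p => ∫ z, g z ∂(κ p) := measurable_integral_kernel hg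
  have hmb : ∀ s ω, |g (ζ s ω) - ∫ z, g z ∂(κ (θ s ω))| ≤ 2 * c := fun s ω => by
    rw [two_mul]
    exact (abs_sub _ _).trans (add_le_add (hc _) (abs_integral_kernel_le hc _))
  have hSF : ∀ n, Measurable[F n] fun ω =>
      ∑ s ∈ Finset.range n, (g (ζ s ω) - ∫ z, g z ∂(κ (θ s ω))) := by
    intro n
    refine Finset.measurable_fun_sum _ fun s hs => ?_
    have hs' := Finset.mem_range.1 hs
    exact (hg.comp ((h.measurable_obs s).mono (h.mono hs') le_rfl)).sub
      (hq.comp ((h.measurable_param s).mono (h.mono hs'.le) le_rfl))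
  have hSb : ∀ n ω, |∑ s ∈ Finset.range n, (g (ζ s ω) - ∫ z, g z ∂(κ (θ s ω)))| ≤
      n * (2 * c) := by
    intro n ω
    refine (Finset.abs_sum_le_sum_abs _ _).trans ((Finset.sum_le_sum fun s _ => hmb s ω).trans ?_)
    simp
  induction n with
  | zero => simp
  | succ n ih =>
    set S : Ω → ℝ := fun ω =>
      ∑ s ∈ Finset.range n, (g (ζ s ω) - ∫ z, g z ∂(κ (θ s ω))) with hS
    set m : Ω → ℝ := fun ω => g (ζ n ω) - ∫ z, g z ∂(κ (θ n ω)) with hm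
    have hSm : Measurable S := (hSF n).mono (h.le n) le_rfl
    have hmm : Measurable m :=
      (hg.comp (h.measurable_obs' n)).sub (hq.comp (h.measurable_param' n))
    have hbdd : ∀ {u : Ω → ℝ} {K : ℝ}, Measurable u → (∀ ω, |u ω| ≤ K) → Integrable u μ :=
      fun hu hK => Integrable.of_bound hu.aestronglyMeasurable _ (ae_of_all _ hK)
    have hSS : Integrable (fun ω => S ω ^ 2) μ := hbdd (hSm.pow_const 2) (K := (n * (2 * c)) ^ 2)
      fun ω => by rw [abs_pow]; exact pow_le_pow_left₀ (abs_nonneg _) (hSb n ω) 2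
    have hmsq : ∀ ω, |m ω ^ 2| ≤ (2 * c) ^ 2 := fun ω => by
      rw [abs_pow]; exact pow_le_pow_left₀ (abs_nonneg _) (hmb n ω) 2
    have hmm2 : Integrable (fun ω => m ω ^ 2) μ := hbdd (hmm.pow_const 2) hmsq
    have hSmi : Integrable (fun ω => 2 * (S ω * m ω)) μ :=
      (hbdd (hSm.mul hmm) (K := (n * (2 * c)) * (2 * c)) fun ω => by
        rw [Pi.mul_apply, abs_mul]
        exact mul_le_mul (hSb n ω) (hmb n ω) (abs_nonneg _)
          ((abs_nonneg _).trans (hSb n ω))).const_mul 2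
    -- The cross term has mean zero because `S` is a bounded function of the past `F n`.
    have hexp : ∀ ω, (∑ s ∈ Finset.range (n + 1), (g (ζ s ω) - ∫ z, g z ∂(κ (θ s ω)))) ^ 2 =
        S ω ^ 2 + 2 * (S ω * m ω) + m ω ^ 2 := fun ω => by
      rw [Finset.sum_range_succ]
      simp only [hS, hm]
      ring
    simp_rw [hexp]
    have hsum : Integrable (fun ω => S ω ^ 2 + 2 * (S ω * m ω)) μ := hSS.add hSmi
    rw [integral_add hsum hmm2, integral_add hSS hSmi, integral_const_mul,
      h.integral_mul_centred_eq_zero n hg hc (hSF n) (hSb n)]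
    have hlast : ∫ ω, m ω ^ 2 ∂μ ≤ (2 * c) ^ 2 := by
      have := integral_mono hmm2 (integrable_const ((2 * c) ^ 2))
        fun ω => (le_abs_self _).trans (hmsq ω)
      simpa using this
    push_cast
    linarith

/-- The averages of centred bounded increments vanish in probability. -/
lemma tendstoInMeasure_average_centred (h : IsKernelDriven μ F θ ζ κ) {g : Z → ℝ}
    (hg : Measurable g) {c : ℝ} (hc : ∀ z, |g z| ≤ c) :
    TendstoInMeasure μ (fun (n : ℕ) ω => (n : ℝ)⁻¹ *
      ∑ s ∈ Finset.range n, (g (ζ s ω) - ∫ z, g z ∂(κ (θ s ω)))) atTop (fun _ => 0) := by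
  have hq : Measurable fun p => ∫ z, g z ∂(κ p) := measurable_integral_kernel hg
  have hm : ∀ n : ℕ, Measurable fun ω => (n : ℝ)⁻¹ *
      ∑ s ∈ Finset.range n, (g (ζ s ω) - ∫ z, g z ∂(κ (θ s ω))) := fun n =>
    (Finset.measurable_fun_sum _ fun s _ => (hg.comp (h.measurable_obs' s)).sub
      (hq.comp (h.measurable_param' s))).const_mul _
  refine tendstoInMeasure_of_tendsto_eLpNorm one_ne_zero
    (fun n => (hm n).aestronglyMeasurable) aestronglyMeasurable_const ?_
  have hlim : Tendsto (fun n : ℕ => ENNReal.ofReal ((n : ℝ)⁻¹ * (2 * c) ^ 2)) atTop (𝓝 0) := by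
    have := (tendsto_inv_atTop_nhds_zero_nat (𝕜 := ℝ)).mul_const ((2 * c) ^ 2)
    simpa using ENNReal.tendsto_ofReal this
  refine tendsto_zero_of_sq_le hlim fun n => ?_
  rw [eLpNorm_one_eq_lintegral_enorm]
  simp only [Pi.sub_apply, sub_zero]
  refine (lintegral_sq_le μ (hm n).enorm.aemeasurable).trans ?_
  rw [measure_univ, mul_one]
  have hsq : ∀ x : ℝ, ‖x‖ₑ ^ 2 = ENNReal.ofReal (x ^ 2) := fun x => by
    rw [← ofReal_norm, ← ENNReal.ofReal_pow (norm_nonneg _), Real.norm_eq_abs, sq_abs]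
  simp_rw [hsq, mul_pow]
  have hint : Integrable (fun ω => ((n : ℝ)⁻¹) ^ 2 *
      (∑ s ∈ Finset.range n, (g (ζ s ω) - ∫ z, g z ∂(κ (θ s ω)))) ^ 2) μ := by
    refine Integrable.const_mul ?_ _
    refine Integrable.of_bound (C := (n * (2 * c)) ^ 2) (Measurable.aestronglyMeasurable
      ((Finset.measurable_fun_sum _ fun s _ => (hg.comp (h.measurable_obs' s)).sub
      (hq.comp (h.measurable_param' s))).pow_const 2)) (ae_of_all _ fun ω => ?_)
    rw [Real.norm_eq_abs, abs_pow]
    refine pow_le_pow_left₀ (abs_nonneg _) ((Finset.abs_sum_le_sum_abs _ _).trans ?_) 2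
    refine (Finset.sum_le_sum (g := fun _ => 2 * c) fun s _ => ?_).trans (by simp)
    rw [two_mul]
    exact (abs_sub _ _).trans (add_le_add (hc _) (abs_integral_kernel_le hc _))
  rw [← ofReal_integral_eq_lintegral_ofReal hint (ae_of_all _ fun ω => by positivity),
    integral_const_mul]
  refine ENNReal.ofReal_le_ofReal ?_
  rcases Nat.eq_zero_or_pos n with rfl | hn
  · simp
  have hn' : (0 : ℝ) < n := Nat.cast_pos.2 hn
  calc ((n : ℝ)⁻¹) ^ 2 * _ ≤ ((n : ℝ)⁻¹) ^ 2 * (n * (2 * c) ^ 2) := by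
        gcongr
        exact h.integral_sum_centred_sq_le hg hc n
    _ = (n : ℝ)⁻¹ * (2 ^ 2 * c ^ 2) := by field_simp

/-- A weak law of large numbers for a statistic of adaptively collected data, when the parameter
settles near a point at which the statistic and the sampling kernel are continuous in mean. -/
theorem tendstoInMeasure_average (h : IsKernelDriven μ F θ ζ κ) {ν : Measure Z}
    [IsFiniteMeasure ν] (hκ : ∀ p, κ p ≤ ν) {l : Filter P} {p₀ : P} {f : P → Z → ℝ}
    (hf : Measurable fun x : P × Z => f x.1 x.2) (hfi : Integrable (f p₀) ν)
    (hsub : Tendsto (fun p => ∫⁻ z, ‖f p z - f p₀ z‖ₑ ∂ν) l (𝓝 0)) {L : ℝ}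
    (hpol : Tendsto (fun p => ∫ z, f p₀ z ∂(κ p)) l (𝓝 L))
    (hexit : ∀ U ∈ l, ∀ ε : ℝ≥0∞, ε ≠ 0 → ∃ T, ∀ n, μ {ω | ∃ s ≤ n, θ (T + s) ω ∉ U} ≤ ε) :
    TendstoInMeasure μ (fun (n : ℕ) ω => (n : ℝ)⁻¹ * ∑ s ∈ Finset.range n, f (θ s ω) (ζ s ω))
      atTop (fun _ => L) := by
  rw [tendstoInMeasure_iff_norm]
  intro δ hδ
  rw [ENNReal.tendsto_nhds_zero]
  intro ε' hε'
  obtain ⟨e, he, hee⟩ : ∃ e : ℝ, 0 < e ∧ 4 * ENNReal.ofReal e ≤ ε' := by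
    have h4 : (0 : ℝ≥0∞) < min ε' 1 / 4 :=
      ENNReal.div_pos (lt_min hε' one_pos).ne' (by simp)
    have h4t : min ε' 1 / 4 ≠ ∞ :=
      ENNReal.div_ne_top ((min_le_right _ _).trans_lt ENNReal.one_lt_top).ne (by simp)
    refine ⟨(min ε' 1 / 4).toReal, ENNReal.toReal_pos h4.ne' h4t, ?_⟩
    rw [ENNReal.ofReal_toReal h4t, ENNReal.mul_div_cancel (by simp) (by simp)]
    exact min_le_left _ _
  -- The first bound makes the deterministic error `2 * a` at most `δ / 8`; the second makes
  -- Markov's inequality give `2 * a / (δ / 4) ≤ e`.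
  set a : ℝ := min (δ / 16) (e * δ / 8) with ha
  have ha0 : 0 < a := by positivity
  have haδ : a ≤ δ / 16 := min_le_left _ _
  have hae : a ≤ e * δ / 8 := min_le_right _ _
  -- A simple function is bounded, so the second-moment bound applies to it although `f p₀` is only
  -- integrable.
  obtain ⟨g, hgL, -⟩ := (memLp_one_iff_integrable.2 hfi).exists_simpleFunc_eLpNorm_sub_lt
    ENNReal.one_ne_top (ENNReal.ofReal_pos.2 ha0).ne'
  rw [eLpNorm_one_eq_lintegral_enorm] at hgL
  simp only [Pi.sub_apply] at hgL
  obtain ⟨c, hc⟩ : ∃ c, ∀ z, |g z| ≤ c := by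
    obtain ⟨c, hc⟩ := g.exists_forall_norm_le
    exact ⟨c, hc⟩
  have hg : Measurable g := g.measurable
  have hq : Measurable fun p => ∫ z, g z ∂(κ p) := measurable_integral_kernel hg
  have hf₀ : Measurable (f p₀) := hf.comp measurable_prodMk_left
  have hr : Measurable fun p => ∫⁻ z, ‖f p z - f p₀ z‖ₑ ∂ν :=
    Measurable.lintegral_prod_right' (f := fun x : P × Z => ‖f x.1 x.2 - f p₀ x.2‖ₑ)
      (hf.sub (hf₀.comp measurable_snd)).enorm
  set U₁ : Set P := {p | ∫⁻ z, ‖f p z - f p₀ z‖ₑ ∂ν ≤ ENNReal.ofReal a} with hU₁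
  have hU₁m : MeasurableSet U₁ := hr measurableSet_Iic
  set U₂ : Set P := {p | |∫ z, f p₀ z ∂(κ p) - L| ≤ a} with hU₂
  have hUl : U₁ ∩ U₂ ∈ l := by
    refine inter_mem ?_ ?_
    · exact (hsub.eventually_lt_const (ENNReal.ofReal_pos.2 ha0)).mono fun p hp => hp.le
    · have := hpol.eventually (Metric.closedBall_mem_nhds L ha0)
      exact this.mono fun p hp => by simpa [hU₂, Real.dist_eq] using hp
  obtain ⟨T, hT⟩ := hexit _ hUl (ENNReal.ofReal e) (ENNReal.ofReal_pos.2 he).ne'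
  -- Cutting off by `U₁`, which depends on `θ s` alone, bounds the mean of `J s` at every time
  -- without conditioning on the event that the parameter stays near `p₀`.
  set J : ℕ → Ω → ℝ := fun s ω =>
    U₁.indicator (fun _ => |f (θ s ω) (ζ s ω) - g (ζ s ω)|) (θ s ω) with hJ
  have hJind : ∀ s ω, J s ω = (U₁ ×ˢ (Set.univ : Set Z)).indicator
      (fun x : P × Z => |f x.1 x.2 - g x.2|) (θ s ω, ζ s ω) := by
    intro s ω
    by_cases hω : θ s ω ∈ U₁ <;> simp [hJ, hω]
  have hJ2 : Measurable ((U₁ ×ˢ (Set.univ : Set Z)).indicator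
      (fun x : P × Z => |f x.1 x.2 - g x.2|)) :=
    (hf.sub (hg.comp measurable_snd)).abs.indicator (hU₁m.prod MeasurableSet.univ)
  have hJ0 : ∀ s ω, 0 ≤ J s ω := fun s ω => Set.indicator_nonneg (fun _ _ => abs_nonneg _) _
  have hJm : ∀ s, Measurable (J s) := fun s => by
    have : J s = fun ω => _ := funext (hJind s)
    rw [this]
    exact hJ2.comp ((h.measurable_param' s).prodMk (h.measurable_obs' s))
  have hJle : ∀ s, ∫⁻ ω, ENNReal.ofReal (J s ω) ∂μ ≤ 2 * ENNReal.ofReal a := by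
    intro s
    simp_rw [hJind]
    rw [h.lintegral_eq s hJ2.ennreal_ofReal]
    calc _ ≤ ∫⁻ _, 2 * ENNReal.ofReal a ∂μ := by
          refine lintegral_mono fun ω => ?_
          by_cases hω : θ s ω ∈ U₁
          · calc _ ≤ ∫⁻ z, ‖f (θ s ω) z - f p₀ z‖ₑ + ‖f p₀ z - g z‖ₑ ∂ν := by
                  refine lintegral_mono' (hκ _) fun z => ?_
                  rw [Set.indicator_of_mem (by simpa using hω), ← Real.norm_eq_abs, ofReal_norm]
                  simpa using enorm_add_le (f (θ s ω) z - f p₀ z) (f p₀ z - g z)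
              _ ≤ ENNReal.ofReal a + ENNReal.ofReal a := by
                  rw [lintegral_add_right (g := fun z => ‖f p₀ z - g z‖ₑ) _ (hf₀.sub hg).enorm]
                  gcongr
                  exact hω
              _ = _ := (two_mul _).symm
          · simp [hω]
      _ = _ := by simp
  -- What is left of `f - L` once the centred increment of `g` is removed.
  set W : ℕ → Ω → ℝ := fun s ω => f (θ s ω) (ζ s ω) - g (ζ s ω) + ∫ z, g z ∂(κ (θ s ω)) - L with hW
  have hWm : ∀ s, Measurable (W s) := fun s =>
    (((hf.comp ((h.measurable_param' s).prodMk (h.measurable_obs' s))).sub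
      (hg.comp (h.measurable_obs' s))).add (hq.comp (h.measurable_param' s))).sub_const _
  have hWle : ∀ s ω, θ s ω ∈ U₁ ∩ U₂ → |W s ω| ≤ J s ω + 2 * a := by
    intro s ω hω
    have hJs : J s ω = |f (θ s ω) (ζ s ω) - g (ζ s ω)| := by simp [hJ, hω.1]
    have hgi : Integrable g (κ (θ s ω)) :=
      Integrable.of_bound hg.aestronglyMeasurable (C := c) (ae_of_all _ hc)
    have hq' : |∫ z, g z ∂(κ (θ s ω)) - ∫ z, f p₀ z ∂(κ (θ s ω))| ≤ a := by
      rw [← integral_sub hgi (hfi.mono_measure (hκ _)), ← Real.norm_eq_abs,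
        ← ENNReal.ofReal_le_ofReal_iff ha0.le, ofReal_norm]
      refine (enorm_integral_le_lintegral_enorm _).trans
        ((lintegral_mono' (hκ _) fun z => ?_).trans hgL.le)
      rw [enorm_sub_rev]
    have h2 : |∫ z, f p₀ z ∂(κ (θ s ω)) - L| ≤ a := hω.2
    have hsum : W s ω = (f (θ s ω) (ζ s ω) - g (ζ s ω)) +
        ((∫ z, g z ∂(κ (θ s ω)) - ∫ z, f p₀ z ∂(κ (θ s ω))) +
          (∫ z, f p₀ z ∂(κ (θ s ω)) - L)) := by
      simp only [hW]
      ring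
    rw [hsum, hJs]
    refine (abs_add_le _ _).trans (add_le_add le_rfl ((abs_add_le _ _).trans ?_))
    linarith
  -- Before time `T` nothing is known about `W`, but these finitely many terms vanish after division
  -- by `n`.
  set Q : Ω → ℝ := fun ω => ∑ s ∈ Finset.range T, |W s ω| with hQ
  have hQm : Measurable Q := Finset.measurable_fun_sum _ fun s _ => (hWm s).abs
  have hQlim : TendstoInMeasure μ (fun (n : ℕ) ω => (n : ℝ)⁻¹ * Q ω) atTop (fun _ => 0) := by
    refine tendstoInMeasure_of_tendsto_ae (fun n => (hQm.const_mul _).aestronglyMeasurable)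
      (ae_of_all _ fun ω => ?_)
    simpa using (tendsto_inv_atTop_nhds_zero_nat (𝕜 := ℝ)).mul_const (Q ω)
  have hSlim := h.tendstoInMeasure_average_centred hg hc
  rw [tendstoInMeasure_iff_norm] at hQlim hSlim
  have hQev := (ENNReal.tendsto_nhds_zero.1 (hQlim (δ / 4) (by positivity)))
    (ENNReal.ofReal e) (ENNReal.ofReal_pos.2 he)
  have hSev := (ENNReal.tendsto_nhds_zero.1 (hSlim (δ / 4) (by positivity)))
    (ENNReal.ofReal e) (ENNReal.ofReal_pos.2 he)
  filter_upwards [hQev, hSev, eventually_ge_atTop 1] with n hQn hSn hn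
  have hn' : (0 : ℝ) < n := Nat.cast_pos.2 hn
  have hJn : μ {ω | δ / 4 ≤ (n : ℝ)⁻¹ * ∑ s ∈ Finset.range n, J s ω} ≤ ENNReal.ofReal e := by
    have hmeas : Measurable fun ω => (n : ℝ)⁻¹ * ∑ s ∈ Finset.range n, J s ω :=
      (Finset.measurable_fun_sum _ fun s _ => hJm s).const_mul _
    have hle : ENNReal.ofReal (δ / 4) * μ {ω | δ / 4 ≤ (n : ℝ)⁻¹ * ∑ s ∈ Finset.range n, J s ω} ≤
        2 * ENNReal.ofReal a := by
      calc _ ≤ ENNReal.ofReal (δ / 4) * μ {ω | ENNReal.ofReal (δ / 4) ≤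
            ENNReal.ofReal ((n : ℝ)⁻¹ * ∑ s ∈ Finset.range n, J s ω)} := by
            gcongr with ω
            exact ENNReal.ofReal_le_ofReal
        _ ≤ ∫⁻ ω, ENNReal.ofReal ((n : ℝ)⁻¹ * ∑ s ∈ Finset.range n, J s ω) ∂μ :=
            mul_meas_ge_le_lintegral hmeas.ennreal_ofReal _
        _ = ENNReal.ofReal (n : ℝ)⁻¹ * ∑ s ∈ Finset.range n, ∫⁻ ω, ENNReal.ofReal (J s ω) ∂μ := by
            simp_rw [ENNReal.ofReal_mul (inv_nonneg.2 hn'.le),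
              ENNReal.ofReal_sum_of_nonneg fun s _ => hJ0 s _]
            rw [lintegral_const_mul' _ _ ENNReal.ofReal_ne_top,
              lintegral_finsetSum _ fun s _ => (hJm s).ennreal_ofReal]
        _ ≤ ENNReal.ofReal (n : ℝ)⁻¹ * ∑ s ∈ Finset.range n, 2 * ENNReal.ofReal a := by
            gcongr with s
            exact hJle s
        _ = _ := by
            rw [Finset.sum_const, Finset.card_range, nsmul_eq_mul, ← mul_assoc,
              ← ENNReal.ofReal_natCast, ← ENNReal.ofReal_mul (inv_nonneg.2 hn'.le),
              inv_mul_cancel₀ hn'.ne', ENNReal.ofReal_one, one_mul]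
    rw [← ENNReal.mul_le_mul_iff_right (ENNReal.ofReal_pos.2 (by positivity : 0 < δ / 4)).ne'
      ENNReal.ofReal_ne_top]
    refine hle.trans ?_
    rw [two_mul_ofReal, ← ENNReal.ofReal_mul (by positivity)]
    exact ENNReal.ofReal_le_ofReal (by linarith)
  have hcover : {ω | δ ≤ ‖(n : ℝ)⁻¹ * ∑ s ∈ Finset.range n, f (θ s ω) (ζ s ω) - L‖} ⊆
      ({ω | ∃ s ≤ n, θ (T + s) ω ∉ U₁ ∩ U₂} ∪
        {ω | δ / 4 ≤ (n : ℝ)⁻¹ * ∑ s ∈ Finset.range n, J s ω}) ∪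
      ({ω | δ / 4 ≤ ‖(n : ℝ)⁻¹ * Q ω - 0‖} ∪ {ω | δ / 4 ≤ ‖(n : ℝ)⁻¹ *
        ∑ s ∈ Finset.range n, (g (ζ s ω) - ∫ z, g z ∂(κ (θ s ω))) - 0‖}) := by
    intro ω hω
    by_contra hnot
    simp only [Set.mem_union, not_or, sub_zero] at hnot
    obtain ⟨⟨hn1, hn2⟩, hn3, hn4⟩ := hnot
    have hin : ∀ s, T ≤ s → s < n → θ s ω ∈ U₁ ∩ U₂ := by
      intro s hTs hsn
      by_contra hcon
      exact hn1 ⟨s - T, by omega, by rwa [Nat.add_sub_cancel' hTs]⟩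
    have hn2' : (n : ℝ)⁻¹ * ∑ s ∈ Finset.range n, J s ω < δ / 4 := not_le.1 hn2
    have hn3' : ‖(n : ℝ)⁻¹ * Q ω‖ < δ / 4 := not_le.1 hn3
    have hn4' : ‖(n : ℝ)⁻¹ * ∑ s ∈ Finset.range n, (g (ζ s ω) - ∫ z, g z ∂(κ (θ s ω)))‖ < δ / 4 :=
      not_le.1 hn4
    have hsumW : ∑ s ∈ Finset.range n, |W s ω| ≤
        Q ω + ∑ s ∈ Finset.range n, J s ω + n * (2 * a) := by
      have hpt : ∀ s ∈ Finset.range n, |W s ω| ≤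
          (if s < T then |W s ω| else 0) + J s ω + 2 * a := by
        intro s hs
        split_ifs with hsT
        · linarith [hJ0 s ω]
        · rw [zero_add]
          exact hWle s ω (hin s (not_lt.1 hsT) (Finset.mem_range.1 hs))
      refine (Finset.sum_le_sum hpt).trans ?_
      rw [Finset.sum_add_distrib, Finset.sum_add_distrib, Finset.sum_const, Finset.card_range,
        nsmul_eq_mul]
      gcongr
      rw [← Finset.sum_filter]
      refine Finset.sum_le_sum_of_subset_of_nonneg (fun s hs => ?_) fun _ _ _ => abs_nonneg _
      simpa using (Finset.mem_filter.1 hs).2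
    have hdecomp : (n : ℝ)⁻¹ * ∑ s ∈ Finset.range n, f (θ s ω) (ζ s ω) - L =
        (n : ℝ)⁻¹ * ∑ s ∈ Finset.range n, (g (ζ s ω) - ∫ z, g z ∂(κ (θ s ω))) +
        (n : ℝ)⁻¹ * ∑ s ∈ Finset.range n, W s ω := by
      have hWs : ∑ s ∈ Finset.range n, W s ω = ∑ s ∈ Finset.range n, f (θ s ω) (ζ s ω) -
          ∑ s ∈ Finset.range n, (g (ζ s ω) - ∫ z, g z ∂(κ (θ s ω))) - n * L := by
        have hL : (n : ℝ) * L = ∑ _s ∈ Finset.range n, L := by simp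
        rw [hL, ← Finset.sum_sub_distrib, ← Finset.sum_sub_distrib]
        refine Finset.sum_congr rfl fun s _ => ?_
        simp only [hW]
        ring
      rw [hWs]
      field_simp
      ring
    have hfinal : ‖(n : ℝ)⁻¹ * ∑ s ∈ Finset.range n, f (θ s ω) (ζ s ω) - L‖ < δ := by
      rw [hdecomp]
      have hW1 : ‖(n : ℝ)⁻¹ * ∑ s ∈ Finset.range n, W s ω‖ ≤
          (n : ℝ)⁻¹ * Q ω + (n : ℝ)⁻¹ * ∑ s ∈ Finset.range n, J s ω + 2 * a := by
        rw [norm_mul, Real.norm_of_nonneg (inv_nonneg.2 hn'.le), Real.norm_eq_abs]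
        calc _ ≤ (n : ℝ)⁻¹ * (Q ω + ∑ s ∈ Finset.range n, J s ω + n * (2 * a)) := by
              gcongr
              exact (Finset.abs_sum_le_sum_abs _ _).trans hsumW
          _ = _ := by field_simp
      have hQn' := (le_abs_self _).trans_lt hn3'
      have := norm_add_le ((n : ℝ)⁻¹ * ∑ s ∈ Finset.range n,
        (g (ζ s ω) - ∫ z, g z ∂(κ (θ s ω)))) ((n : ℝ)⁻¹ * ∑ s ∈ Finset.range n, W s ω)
      linarith
    exact absurd hω (not_le.2 hfinal)
  calc _ ≤ _ := measure_mono hcover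
    _ ≤ (ENNReal.ofReal e + ENNReal.ofReal e) + (ENNReal.ofReal e + ENNReal.ofReal e) := by
      refine (measure_union_le _ _).trans (add_le_add ?_ ?_)
      · exact (measure_union_le _ _).trans (add_le_add (hT n) hJn)
      · exact (measure_union_le _ _).trans (add_le_add hQn hSn)
    _ = 4 * ENNReal.ofReal e := by ring
    _ ≤ ε' := hee

end IsKernelDriven

/-! ### From entries to matrices, and application to the SGD iterates. -/

/-- Expanding in matrix units bounds the spectral norm by `C` times the largest entry; a union bound
over the entries finishes. -/
lemma tendstoInMeasure_matrix_of_apply {Ω : Type*} [MeasurableSpace Ω] {μ : Measure Ω} {d : ℕ}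
    {B : ℕ → Ω → Matrix (Fin d) (Fin d) ℝ} {B₀ : Matrix (Fin d) (Fin d) ℝ}
    (h : ∀ i j, TendstoInMeasure μ (fun n ω => B n ω i j) atTop fun _ => B₀ i j) :
    TendstoInMeasure μ B atTop fun _ => B₀ := by
  simp only [tendstoInMeasure_iff_norm] at h ⊢
  intro ε hε
  set C : ℝ := ∑ i : Fin d, ∑ j : Fin d, ‖Matrix.single i j (1 : ℝ)‖ with hC
  have hC0 : 0 ≤ C := by positivity
  have hbound : ∀ (A : Matrix (Fin d) (Fin d) ℝ) (τ : ℝ), (∀ i j, ‖A i j‖ ≤ τ) → ‖A‖ ≤ C * τ := by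
    intro A τ hA
    have hAs : A = ∑ i, ∑ j, A i j • Matrix.single i j (1 : ℝ) := by
      conv_lhs => rw [Matrix.matrix_eq_sum_single A]
      simp
    rw [hAs, hC, Finset.sum_mul]
    refine (norm_sum_le _ _).trans (Finset.sum_le_sum fun i _ => ?_)
    rw [Finset.sum_mul]
    refine (norm_sum_le _ _).trans (Finset.sum_le_sum fun j _ => ?_)
    rw [norm_smul, mul_comm]
    gcongr
    exact hA i j
  -- The `+ 1` makes `C * τ < ε` strict and covers `C = 0`, as for `d = 0`.
  set τ : ℝ := ε / (C + 1) with hτ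
  have hτ0 : 0 < τ := by positivity
  have hlim : Tendsto (fun n => ∑ i, ∑ j, μ {ω | τ ≤ ‖B n ω i j - B₀ i j‖}) atTop (𝓝 0) := by
    have := tendsto_finsetSum Finset.univ fun i (_ : i ∈ Finset.univ) =>
      tendsto_finsetSum Finset.univ fun j (_ : j ∈ Finset.univ) => h i j τ hτ0
    simpa using this
  refine tendsto_of_tendsto_of_tendsto_of_le_of_le tendsto_const_nhds hlim (fun _ => zero_le)
    fun n => ?_
  have hsub : {ω | ε ≤ ‖B n ω - B₀‖} ⊆
      ⋃ i ∈ (Finset.univ : Finset (Fin d)), ⋃ j ∈ (Finset.univ : Finset (Fin d)),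
        {ω | τ ≤ ‖B n ω i j - B₀ i j‖} := by
    intro ω hω
    by_contra hcon
    simp only [Finset.mem_univ, Set.iUnion_true, Set.mem_iUnion, not_exists] at hcon
    have := hbound (B n ω - B₀) τ fun i j => (not_le.1 (hcon i j)).le
    have hlt : C * τ < ε := by
      rw [hτ, ← mul_div_assoc, div_lt_iff₀ (by positivity)]
      nlinarith
    exact absurd (show ε ≤ ‖B n ω - B₀‖ from hω) (not_le.2 (this.trans_lt hlt))
  refine (measure_mono hsub).trans ((measure_biUnion_finset_le _ _).trans
    (Finset.sum_le_sum fun i _ => measure_biUnion_finset_le _ _))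

namespace Model

variable {d : ℕ} {𝒳 𝒜 Ω : Type*} [MeasurableSpace 𝒳] [MeasurableSpace 𝒜]
  [Fintype 𝒜] [MeasurableSingletonClass 𝒜] [MeasurableSpace Ω] {M : Model d 𝒳 𝒜}
  {θstar θ₀ : Param d} {φ ψ : 𝒳 → ℝ} {wlo whi δ lam K : ℝ} {η : ℕ → ℝ} {μ : Measure Ω}
  [IsProbabilityMeasure μ] {X : ℕ → Ω → 𝒳} {Y : ℕ → Ω → 𝒜 → ℝ} {A : ℕ → Ω → 𝒜}

/-- With high probability the SGD iterates stay in a given neighbourhood of `θstar` from some time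
on. -/
theorem IsAdaptiveData.exists_forall_measure_sgd_notMem_le
    (hdata : M.IsAdaptiveData η θ₀ μ X Y A)
    (hd : ∀ ζ, Differentiable ℝ fun θ => M.loss θ ζ)
    (h1 : M.BoundedWeight wlo whi) (h2 : M.RegularLoss θstar δ lam)
    (h4 : M.GradientMoment θstar φ) (h5 : M.GradientContinuity θstar φ)
    (hη_pos : ∀ t, 1 ≤ t → 0 < η t) (hη_sum : ¬ Summable fun t : ℕ => η (t + 1))
    (hη_sq : Summable fun t : ℕ => η (t + 1) ^ 2) {U : Set (Param d)} (hU : U ∈ 𝓝 θstar)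
    {ε : ℝ≥0∞} (hε : ε ≠ 0) :
    ∃ T, ∀ n, μ {ω | ∃ s ≤ n, M.sgd η θ₀ X Y A (T + s) ω ∉ U} ≤ ε := by
  obtain ⟨r, hr, hrU⟩ := Metric.mem_nhds_iff.1 hU
  set C : ℝ := whi ^ 2 * (Fintype.card 𝒜 * ∫ x, φ x ∂M.env.fst) with hC
  have hC0 : 0 ≤ C := by
    have := h4.integral_pos
    positivity
  have hη : ∀ t, 0 < η (t + 1) := fun t => hη_pos _ (Nat.le_add_left 1 t)
  have key : ∃ T, ∀ n, μ {ω | ∃ s ≤ n, ENNReal.ofReal (r ^ 2) ≤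
      ENNReal.ofReal (‖M.sgd η θ₀ X Y A (T + s) ω - θstar‖ ^ 2)} ≤ ε := by
    refine (hdata.isKernelDriven hd).exists_forall_measure_exit_le
      -- The step out of index `t` uses `η (t + 1)`. As `D` is a squared distance, levels of `D`
      -- become radii by taking square roots.
      (D := fun p => ENNReal.ofReal (‖p - θstar‖ ^ 2))
      (b := fun p => ENNReal.ofReal (inner ℝ (M.gradPopLoss p p) (p - θstar)))
      (step := fun t p z => p - (η (t + 1) * M.weight p z.1 z.2.1) • M.gradLoss p z)
      (e := fun t => C * η (t + 1) ^ 2) (γ := fun t => 2 * η (t + 1))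
      (ρ := ENNReal.ofReal (r ^ 2)) (ε := ε) (by fun_prop) (fun t => ?_) (fun t ω => rfl)
      (fun t p => ?_) (fun t => by positivity) (hη_sq.mul_left C)
      (fun t => by have := hη t; positivity) (fun hs => hη_sum ?_) ?_ (fun R₁ R₂ hR₁ hR₂ => ?_)
      (ENNReal.ofReal_pos.2 (by positivity)).ne' ENNReal.ofReal_ne_top hε
    · have hg := M.measurable_gradLoss hd
      have hw := M.measurable_weight_obs
      fun_prop
    · have h := lintegral_sgd_step_add_le hd h1 h2 h4 h5 (hη t).le p
      have hin := inner_gradPopLoss_nonneg h2 p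
      have hηt := (hη t).le
      rw [ENNReal.ofReal_mul (by positivity : 0 ≤ 2 * η (t + 1))] at h
      refine h.trans (le_of_eq ?_)
      rw [ENNReal.ofReal_add (by positivity) (by positivity), ENNReal.ofReal_mul (by positivity),
        add_comm 1, ENNReal.ofReal_add (by positivity) zero_le_one, ENNReal.ofReal_one]
    · exact (summable_mul_left_iff two_ne_zero).1 hs
    · have hconst : ∀ ω, M.sgd η θ₀ X Y A 0 ω = θ₀ := fun ω => rfl
      simp [hconst]
    · rcases lt_or_ge R₂ R₁ with hlt | hle
      · exact ⟨1, one_ne_zero, fun p hp1 hp2 => absurd (hp1.trans hp2) (not_le.2 hlt)⟩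
      have hR₁t : R₁ ≠ ∞ := (hle.trans_lt (lt_top_iff_ne_top.2 hR₂)).ne
      have hR₁0 : 0 < R₁.toReal := ENNReal.toReal_pos hR₁ hR₁t
      obtain ⟨c, hc, hsep⟩ := h2.separated (√R₁.toReal) (√R₂.toReal) (Real.sqrt_pos.2 hR₁0)
        (Real.sqrt_le_sqrt (ENNReal.toReal_mono hR₂ hle))
      refine ⟨ENNReal.ofReal c, (ENNReal.ofReal_pos.2 hc).ne', fun p hp1 hp2 =>
        ENNReal.ofReal_le_ofReal (hsep p ?_ ?_)⟩
      · rw [Real.sqrt_le_left (norm_nonneg _)]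
        exact ENNReal.toReal_le_of_le_ofReal (by positivity) hp1
      · refine Real.le_sqrt_of_sq_le ?_
        exact (ENNReal.ofReal_le_iff_le_toReal hR₂).1 hp2
  obtain ⟨T, hT⟩ := key
  refine ⟨T, fun n => (measure_mono fun ω => ?_).trans (hT n)⟩
  rintro ⟨s, hs, hsU⟩
  refine ⟨s, hs, ENNReal.ofReal_le_ofReal ?_⟩
  gcongr
  by_contra hlt
  exact hsU (hrU (by rw [Metric.mem_ball, dist_eq_norm]; exact not_le.1 hlt))

/-- Averages of a statistic that is continuous in mean are consistent for its mean at `θstar`. -/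
theorem ContinuousStatistic.tendstoInMeasure_average {f : Param d → 𝒳 × 𝒜 × ℝ → ℝ}
    (hf : M.ContinuousStatistic θstar f) (hdata : M.IsAdaptiveData η θ₀ μ X Y A)
    (hd : ∀ ζ, Differentiable ℝ fun θ => M.loss θ ζ)
    (h1 : M.BoundedWeight wlo whi) (h2 : M.RegularLoss θstar δ lam)
    (h4 : M.GradientMoment θstar φ) (h5 : M.GradientContinuity θstar φ)
    (hη_pos : ∀ t, 1 ≤ t → 0 < η t) (hη_sum : ¬ Summable fun t : ℕ => η (t + 1))
    (hη_sq : Summable fun t : ℕ => η (t + 1) ^ 2) :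
    TendstoInMeasure μ (fun (n : ℕ) ω => (n : ℝ)⁻¹ * ∑ s ∈ Finset.range n,
      f (M.sgd η θ₀ X Y A s ω) (obs X Y A (s + 1) ω)) atTop
      (fun _ => ∫ z, f θstar z ∂(M.obsLaw θstar)) :=
  (hdata.isKernelDriven hd).tendstoInMeasure_average (ν := M.slotLaw) (l := 𝓝 θstar)
    M.obsLaw_le_slotLaw hf.measurable (hf.integrable θstar) hf.tendsto_sub
    hf.tendsto_integral_policy fun _ hU _ hε =>
      hdata.exists_forall_measure_sgd_notMem_le hd h1 h2 h4 h5 hη_pos hη_sum hη_sq hU hε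

end Model

end AdaptiveSGD

end

theorem proposition1 {d : ℕ} {𝒳 𝒜 Ω : Type*} [MeasurableSpace 𝒳]
    [Fintype 𝒜] [MeasurableSpace 𝒜] [MeasurableSingletonClass 𝒜] [MeasurableSpace Ω]
    (M : AdaptiveSGD.Model d 𝒳 𝒜) (θstar : AdaptiveSGD.Param d)
    (wlo whi δ lam K : ℝ) (φ ψ : 𝒳 → ℝ)
    (h1 : M.BoundedWeight wlo whi)
    (h2 : M.RegularLoss θstar δ lam)
    (h3 : M.RegularHessian θstar δ K)
    (h4 : M.GradientMoment θstar φ)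
    (h5 : M.GradientContinuity θstar φ)
    (h6 : M.HessianConditions θstar ψ)
    (η : ℕ → ℝ) (hη_pos : ∀ t, 1 ≤ t → 0 < η t)
    (hη_sum : ¬ Summable fun t : ℕ => η (t + 1))
    (hη_sq : Summable fun t : ℕ => η (t + 1) ^ 2)
    (θ₀ : AdaptiveSGD.Param d)
    (μ : Measure Ω) [IsProbabilityMeasure μ]
    (X : ℕ → Ω → 𝒳) (Y : ℕ → Ω → 𝒜 → ℝ) (A : ℕ → Ω → 𝒜)
    (hdata : M.IsAdaptiveData η θ₀ μ X Y A) :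
    TendstoInMeasure μ (M.Shat η θ₀ X Y A) atTop (fun _ => M.S θstar) ∧
      TendstoInMeasure μ (M.Hhat η θ₀ X Y A) atTop (fun _ => M.H θstar) := by
  have hd := h6.differentiable_loss
  refine ⟨AdaptiveSGD.tendstoInMeasure_matrix_of_apply fun i j => ?_,
    AdaptiveSGD.tendstoInMeasure_matrix_of_apply fun i j => ?_⟩
  -- The two factors `w_t` are shared between the coordinates, so the entry is a product of two
  -- weighted statistics.
  · have h := ((AdaptiveSGD.Model.regularStatistic_gradLoss hd h4 h5
      i).continuousStatistic_weighted_mul (AdaptiveSGD.Model.regularStatistic_gradLoss hd h4 h5 j)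
      h1).tendstoInMeasure_average hdata hd h1 h2 h4 h5 hη_pos hη_sum hη_sq
    rw [← AdaptiveSGD.Model.S_apply hd h1 h2 h4 h5] at h
    refine h.congr_left fun n => ae_of_all _ fun ω => ?_
    simp only [AdaptiveSGD.Model.Shat, Matrix.smul_apply, Matrix.sum_apply, smul_eq_mul,
      AdaptiveSGD.outer, Matrix.of_apply, AdaptiveSGD.Model.weighted, AdaptiveSGD.Model.obs]
    congr 1
    exact Finset.sum_congr rfl fun s _ => by ring
  · have h := ((AdaptiveSGD.Model.regularStatistic_hessLoss h6 i
      j).continuousStatistic_weighted h1).tendstoInMeasure_average hdata hd h1 h2 h4 h5 hη_pos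
      hη_sum hη_sq
    rw [← AdaptiveSGD.Model.H_apply h1 h2 h3 h4 h5 h6] at h
    refine h.congr_left fun n => ae_of_all _ fun ω => ?_
    simp only [AdaptiveSGD.Model.Hhat, Matrix.smul_apply, Matrix.sum_apply, smul_eq_mul,
      AdaptiveSGD.Model.weighted, AdaptiveSGD.Model.obs]
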